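/- Let $p$ be an odd prime, let $\overline{\mathbb{Q}}_p$ be an algebraic closure of $\mathbb{Q}_p$, let $K\subset\overline{\mathbb{Q}}_p$ be a finite unramified extension of $\mathbb{Q}_p$ of degree $d$, let $q=p^d$, and let $\mathfrak{O}_K$ be the valuation ring of $K$. Let $\{a_i : 0\le i\le d-1\}$ be a $\mathbb{Z}_p$-basis of $\mathfrak{O}_K$ with $a_0=1$ and every $a_i$ a $(q-1)$th root of unity. Let $\gamma\in\overline{\mathbb{Q}}_p$ satisfy $\gamma^{p-1}=-p$, let $E_\gamma(X)=\exp(\gamma X-\gamma X^p)$ be Dwork's exponential, regarded as a formal power series, and let $e_i=E_\gamma(X)|_{X=a_i}$ be its $p$-adic value at $a_i$ (the series converges at each $a_i$). Let $\zeta_p$ be a primitive $p$th root of unity and $K'=K(\zeta_p)$. For a finite Galois extension $M/K$ with group $G$, let $\mathfrak{O}_M$ be the integral closure of $\mathfrak{O}_K$ in $M$, let $\mathfrak{D}_{M/K}$ be its different, so that $\mathfrak{D}_{M/K}^{-1}=\{z\in M : \mathrm{Tr}_{M/K}(z\,\mathfrak{O}_M)\subseteq\mathfrak{O}_K\}$,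 and let $A_{M/K}$ denote the unique fractional $\mathfrak{O}_M$-ideal with $A_{M/K}^2=\mathfrak{D}_{M/K}^{-1}$, when it exists. **Theorem.** Let $x=\prod_{i=0}^{d-1}e_i^{n_i}$ with integers $0\le n_i\le p-1$, not all zero, and let $x^{1/p}\in\overline{\mathbb{Q}}_p$ be any $p$th root of $x$. Then there is exactly one field $M$ with $K\subseteq M\subseteq K'(x^{1/p})$ and $[M:K]=p$. The extension $M/K$ is Galois and $A_{M/K}$ exists and is unique. Put $\Delta=\mathrm{Gal}(K'(x^{1/p})/M)$, $G=\mathrm{Gal}(M/K)$ and $\mathrm{Tr}_\Delta(z)=\sum_{\delta\in\Delta}\delta(z)$. Then $$\alpha=\frac{1+\mathrm{Tr}_\Delta(x^{1/p})}{p}$$ lies in $M$ and is a self-dual integral normal basis generator of $A_{M/K}$: the map $\mathfrak{O}_K[G]\to M$, $\sum_g r_g g\mapsto\sum_g r_g\,g(\alpha)$, is injective with image $A_{M/K}$, and for all $g,h\in G$ the trace $\mathrm{Tr}_{M/K}(g(\alpha)h(\alpha))$ equals $1$ if $g=h$ and $0$ if $g\ne h$. -/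

import Mathlib

open scoped nonZeroDivisors

noncomputable section

/-! ### Dwork's exponential power series -/

/-- Dwork's exponential power series `E_γ(X) = exp(γ X - γ X ^ p)`, as a formal power series. -/
def dworkSeries {F : Type*} [Field F] [CharZero F] (p : ℕ) (γ : F) : PowerSeries F :=
  (PowerSeries.exp F).subst
    (PowerSeries.C γ * PowerSeries.X - PowerSeries.C γ * PowerSeries.X ^ p : PowerSeries F)

/-- The series of terms obtained by putting `X = η` in Dwork's exponential power series. -/
def dworkTerm (p : ℕ) [Fact p.Prime] (γ η : PadicAlgCl p) (n : ℕ) : PadicAlgCl p :=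
  PowerSeries.coeff n (dworkSeries p γ) * η ^ n

/-- `E_γ(X)|_{X = η}`: the `p`-adic value at `η` of Dwork's exponential power series. -/
def dworkValue (p : ℕ) [Fact p.Prime] (γ η : PadicAlgCl p) : PadicAlgCl p :=
  ∑' n, dworkTerm p γ η n

/-! ### The fields and rings -/

/-- The valuation ring of an algebraic extension `K` of `ℚ_[p]`: the integral closure of
`ℤ_[p]` in `K`. -/
abbrev padicIntegers (p : ℕ) [Fact p.Prime] (K : Type*) [Field K] [Algebra ℤ_[p] K] :
    Subalgebra ℤ_[p] K :=
  integralClosure ℤ_[p] K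

/-- The field `K'(y)` with `K' = K(ζ)`, regarded as an extension of `K`. -/
def kummerExt (K : Type*) {Ω : Type*} [Field K] [Field Ω] [Algebra K Ω] (ζ y : Ω) :
    IntermediateField K Ω :=
  (IntermediateField.adjoin (IntermediateField.adjoin K {ζ}) {y}).restrictScalars K

/-- `K'(y)` is finite over `K` for an intermediate extension `ℚ_[p] ⊆ K ⊆ PadicAlgCl p`. -/
instance kummerExt.finiteDimensional {p : ℕ} [Fact p.Prime] (K : Type*) [Field K]
    [Algebra ℚ_[p] K] [Algebra K (PadicAlgCl p)] [IsScalarTower ℚ_[p] K (PadicAlgCl p)]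
    (ζ y : PadicAlgCl p) : FiniteDimensional K (kummerExt K ζ y) := by
  have h0 : Algebra.IsAlgebraic K (PadicAlgCl p) :=
    Algebra.IsAlgebraic.tower_top (K := ℚ_[p]) _
  have h1 : FiniteDimensional K (IntermediateField.adjoin K {ζ}) :=
    IntermediateField.adjoin.finiteDimensional (Algebra.IsIntegral.isIntegral ζ)
  have h2 : Algebra.IsAlgebraic (IntermediateField.adjoin K {ζ}) (PadicAlgCl p) :=
    Algebra.IsAlgebraic.tower_top (K := K) _
  have h3 : FiniteDimensional (IntermediateField.adjoin K {ζ})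
      (IntermediateField.adjoin (IntermediateField.adjoin K {ζ}) {y}) :=
    IntermediateField.adjoin.finiteDimensional (Algebra.IsIntegral.isIntegral y)
  exact FiniteDimensional.trans K (IntermediateField.adjoin K {ζ})
    (IntermediateField.adjoin (IntermediateField.adjoin K {ζ}) {y})

/-- The element `y` of `K'(y)`. -/
def kummerGen (K : Type*) {Ω : Type*} [Field K] [Field Ω] [Algebra K Ω] (ζ y : Ω) :
    kummerExt K ζ y :=
  ⟨y, IntermediateField.mem_adjoin_simple_self (IntermediateField.adjoin K {ζ}) y⟩

/-- `Tr_Δ(z) = ∑_{δ ∈ Δ} δ(z)`, where `Δ` is the group of automorphisms of `L` over `M`. -/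
def galTrace (M : Type*) {L : Type*} [Field M] [Field L] [Algebra M L] [FiniteDimensional M L]
    (z : L) : L :=
  ∑ δ : Gal(L/M), δ z

/-! ### The square root of the inverse different and self-dual integral normal bases -/

/-- `A ^ 2 = 𝔇⁻¹`, for a fractional ideal `A` of the integral closure `S` of `R` in `L`, where `𝔇`
is the different of `L/K` (`R` having fraction field `K`): the inverse different `𝔇⁻¹` is the dual
`{x ∈ L | Tr_{L/K}(x S) ⊆ R}` of `S` with respect to the trace form. -/
def IsSqrtInverseDifferent (R K : Type*) {L : Type*} [CommRing R] [Field K] [Field L]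
    [Algebra R K] [Algebra R L] [Algebra K L] [IsScalarTower R K L]
    (A : FractionalIdeal (integralClosure R L)⁰ L) : Prop :=
  ((A ^ 2 : FractionalIdeal (integralClosure R L)⁰ L) : Submodule (integralClosure R L) L) =
    Submodule.traceDual R K (1 : Submodule (integralClosure R L) L)

/-- The action of an element `∑ r_g g` of the group ring `R[G]`, `G = Gal(L/K)`, on `x ∈ L`:
the element `∑ r_g g(x)`. -/
def groupRingAct {R K L : Type*} [CommRing R] [Field K] [Field L] [Algebra R L] [Algebra K L]
    (a : MonoidAlgebra R Gal(L/K)) (x : L) : L :=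
  a.coeff.sum fun g r => r • g x

/-- `α` is a self-dual integral normal basis generator of `A ⊆ L`: `A` is the free
`R[Gal(L/K)]`-module on `α`, and the conjugates of `α` are orthonormal for the trace form. -/
structure IsSelfDualIntegralNormalBasisGenerator (R K : Type*) {L : Type*} [CommRing R] [Field K]
    [Field L] [Algebra R L] [Algebra K L] (A : Set L) (α : L) : Prop where
  generates : Set.range (fun a : MonoidAlgebra R Gal(L/K) => groupRingAct a α) = A
  free : Function.Injective (fun a : MonoidAlgebra R Gal(L/K) => groupRingAct a α)
  trace_self : ∀ g : Gal(L/K), Algebra.trace K L (g α * g α) = 1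
  trace_ne : ∀ g h : Gal(L/K), g ≠ h → Algebra.trace K L (g α * h α) = 0

end

/-! Write E_c = exp(cX − cX^p), so that E_{c+c'} = E_c E_{c'}. The numbers n!·[X^n]E_γ are γ^n times
the number of permutations of n points with trivial p-th power. These counts are divisible by high
powers of p (`pow_dvd_rootCount`), so E_γ converges on the closed unit disc and E_γ(η) ≡ 1 + γη mod
γ². As E_γ^p = E_{pγ} and E_{pγ}(1) = 1, the value E_γ(1) is a primitive p-th root of unity; hence
K' = K(γ), totally ramified of degree p − 1 over K.

Let an automorphism σ send ζ to ζ^u. Then σγ/γ is a (p−1)th root of unity, and u can be chosen so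
close to it that σγ = uγ + pc with c small. Therefore E_{σγ} = E_γ^u E_c^p, that is σ(e_i) = e_i^u
w^p with w in K' (`exists_map_eq_pow_mul_pow`). So the Galois group acts on x, modulo p-th powers,
through the cyclotomic character, and L = K'(y), with y = x^{1/p}, is abelian over K. Since Σ n_i
a_i is a unit, |x − 1| = |γ|, whence |y − 1|^p = |γ|: L/K is totally ramified of degree p(p−1) with
uniformizer y − 1. An abelian group of this order has exactly one subgroup of order p − 1, which
gives M.

The element of Δ inverting ζ sends γ to −γ, hence inverts x, and even y because p is odd. Kummer
theory kills the trace of y·δ(σy) for every other δ in Δ, so the conjugates of α are orthonormal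
(`IsRamifiedKummer.trace_mul_map`).

Let π be the norm of a uniformizer of M and A = {z : |z| ≤ π^(1−p)}. Expansion in powers of y − 1
shows Tr(A·A) ⊆ 𝔒_K (`IsRamifiedKummer.norm_trace_mul_le_one`), and α lies in A because 1 + Tr_Δ(y)
has norm less than 1. An orthonormal basis inside a lattice on which the trace form is integral
spans that lattice, so A is free on α and is its own dual; since A is principal, A² is then the dual
of 𝔒_M. Square roots of fractional ideals are unique over an integrally closed domain. -/

/-! ### Formal identities for exp(cX − cX^p) -/

open PowerSeries in
theorem derivative_exp_subst {F : Type*} [Field F] [CharZero F] {g : PowerSeries F}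
    (hg : constantCoeff g = 0) :
    PowerSeries.derivative F ((exp F).subst g) =
      (exp F).subst g * PowerSeries.derivative F g := by
  rw [derivative_subst (HasSubst.of_constantCoeff_zero' hg), derivative_exp]

open PowerSeries in
theorem constantCoeff_exp_subst {F : Type*} [Field F] [CharZero F] {g : PowerSeries F}
    (hg : constantCoeff g = 0) : constantCoeff ((exp F).subst g) = 1 := by
  rw [← coeff_zero_eq_constantCoeff_apply, coeff_subst' (HasSubst.of_constantCoeff_zero' hg),
    finsum_eq_single _ 0]
  · simp
  · intro n hn
    simp [hg, hn]

-- Multiplied by exp(−(f+g)), each side has zero derivative and constant term 1, hence becomes 1.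
open PowerSeries in
theorem exp_subst_add {F : Type*} [Field F] [CharZero F] {f g : PowerSeries F}
    (hf : constantCoeff f = 0) (hg : constantCoeff g = 0) :
    (exp F).subst (f + g) = (exp F).subst f * (exp F).subst g := by
  have hfg : constantCoeff (f + g) = 0 := by simp [hf, hg]
  have hn : constantCoeff (-(f + g)) = 0 := by rw [map_neg, hfg, neg_zero]
  have h1 : (exp F).subst (f + g) * (exp F).subst (-(f + g)) = 1 := by
    refine derivative.ext (R := F) ?_ ?_
    · rw [Derivation.leibniz, derivative_exp_subst hfg, derivative_exp_subst hn]
      simp only [smul_eq_mul, map_neg, map_add, derivative_one]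
      ring
    · rw [map_mul, constantCoeff_exp_subst hfg, constantCoeff_exp_subst hn, map_one, mul_one]
  have h2 : (exp F).subst f * (exp F).subst g * (exp F).subst (-(f + g)) = 1 := by
    refine derivative.ext (R := F) ?_ ?_
    · rw [Derivation.leibniz, Derivation.leibniz, derivative_exp_subst hf,
        derivative_exp_subst hg, derivative_exp_subst hn]
      simp only [smul_eq_mul, map_neg, map_add, derivative_one]
      ring
    · rw [map_mul, map_mul, constantCoeff_exp_subst hf, constantCoeff_exp_subst hg,
        constantCoeff_exp_subst hn, map_one, mul_one, mul_one]
  have h3 : (exp F).subst (-(f + g)) ≠ 0 := by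
    intro h
    rw [h, mul_zero] at h1
    exact zero_ne_one h1
  exact mul_right_cancel₀ h3 (h1.trans h2.symm)

open PowerSeries in
theorem constantCoeff_dwork_exponent {F : Type*} [Field F] {p : ℕ} (hp : p ≠ 0) (c : F) :
    constantCoeff (C c * X - C c * X ^ p : PowerSeries F) = 0 := by
  simp [hp]

theorem dworkSeries_add {F : Type*} [Field F] [CharZero F] {p : ℕ} (hp : p ≠ 0) (c c' : F) :
    dworkSeries p (c + c') = dworkSeries p c * dworkSeries p c' := by
  rw [dworkSeries, dworkSeries, dworkSeries,
    ← exp_subst_add (constantCoeff_dwork_exponent hp c) (constantCoeff_dwork_exponent hp c')]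
  congr 1
  rw [map_add]
  ring

theorem dworkSeries_zero {F : Type*} [Field F] [CharZero F] {p : ℕ} (hp : p ≠ 0) :
    dworkSeries p (0 : F) = 1 := by
  have h := dworkSeries_add hp (0 : F) 0
  rw [add_zero] at h
  have h3 : dworkSeries p (0 : F) ≠ 0 := by
    intro h0
    have := constantCoeff_exp_subst (constantCoeff_dwork_exponent hp (0 : F))
    rw [← dworkSeries, h0, map_zero] at this
    exact zero_ne_one this
  exact mul_left_cancel₀ h3 (by rw [← h, mul_one])

theorem dworkSeries_nsmul {F : Type*} [Field F] [CharZero F] {p : ℕ} (hp : p ≠ 0) (k : ℕ) (c : F) :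
    dworkSeries p (k * c) = dworkSeries p c ^ k := by
  induction k with
  | zero => simp [dworkSeries_zero hp]
  | succ k ih => rw [pow_succ, ← ih, ← dworkSeries_add hp]; push_cast; ring_nf

/-- The numbers `n! * coeff n (dworkSeries p c)`. -/
noncomputable def dworkNum {F : Type*} [Field F] [CharZero F] (p : ℕ) (c : F) (n : ℕ) : F :=
  n.factorial * PowerSeries.coeff n (dworkSeries p c)

theorem dworkNum_zero {F : Type*} [Field F] [CharZero F] {p : ℕ} (hp : p ≠ 0) (c : F) :
    dworkNum p c 0 = 1 := by
  simpa [dworkNum, dworkSeries] using constantCoeff_exp_subst (constantCoeff_dwork_exponent hp c)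

-- The differential equation E' = (c − pcX^(p−1))E, read off coefficientwise after clearing
-- factorials. For n < p − 1 the descending factorial vanishes, so the truncated index n − (p − 1)
-- does no harm.
open PowerSeries in
theorem dworkNum_succ {F : Type*} [Field F] [CharZero F] {p : ℕ} (hp : p ≠ 0) (c : F) (n : ℕ) :
    dworkNum p c (n + 1) =
      c * dworkNum p c n - p * c * n.descFactorial (p - 1) * dworkNum p c (n - (p - 1)) := by
  have h := derivative_exp_subst (constantCoeff_dwork_exponent hp c)
  rw [← dworkSeries] at h
  have h2 : dworkSeries p c * PowerSeries.derivative F (C c * X - C c * X ^ p) =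
      C c * dworkSeries p c - C (p * c) * (X ^ (p - 1) * dworkSeries p c) := by
    simp only [map_sub, Derivation.leibniz, derivative_C, derivative_X, derivative_pow, smul_eq_mul,
      map_mul, map_natCast]
    ring
  rw [h2] at h
  have h3 := congrArg (coeff n) h
  rw [coeff_derivative, map_sub, coeff_C_mul, coeff_C_mul, coeff_X_pow_mul'] at h3
  simp only [dworkNum, Nat.factorial_succ]
  push_cast
  rw [show ((n : F) + 1) * (n.factorial : F) * coeff (n + 1) (dworkSeries p c) =
    n.factorial * (coeff (n + 1) (dworkSeries p c) * (n + 1)) by ring, h3]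
  split_ifs with hn
  · rw [← Nat.factorial_mul_descFactorial hn]
    push_cast
    ring
  · rw [Nat.descFactorial_of_lt (by omega)]
    push_cast
    ring

/-! ### Divisibility of the number of solutions of σ^p = 1 in the symmetric group -/

/-- The number of permutations of `n` points whose `p`-th power is trivial, by its recurrence. -/
def rootCount (p : ℕ) : ℕ → ℕ
  | 0 => 1
  | n + 1 => rootCount p n + n.descFactorial (p - 1) * rootCount p (n - (p - 1))

/-- The relation γ^(p−1) = −p absorbs both the sign and the factor p of the recurrence into γ^(n+1),
leaving a recurrence in natural numbers. -/
theorem dworkNum_eq_rootCount {F : Type*} [Field F] [CharZero F] {p : ℕ} (hp : p ≠ 0) {γ : F}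
    (hγ : γ ^ (p - 1) = -(p : F)) (n : ℕ) : dworkNum p γ n = γ ^ n * rootCount p n := by
  induction n using Nat.strong_induction_on with
  | _ n ih =>
    cases n with
    | zero => simp [dworkNum_zero hp, rootCount]
    | succ n =>
      rw [dworkNum_succ hp, ih n (by omega), ih (n - (p - 1)) (by omega), rootCount]
      push_cast
      rcases le_or_gt (p - 1) n with hn | hn
      · have : γ ^ (n + 1) = -(p * γ) * γ ^ (n - (p - 1)) := by
          conv_lhs => rw [show n + 1 = (p - 1) + 1 + (n - (p - 1)) by omega, pow_add, pow_succ, hγ]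
          ring
        have h2 : γ * γ ^ n = γ ^ (n + 1) := by ring
        linear_combination (-(n.descFactorial (p - 1) : F) * (rootCount p (n - (p - 1)))) * this
      · rw [Nat.descFactorial_of_lt hn]
        push_cast
        ring

/-- The p − 1 consecutive factors n, …, n − p + 2 miss the multiples of p only when n ≡ −1 mod p; in
that exceptional case the product is −1 mod p by Wilson, which is the next lemma. -/
theorem prime_dvd_descFactorial {p n : ℕ} (hp : p.Prime) (hn : n % p ≠ p - 1) :
    p ∣ n.descFactorial (p - 1) := by
  have h1 := Nat.mod_lt n hp.pos
  rw [Nat.descFactorial_eq_prod_range]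
  exact (Nat.dvd_sub_mod n).trans (Finset.dvd_prod_of_mem _ (Finset.mem_range.2 (by omega)))

theorem prime_dvd_descFactorial_add_one {p n : ℕ} (hp : p.Prime) (hn : n % p = p - 1) :
    p ∣ n.descFactorial (p - 1) + 1 := by
  have := Fact.mk hp
  rw [← ZMod.natCast_eq_zero_iff, Nat.descFactorial_eq_factorial_mul_choose]
  push_cast
  have h := Choose.choose_modEq_choose_mod_mul_choose_div_nat (n := n) (k := p - 1) (p := p)
  rw [hn, Nat.mod_eq_of_lt (Nat.sub_lt hp.pos one_pos), Nat.choose_self,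
    Nat.div_eq_of_lt (Nat.sub_lt hp.pos one_pos), Nat.choose_zero_right] at h
  rw [(ZMod.natCast_eq_natCast_iff _ _ _).2 h, ZMod.wilsons_lemma]
  simp

/-- Divisibility by p^k on the two preceding blocks of length p improves to p^(k+1) on the next one.
Modulo p^(k+1) the count is constant along a block, since the added terms carry an extra p, and the
passage to the next block multiplies it by 1 + (−1) modulo p. -/
theorem pow_succ_dvd_rootCount_block {p : ℕ} (hp : p.Prime) {N k : ℕ} (hN : p ∣ N) (hN0 : N ≠ 0)
    (h : ∀ j, N - 2 * p ≤ j → j < N → p ^ k ∣ rootCount p j) :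
    ∀ r < p, p ^ (k + 1) ∣ rootCount p (N + r) := by
  have hp1 := hp.two_le
  obtain ⟨m, rfl⟩ : ∃ m, N = p * (m + 1) := by
    obtain ⟨m, rfl⟩ := hN
    exact ⟨m - 1, by rw [Nat.sub_add_cancel (Nat.pos_of_ne_zero fun h0 => hN0 (by rw [h0, mul_zero]))]⟩
  rw [mul_add, mul_one] at *
  -- From here on N is the start of the preceding block, and the block to be treated starts at N +
  -- p.
  set N := p * m with hNm
  have hmod : ∀ r < p, (N + r) % p = r := fun r hr => by
    rw [hNm, Nat.mul_add_mod, Nat.mod_eq_of_lt hr]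
  have step : ∀ n r, n % p = r → r + 1 < p → N ≤ n → n - (p - 1) < N + p →
      p ^ (k + 1) ∣ n.descFactorial (p - 1) * rootCount p (n - (p - 1)) := by
    intro n r hr hr1 h2 h3
    rw [pow_succ, mul_comm (p ^ k)]
    exact mul_dvd_mul (prime_dvd_descFactorial hp (by omega)) (h _ (by omega) h3)
  have ha : ∀ r < p, (p ^ (k + 1) : ℤ) ∣ rootCount p (N + r) - rootCount p N := by
    intro r
    induction r with
    | zero => simp
    | succ r ih =>
      intro hr
      have h1 := step (N + r) r (hmod r (by omega)) hr (by omega) (by omega)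
      rw [← add_assoc, rootCount]
      have h2 := ih (by omega)
      zify at h1
      push_cast
      exact (dvd_add h2 h1).trans (dvd_of_eq (by ring))
  -- Crossing the block boundary: the new value is congruent to (descending factorial + 1) times the
  -- value at N, and Wilson makes the first factor divisible by p.
  have hb : p ^ (k + 1) ∣ rootCount p (N + p) := by
    have h1 := ha (p - 1) (by omega)
    have h2 := prime_dvd_descFactorial_add_one hp (hmod (p - 1) (by omega))
    rw [show N + p = (N + (p - 1)) + 1 by omega, rootCount,
      show N + (p - 1) - (p - 1) = N by omega]
    have h3 : p ^ (k + 1) ∣ ((N + (p - 1)).descFactorial (p - 1) + 1) * rootCount p N := by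
      rw [pow_succ, mul_comm (p ^ k)]
      exact mul_dvd_mul h2 (h _ (by omega) (by omega))
    zify at h3 ⊢
    exact (dvd_add h1 h3).trans (dvd_of_eq (by ring))
  intro r
  induction r with
  | zero => intro _; exact hb
  | succ r ih =>
    intro hr
    have h1 := step (N + p + r) r (by rw [add_right_comm, Nat.add_mod_right]; exact hmod r (by omega)) hr
      (by omega) (by omega)
    rw [← add_assoc, rootCount]
    exact dvd_add (ih (by omega)) h1

theorem pow_dvd_rootCount {p : ℕ} (hp : p.Prime) (n : ℕ) :
    p ^ ((n / p + 1) / 2) ∣ rootCount p n := by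
  have key : ∀ m, ∀ r < p, p ^ ((m + 1) / 2) ∣ rootCount p (p * m + r) := by
    intro m
    induction m using Nat.strong_induction_on with
    | _ m ih =>
      rcases Nat.eq_zero_or_pos m with rfl | hm
      · simp
      have h2 : (m + 1) / 2 = (m - 1) / 2 + 1 := by omega
      rw [h2]
      refine pow_succ_dvd_rootCount_block hp (dvd_mul_right p m)
        (Nat.mul_ne_zero hp.ne_zero hm.ne') fun j h1 h3 => ?_
      have hj : j / p < m := Nat.div_lt_of_lt_mul h3
      have hj2 : m ≤ j / p + 2 := by
        have : p * m ≤ j + 2 * p := by omega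
        have h4 := Nat.div_le_div_right (c := p) this
        rwa [Nat.mul_div_cancel_left _ hp.pos, Nat.add_mul_div_right _ _ hp.pos] at h4
      have h5 := ih (j / p) hj (j % p) (Nat.mod_lt _ hp.pos)
      rw [Nat.div_add_mod] at h5
      exact (pow_dvd_pow p (by omega)).trans h5
  have := key (n / p) (n % p) (Nat.mod_lt _ hp.pos)
  rwa [Nat.div_add_mod] at this

/-! ### Norm estimates for the coefficients -/

open Filter Topology

theorem IsUltrametricDist.norm_sub_le_max_norm {E : Type*} [SeminormedAddCommGroup E]
    [IsUltrametricDist E] (x y : E) : ‖x - y‖ ≤ max ‖x‖ ‖y‖ := by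
  rw [sub_eq_add_neg, ← norm_neg y]
  exact IsUltrametricDist.norm_add_le_max _ _

instance PadicAlgCl.nonarchimedeanRing (p : ℕ) [Fact p.Prime] : NonarchimedeanRing (PadicAlgCl p) where
  is_nonarchimedean := NonarchimedeanAddGroup.is_nonarchimedean

theorem PadicAlgCl.norm_natCast (p : ℕ) [Fact p.Prime] (n : ℕ) :
    ‖(n : PadicAlgCl p)‖ = ‖(n : ℚ_[p])‖ := by
  rw [← map_natCast (algebraMap ℚ_[p] (PadicAlgCl p)), norm_algebraMap']

theorem PadicAlgCl.norm_prime (p : ℕ) [Fact p.Prime] : ‖(p : PadicAlgCl p)‖ = (p : ℝ)⁻¹ := by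
  rw [norm_natCast, Padic.norm_p]

theorem PadicAlgCl.norm_prime_pos (p : ℕ) [Fact p.Prime] : 0 < ‖(p : PadicAlgCl p)‖ := by
  rw [norm_prime]
  have := (Fact.out : p.Prime).pos
  positivity

theorem PadicAlgCl.norm_prime_lt_one (p : ℕ) [Fact p.Prime] : ‖(p : PadicAlgCl p)‖ < 1 := by
  rw [norm_prime]
  exact inv_lt_one_of_one_lt₀ (by exact_mod_cast (Fact.out : p.Prime).one_lt)

theorem PadicAlgCl.norm_natCast_le_one (p : ℕ) [Fact p.Prime] (n : ℕ) :
    ‖(n : PadicAlgCl p)‖ ≤ 1 := IsUltrametricDist.norm_natCast_le_one _ n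

theorem PadicAlgCl.norm_natCast_eq_one {p : ℕ} [Fact p.Prime] {n : ℕ} (h : ¬ p ∣ n) :
    ‖(n : PadicAlgCl p)‖ = 1 := by
  rw [norm_natCast]
  exact Padic.norm_natCast_eq_one_iff.2 (((Fact.out : p.Prime).coprime_iff_not_dvd).2 h)

theorem PadicAlgCl.norm_natCast_le_pow {p : ℕ} [Fact p.Prime] {n k : ℕ} (h : p ^ k ∣ n) :
    ‖(n : PadicAlgCl p)‖ ≤ ‖(p : PadicAlgCl p)‖ ^ k := by
  obtain ⟨m, rfl⟩ := h
  push_cast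
  rw [norm_mul, norm_pow]
  exact mul_le_of_le_one_right (by positivity) (norm_natCast_le_one p m)

section DworkRoot

variable {p : ℕ} [Fact p.Prime] {γ : PadicAlgCl p}

theorem norm_pow_of_pow_eq (hγ : γ ^ (p - 1) = -(p : PadicAlgCl p)) :
    ‖γ‖ ^ (p - 1) = ‖(p : PadicAlgCl p)‖ := by
  rw [← norm_pow, hγ, norm_neg]

theorem norm_pos_of_pow_eq (hγ : γ ^ (p - 1) = -(p : PadicAlgCl p)) : 0 < ‖γ‖ := by
  rw [norm_pos_iff]
  rintro rfl
  rw [zero_pow (Nat.sub_ne_zero_of_lt (Fact.out : p.Prime).one_lt), zero_eq_neg] at hγ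
  have := PadicAlgCl.norm_prime_pos p
  rw [hγ, norm_zero] at this
  exact lt_irrefl _ this

theorem norm_lt_one_of_pow_eq (hγ : γ ^ (p - 1) = -(p : PadicAlgCl p)) : ‖γ‖ < 1 := by
  by_contra! h
  have h1 := one_le_pow₀ (n := p - 1) h
  rw [norm_pow_of_pow_eq hγ] at h1
  exact absurd (PadicAlgCl.norm_prime_lt_one p) (not_lt.2 h1)

theorem norm_prime_le_of_pow_eq (hγ : γ ^ (p - 1) = -(p : PadicAlgCl p)) :
    ‖(p : PadicAlgCl p)‖ ≤ ‖γ‖ := by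
  rw [← norm_pow_of_pow_eq hγ]
  exact pow_le_of_le_one (norm_nonneg _) (norm_lt_one_of_pow_eq hγ).le
    (Nat.sub_ne_zero_of_lt (Fact.out : p.Prime).one_lt)

theorem norm_factorial_eq (hγ : γ ^ (p - 1) = -(p : PadicAlgCl p)) (n : ℕ) :
    ‖(n.factorial : PadicAlgCl p)‖ = ‖γ‖ ^ ((p - 1) * padicValNat p n.factorial) := by
  rw [pow_mul, norm_pow_of_pow_eq hγ, PadicAlgCl.norm_natCast, PadicAlgCl.norm_natCast,
    Padic.norm_eq_zpow_neg_valuation (by exact_mod_cast n.factorial_ne_zero),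
    Padic.valuation_natCast, Padic.norm_p, zpow_neg, inv_pow, zpow_natCast]

/-- Legendre's formula gives (p − 1)·v_p(n!) < n, and |p| = |γ|^(p−1). -/
theorem pow_le_norm_factorial (hγ : γ ^ (p - 1) = -(p : PadicAlgCl p)) {n : ℕ} (hn : n ≠ 0) :
    ‖γ‖ ^ (n - 1) ≤ ‖(n.factorial : PadicAlgCl p)‖ := by
  rw [norm_factorial_eq hγ]
  have := sub_one_mul_padicValNat_factorial_lt_of_ne_zero p hn
  exact pow_le_pow_of_le_one (norm_nonneg _) (norm_lt_one_of_pow_eq hγ).le (by omega)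

theorem norm_coeff_dworkSeries (c : PadicAlgCl p) (n : ℕ) :
    ‖PowerSeries.coeff n (dworkSeries p c)‖ * ‖(n.factorial : PadicAlgCl p)‖ =
      ‖dworkNum p c n‖ := by
  rw [dworkNum, norm_mul, mul_comm]

theorem norm_coeff_dworkSeries_le_of_dworkNum (hγ : γ ^ (p - 1) = -(p : PadicAlgCl p))
    {c : PadicAlgCl p} {n : ℕ} (hn : n ≠ 0) {s : ℝ}
    (h : ‖dworkNum p c n‖ ≤ s * ‖γ‖ ^ n) :
    ‖PowerSeries.coeff n (dworkSeries p c)‖ ≤ ‖γ‖ * s := by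
  have h1 := norm_coeff_dworkSeries c n
  have h2 := pow_le_norm_factorial hγ hn
  have h3 : 0 < ‖γ‖ ^ (n - 1) := pow_pos (norm_pos_of_pow_eq hγ) _
  refine le_of_mul_le_mul_right ?_ h3
  calc _ ≤ _ := mul_le_mul_of_nonneg_left h2 (norm_nonneg _)
    _ ≤ s * ‖γ‖ ^ n := h1.trans_le h
    _ = ‖γ‖ * s * ‖γ‖ ^ (n - 1) := by
      conv_lhs => rw [show n = (n - 1) + 1 by omega, pow_succ]
      ring

/-- For exp(γX) alone the bound is just |γ|, which does not give convergence at points of norm 1;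
the power of p gained from `pow_dvd_rootCount` does. -/
theorem norm_coeff_dworkSeries_le (hγ : γ ^ (p - 1) = -(p : PadicAlgCl p)) {n : ℕ} (hn : n ≠ 0) :
    ‖PowerSeries.coeff n (dworkSeries p γ)‖ ≤
      ‖γ‖ * ‖(p : PadicAlgCl p)‖ ^ ((n / p + 1) / 2) := by
  refine norm_coeff_dworkSeries_le_of_dworkNum hγ hn ?_
  rw [dworkNum_eq_rootCount (Fact.out : p.Prime).ne_zero hγ, norm_mul, norm_pow, mul_comm]
  exact mul_le_mul_of_nonneg_right
    (PadicAlgCl.norm_natCast_le_pow (pow_dvd_rootCount Fact.out n)) (by positivity)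

theorem norm_coeff_dworkSeries_le_sq (hγ : γ ^ (p - 1) = -(p : PadicAlgCl p)) {n : ℕ}
    (hn : 2 ≤ n) : ‖PowerSeries.coeff n (dworkSeries p γ)‖ ≤ ‖γ‖ ^ 2 := by
  have hp : p.Prime := Fact.out
  rcases lt_or_ge n p with h | h
  · have h1 := norm_coeff_dworkSeries γ n
    rw [PadicAlgCl.norm_natCast_eq_one (fun h2 => by rw [hp.dvd_factorial] at h2; omega), mul_one,
      dworkNum_eq_rootCount hp.ne_zero hγ, norm_mul, norm_pow] at h1
    rw [h1]
    calc _ ≤ ‖γ‖ ^ n * 1 := by gcongr; exact PadicAlgCl.norm_natCast_le_one p _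
      _ ≤ ‖γ‖ ^ 2 := by
        rw [mul_one]
        exact pow_le_pow_of_le_one (norm_nonneg _) (norm_lt_one_of_pow_eq hγ).le hn
  · refine (norm_coeff_dworkSeries_le hγ (by omega)).trans ?_
    rw [pow_two]
    gcongr
    refine le_trans (pow_le_of_le_one (norm_nonneg _) (PadicAlgCl.norm_prime_lt_one p).le ?_)
      (norm_prime_le_of_pow_eq hγ)
    have : 1 ≤ n / p := (Nat.one_le_div_iff hp.pos).2 h
    omega

/-- For a parameter c smaller than γ no combinatorics is needed: each use of the recurrence costs a
factor r and advances the index by at most p, so at least ⌈n/p⌉ factors r accumulate. -/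
theorem norm_dworkNum_le (hγ : γ ^ (p - 1) = -(p : PadicAlgCl p)) {c : PadicAlgCl p} {r : ℝ}
    (hr0 : 0 ≤ r) (hr1 : r ≤ 1) (hc : ‖c‖ ≤ r * ‖γ‖) (n : ℕ) :
    ‖dworkNum p c n‖ ≤ r ^ ((n + p - 1) / p) * ‖γ‖ ^ n := by
  have hp : p.Prime := Fact.out
  have hp2 := hp.two_le
  induction n using Nat.strong_induction_on with
  | _ n ih =>
    cases n with
    | zero =>
      rw [dworkNum_zero hp.ne_zero, Nat.div_eq_of_lt (by omega)]
      simp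
    | succ n =>
      rw [dworkNum_succ hp.ne_zero]
      refine (IsUltrametricDist.norm_sub_le_max_norm _ _).trans (max_le ?_ ?_)
      · rw [norm_mul]
        calc _ ≤ (r * ‖γ‖) * (r ^ ((n + p - 1) / p) * ‖γ‖ ^ n) := by
              gcongr; exact ih n (by omega)
          _ = r ^ ((n + p - 1) / p + 1) * ‖γ‖ ^ (n + 1) := by ring
          _ ≤ _ := by
            refine mul_le_mul_of_nonneg_right (pow_le_pow_of_le_one hr0 hr1 ?_) (by positivity)
            rw [← Nat.add_div_right _ hp.pos]
            exact Nat.div_le_div_right (by omega)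
      · rcases lt_or_ge n (p - 1) with h | h
        · rw [Nat.descFactorial_of_lt h]
          simp only [Nat.cast_zero, mul_zero, zero_mul, norm_zero]
          positivity
        · rw [norm_mul, norm_mul, norm_mul]
          calc _ ≤ ‖(p : PadicAlgCl p)‖ * (r * ‖γ‖) * 1 *
                (r ^ ((n - (p - 1) + p - 1) / p) * ‖γ‖ ^ (n - (p - 1))) := by
                gcongr
                · exact PadicAlgCl.norm_natCast_le_one p _
                · exact ih _ (by omega)
            _ = r ^ ((n - (p - 1) + p - 1) / p + 1) *
                (‖γ‖ ^ (p - 1) * ‖γ‖ * ‖γ‖ ^ (n - (p - 1))) := by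
                rw [norm_pow_of_pow_eq hγ]; ring
            _ = r ^ ((n + 1 + p - 1) / p) * ‖γ‖ ^ (n + 1) := by
                rw [← pow_succ, ← pow_add, ← Nat.add_div_right _ hp.pos]
                congr 2 <;> [congr 1; skip] <;> omega

theorem norm_coeff_dworkSeries_small (hγ : γ ^ (p - 1) = -(p : PadicAlgCl p)) {c : PadicAlgCl p}
    {r : ℝ} (hr0 : 0 ≤ r) (hr1 : r ≤ 1) (hc : ‖c‖ ≤ r * ‖γ‖) {n : ℕ} (hn : n ≠ 0) :
    ‖PowerSeries.coeff n (dworkSeries p c)‖ ≤ ‖γ‖ * r ^ ((n + p - 1) / p) :=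
  norm_coeff_dworkSeries_le_of_dworkNum hγ hn (norm_dworkNum_le hγ hr0 hr1 hc n)

theorem tendsto_coeff_dworkSeries (hγ : γ ^ (p - 1) = -(p : PadicAlgCl p)) :
    Tendsto (fun n => PowerSeries.coeff n (dworkSeries p γ)) atTop (𝓝 0) := by
  have hp : p.Prime := Fact.out
  refine squeeze_zero_norm' (a := fun n => ‖γ‖ * ‖(p : PadicAlgCl p)‖ ^ ((n / p + 1) / 2)) ?_ ?_
  · filter_upwards [eventually_ne_atTop 0] with n hn using norm_coeff_dworkSeries_le hγ hn
  · rw [← mul_zero ‖γ‖]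
    refine ((tendsto_pow_atTop_nhds_zero_of_lt_one (norm_nonneg _)
      (PadicAlgCl.norm_prime_lt_one p)).comp ?_).const_mul _
    exact (Nat.tendsto_div_const_atTop two_ne_zero).comp
      ((tendsto_add_atTop_nat 1).comp (Nat.tendsto_div_const_atTop hp.ne_zero))

theorem tendsto_coeff_dworkSeries_small (hγ : γ ^ (p - 1) = -(p : PadicAlgCl p))
    {c : PadicAlgCl p} (hc : ‖c‖ ≤ ‖(p : PadicAlgCl p)‖ * ‖γ‖) :
    Tendsto (fun n => PowerSeries.coeff n (dworkSeries p c)) atTop (𝓝 0) := by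
  have hp : p.Prime := Fact.out
  refine squeeze_zero_norm' (a := fun n => ‖γ‖ * ‖(p : PadicAlgCl p)‖ ^ ((n + p - 1) / p)) ?_ ?_
  · filter_upwards [eventually_ne_atTop 0] with n hn using
      norm_coeff_dworkSeries_small hγ (norm_nonneg _) (PadicAlgCl.norm_prime_lt_one p).le hc hn
  · rw [← mul_zero ‖γ‖]
    refine ((tendsto_pow_atTop_nhds_zero_of_lt_one (norm_nonneg _)
      (PadicAlgCl.norm_prime_lt_one p)).comp ?_).const_mul _
    refine (Nat.tendsto_div_const_atTop hp.ne_zero).comp ?_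
    have := hp.pos
    exact tendsto_atTop_mono (fun n => by simp only [id]; omega) tendsto_id

end DworkRoot

/-! ### Values of the series, and the root of unity E_γ(1) -/

/-- The algebraic closure is not complete, but finite-dimensional subspaces are, and there a
nonarchimedean series converges once its terms tend to 0. The sum staying in N is what later places
the values in K(ζ). -/
theorem exists_hasSum_of_mem {p : ℕ} [Fact p.Prime] (N : Submodule ℚ_[p] (PadicAlgCl p))
    [FiniteDimensional ℚ_[p] N] {f : ℕ → PadicAlgCl p} (hf : ∀ n, f n ∈ N)
    (h0 : Tendsto f atTop (𝓝 0)) : ∃ v ∈ N, HasSum f v := by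
  have : CompleteSpace N := FiniteDimensional.complete ℚ_[p] N
  have hU : IsUltrametricDist N := inferInstance
  have h1 : Tendsto (fun n => (⟨f n, hf n⟩ : N)) cofinite (𝓝 0) := by
    rw [Nat.cofinite_eq_atTop, tendsto_subtype_rng]
    exact h0
  obtain ⟨v, hv⟩ := NonarchimedeanAddGroup.summable_of_tendsto_cofinite_zero h1
  exact ⟨v, v.2, hv.map N.subtype continuous_subtype_val⟩

/-- The power series `f` converges at `η`, with value `v`. -/
def SeriesHasValue {p : ℕ} [Fact p.Prime] (f : PowerSeries (PadicAlgCl p)) (η v : PadicAlgCl p) :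
    Prop :=
  HasSum (fun n => PowerSeries.coeff n f * η ^ n) v

namespace SeriesHasValue

variable {p : ℕ} [Fact p.Prime] {f g : PowerSeries (PadicAlgCl p)} {η v w : PadicAlgCl p}

theorem mul (hf : SeriesHasValue f η v) (hg : SeriesHasValue g η w) :
    SeriesHasValue (f * g) η (v * w) := by
  have h := HasSum.mul_of_nonarchimedean hf hg
  have h2 := (Finset.HasAntidiagonal.sigmaAntidiagonalEquivProd.hasSum_iff.mpr h).sigma
    (fun n => hasSum_fintype _)
  refine h2.congr_fun fun n => ?_
  simp only [Function.comp_apply, Finset.HasAntidiagonal.sigmaAntidiagonalEquivProd_apply]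
  rw [Finset.sum_coe_sort (Finset.HasAntidiagonal.antidiagonal n) (fun x : ℕ × ℕ =>
    PowerSeries.coeff x.1 f * η ^ x.1 * (PowerSeries.coeff x.2 g * η ^ x.2)),
    PowerSeries.coeff_mul, Finset.sum_mul]
  refine Finset.sum_congr rfl fun x hx => ?_
  rw [← Finset.HasAntidiagonal.mem_antidiagonal.1 hx, pow_add]
  ring

theorem one : SeriesHasValue (1 : PowerSeries (PadicAlgCl p)) η 1 := by
  refine (hasSum_ite_eq (0 : ℕ) (1 : PadicAlgCl p)).congr_fun fun n => ?_
  rw [PowerSeries.coeff_one]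
  split_ifs with h <;> simp [h]

theorem pow (hf : SeriesHasValue f η v) (k : ℕ) : SeriesHasValue (f ^ k) η (v ^ k) := by
  induction k with
  | zero => simpa using one
  | succ k ih => simpa [pow_succ] using ih.mul hf

theorem unique (hf : SeriesHasValue f η v) (hg : SeriesHasValue f η w) : v = w :=
  HasSum.unique hf hg

end SeriesHasValue

theorem tendsto_mul_pow_of_norm_le_one {p : ℕ} [Fact p.Prime] {f : ℕ → PadicAlgCl p}
    (hf : Tendsto f atTop (𝓝 0)) {η : PadicAlgCl p} (hη : ‖η‖ ≤ 1) :
    Tendsto (fun n => f n * η ^ n) atTop (𝓝 0) := by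
  refine squeeze_zero_norm (fun n => ?_) (tendsto_zero_iff_norm_tendsto_zero.1 hf)
  rw [norm_mul, norm_pow]
  exact mul_le_of_le_one_right (norm_nonneg _) (pow_le_one₀ (norm_nonneg _) hη)

theorem coeff_dworkSeries_mem {F : Type*} [Field F] [CharZero F] {p : ℕ} (hp : p ≠ 0)
    {S : Type*} [SetLike S F] [SubfieldClass S F] (N : S) {c : F} (hc : c ∈ N) (n : ℕ) :
    PowerSeries.coeff n (dworkSeries p c) ∈ N := by
  have key : ∀ n, dworkNum p c n ∈ N := by
    intro n
    induction n using Nat.strong_induction_on with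
    | _ n ih =>
      cases n with
      | zero => rw [dworkNum_zero hp]; exact one_mem N
      | succ n =>
        rw [dworkNum_succ hp]
        exact sub_mem (mul_mem hc (ih n (by omega)))
          (mul_mem (mul_mem (mul_mem (natCast_mem N p) hc) (natCast_mem N _)) (ih _ (by omega)))
  have h := div_mem (key n) (natCast_mem N n.factorial)
  rwa [dworkNum, mul_div_cancel_left₀ _ (by exact_mod_cast n.factorial_ne_zero)] at h

section Values

variable {p : ℕ} [Fact p.Prime] {γ : PadicAlgCl p}

theorem exists_seriesHasValue_mem {K : Type*} [Field K] [Algebra ℚ_[p] K]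
    [FiniteDimensional ℚ_[p] K] [Algebra K (PadicAlgCl p)]
    [IsScalarTower ℚ_[p] K (PadicAlgCl p)] (N : IntermediateField K (PadicAlgCl p))
    [FiniteDimensional K N] {c η : PadicAlgCl p} (hc : c ∈ N) (hη : η ∈ N) (hη1 : ‖η‖ ≤ 1)
    (h : Tendsto (fun n => PowerSeries.coeff n (dworkSeries p c)) atTop (𝓝 0)) :
    ∃ v ∈ N, SeriesHasValue (dworkSeries p c) η v := by
  have : FiniteDimensional ℚ_[p] N := FiniteDimensional.trans ℚ_[p] K N
  have : FiniteDimensional ℚ_[p]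
    ((Subalgebra.toSubmodule N.toSubalgebra).restrictScalars ℚ_[p]) := this
  exact exists_hasSum_of_mem ((Subalgebra.toSubmodule N.toSubalgebra).restrictScalars ℚ_[p])
    (fun n => show _ ∈ N from
      mul_mem (coeff_dworkSeries_mem (Fact.out : p.Prime).ne_zero N hc n) (pow_mem hη n))
    (tendsto_mul_pow_of_norm_le_one h hη1)

theorem norm_seriesHasValue_sub_le (hγ : γ ^ (p - 1) = -(p : PadicAlgCl p))
    {η v : PadicAlgCl p} (hη : ‖η‖ ≤ 1) (hv : SeriesHasValue (dworkSeries p γ) η v) :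
    ‖v - 1 - γ * η‖ ≤ ‖γ‖ ^ 2 := by
  have hp : p ≠ 0 := (Fact.out : p.Prime).ne_zero
  have hp1 : (p - 1) ≠ 0 := Nat.sub_ne_zero_of_lt (Fact.out : p.Prime).one_lt
  have h := (hasSum_nat_add_iff' 2).2 hv
  have c0 : PowerSeries.coeff 0 (dworkSeries p γ) = 1 := by
    simpa [dworkNum] using dworkNum_zero hp γ
  have c1 : PowerSeries.coeff 1 (dworkSeries p γ) = γ := by
    have := dworkNum_succ hp γ 0
    rw [dworkNum_zero hp, Nat.descFactorial_of_lt (by omega)] at this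
    simpa [dworkNum] using this
  rw [Finset.sum_range_succ, Finset.sum_range_one, c0, c1, pow_zero, pow_one, mul_one,
    ← sub_sub] at h
  rw [← h.tsum_eq]
  refine IsUltrametricDist.norm_tsum_le_of_forall_le fun n => ?_
  rw [norm_mul, norm_pow]
  exact (mul_le_of_le_one_right (norm_nonneg _) (pow_le_one₀ (norm_nonneg _) hη)).trans
    (norm_coeff_dworkSeries_le_sq hγ (by omega))

open PowerSeries in
theorem coeff_exp_subst_C_mul_X_pow {F : Type*} [Field F] [CharZero F] {m : ℕ} (hm : m ≠ 0)
    (c : F) (k : ℕ) :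
    coeff (m * k) ((exp F).subst (C c * X ^ m : PowerSeries F)) = c ^ k / k.factorial := by
  have hc : constantCoeff (C c * X ^ m : PowerSeries F) = 0 := by simp [hm]
  rw [coeff_subst' (HasSubst.of_constantCoeff_zero' hc), finsum_eq_single _ k]
  · rw [mul_pow, ← map_pow, ← pow_mul, coeff_C_mul, coeff_X_pow_self, coeff_exp]
    simp [div_eq_mul_inv, mul_comm]
  · intro n hn
    rw [mul_pow, ← map_pow, ← pow_mul, coeff_C_mul, coeff_X_pow, if_neg, mul_zero, smul_zero]
    intro h
    exact hn (Nat.eq_of_mul_eq_mul_left (Nat.pos_of_ne_zero hm) h).symm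

open PowerSeries in
theorem coeff_exp_subst_C_mul_X_pow_of_not_dvd {F : Type*} [Field F] [CharZero F] {m : ℕ}
    (hm : m ≠ 0) (c : F) {n : ℕ} (hn : ¬ m ∣ n) :
    coeff n ((exp F).subst (C c * X ^ m : PowerSeries F)) = 0 := by
  have hc : constantCoeff (C c * X ^ m : PowerSeries F) = 0 := by simp [hm]
  rw [coeff_subst' (HasSubst.of_constantCoeff_zero' hc), finsum_eq_zero_of_forall_eq_zero]
  intro k
  rw [mul_pow, ← map_pow, ← pow_mul, coeff_C_mul, coeff_X_pow, if_neg, mul_zero, smul_zero]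
  rintro rfl
  exact hn (dvd_mul_right _ _)

open PowerSeries in
theorem seriesHasValue_exp_subst_one {m : ℕ} (hm : m ≠ 0) {c s : PadicAlgCl p}
    (h : HasSum (fun k : ℕ => c ^ k / k.factorial) s) :
    SeriesHasValue ((exp (PadicAlgCl p)).subst (C c * X ^ m : PowerSeries (PadicAlgCl p))) 1 s := by
  have hinj : Function.Injective (fun k : ℕ => m * k) := fun a b hab =>
    Nat.eq_of_mul_eq_mul_left (Nat.pos_of_ne_zero hm) hab
  refine (hinj.hasSum_iff ?_).1 (h.congr_fun fun k => ?_)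
  · intro n hn
    rw [coeff_exp_subst_C_mul_X_pow_of_not_dvd hm c, zero_mul]
    rintro ⟨k, rfl⟩
    exact hn ⟨k, rfl⟩
  · simp only [Function.comp_apply]
    rw [coeff_exp_subst_C_mul_X_pow hm, one_pow, mul_one]

theorem exists_hasSum_pow_div_factorial (hγ : γ ^ (p - 1) = -(p : PadicAlgCl p))
    {c : PadicAlgCl p} (hc : ‖c‖ ≤ ‖(p : PadicAlgCl p)‖ * ‖γ‖) :
    ∃ s, HasSum (fun k : ℕ => c ^ k / k.factorial) s := by
  have : FiniteDimensional ℚ_[p] (IntermediateField.adjoin ℚ_[p] {c}) :=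
    IntermediateField.adjoin.finiteDimensional (Algebra.IsIntegral.isIntegral c)
  have : FiniteDimensional ℚ_[p]
    (Subalgebra.toSubmodule (IntermediateField.adjoin ℚ_[p] {c}).toSubalgebra) := this
  have hc' : c ∈ IntermediateField.adjoin ℚ_[p] {c} :=
    IntermediateField.mem_adjoin_simple_self _ _
  obtain ⟨s, -, hs⟩ := exists_hasSum_of_mem
    (Subalgebra.toSubmodule (IntermediateField.adjoin ℚ_[p] {c}).toSubalgebra)
    (f := fun k : ℕ => c ^ k / k.factorial)
    (fun n => show _ ∈ IntermediateField.adjoin ℚ_[p] {c} from div_mem (pow_mem hc' n) (natCast_mem (IntermediateField.adjoin ℚ_[p] {c}) _)) (by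
      refine squeeze_zero_norm' (a := fun n => ‖(p : PadicAlgCl p)‖ ^ n * ‖γ‖) ?_ ?_
      · filter_upwards [eventually_ne_atTop 0] with n hn
        have h0 := pow_le_norm_factorial hγ hn
        have hg := norm_pos_of_pow_eq hγ
        rw [norm_div, norm_pow, div_le_iff₀ ((pow_pos hg _).trans_le h0)]
        calc ‖c‖ ^ n ≤ (‖(p : PadicAlgCl p)‖ * ‖γ‖) ^ n := by gcongr
          _ = ‖(p : PadicAlgCl p)‖ ^ n * ‖γ‖ * ‖γ‖ ^ (n - 1) := by
            rw [mul_assoc, ← pow_succ', Nat.sub_add_cancel (Nat.pos_of_ne_zero hn), mul_pow]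
          _ ≤ _ := by gcongr
      · rw [← zero_mul ‖γ‖]
        exact (tendsto_pow_atTop_nhds_zero_of_lt_one (norm_nonneg _)
          (PadicAlgCl.norm_prime_lt_one p)).mul_const _)
  exact ⟨s, hs⟩

-- For small c the factors exp(cX) and exp(−cX^p) converge separately at X = 1, with inverse values.
-- For c = γ this separation is not available, and E_γ(1) is indeed not 1.
open PowerSeries in
theorem seriesHasValue_dworkSeries_one (hγ : γ ^ (p - 1) = -(p : PadicAlgCl p))
    {c : PadicAlgCl p} (hc : ‖c‖ ≤ ‖(p : PadicAlgCl p)‖ * ‖γ‖) :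
    SeriesHasValue (dworkSeries p c) 1 1 := by
  have hp : p ≠ 0 := (Fact.out : p.Prime).ne_zero
  obtain ⟨s, hs⟩ := exists_hasSum_pow_div_factorial hγ hc
  obtain ⟨t, ht⟩ := exists_hasSum_pow_div_factorial hγ (c := -c) (by rwa [norm_neg])
  have h1 := seriesHasValue_exp_subst_one one_ne_zero hs
  have h2 := seriesHasValue_exp_subst_one one_ne_zero ht
  have h3 := seriesHasValue_exp_subst_one hp ht
  have hc0 : ∀ (m : ℕ) (a : PadicAlgCl p), m ≠ 0 →
      constantCoeff (C a * X ^ m : PowerSeries (PadicAlgCl p)) = 0 := by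
    intro m a hm
    simp [hm]
  have h12 := h1.mul h2
  rw [← exp_subst_add (hc0 _ _ one_ne_zero) (hc0 _ _ one_ne_zero), map_neg, neg_mul,
    add_neg_cancel] at h12
  have hz : (exp (PadicAlgCl p)).subst (0 : PowerSeries (PadicAlgCl p)) = 1 := by
    have := dworkSeries_zero (F := PadicAlgCl p) hp
    rwa [dworkSeries, map_zero, zero_mul, zero_mul, sub_zero] at this
  rw [hz] at h12
  have hst : s * t = 1 := h12.unique SeriesHasValue.one
  have h13 := h1.mul h3
  rwa [← exp_subst_add (hc0 _ _ one_ne_zero) (hc0 _ _ hp), map_neg, neg_mul, ← sub_eq_add_neg,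
    pow_one, ← dworkSeries, hst] at h13

/-- The p-th power is E_{pγ}(1) = 1, while v ≡ 1 + γ mod γ² excludes v = 1. -/
theorem isPrimitiveRoot_dworkSeries_one (hγ : γ ^ (p - 1) = -(p : PadicAlgCl p))
    {v : PadicAlgCl p} (hv : SeriesHasValue (dworkSeries p γ) 1 v) : IsPrimitiveRoot v p := by
  have hp : p ≠ 0 := (Fact.out : p.Prime).ne_zero
  have h1 : v ^ p = 1 := by
    have h := hv.pow p
    rw [← dworkSeries_nsmul hp] at h
    exact h.unique (seriesHasValue_dworkSeries_one hγ (by rw [norm_mul]))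
  refine IsPrimitiveRoot.of_map_of_injective (f := MonoidHom.id _) ?_ Function.injective_id
  refine (IsPrimitiveRoot.iff_orderOf).2 ((Nat.dvd_prime Fact.out).1 (orderOf_dvd_of_pow_eq_one h1)
    |>.resolve_left fun h => ?_)
  have hv1 : v = 1 := orderOf_eq_one_iff.1 h
  have h2 := norm_seriesHasValue_sub_le hγ (norm_one.le) hv
  rw [hv1, sub_self, zero_sub, mul_one, norm_neg] at h2
  have h3 := norm_pos_of_pow_eq hγ
  have h4 := norm_lt_one_of_pow_eq hγ
  nlinarith

end Values

/-! ### Totally ramified extensions: powers of a uniformizer are orthogonal -/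

section Orthogonality

variable {Ω : Type*} [NormedField Ω] {N : Type*} [Field N] [Algebra N Ω]
  {ρ : ℝ} {m : ℕ} {t : Ω}

/-- The values of the norm on `N \ {0}` are integral powers of `ρ`. -/
def HasNormValues (N : Type*) {Ω : Type*} [NormedField Ω] [Field N] [Algebra N Ω] (ρ : ℝ) : Prop :=
  ∀ c : N, c ≠ 0 → ∃ k : ℤ, ‖algebraMap N Ω c‖ = ρ ^ k

theorem HasNormValues.norm_le_of_lt_zpow (hN : HasNormValues N (Ω := Ω) ρ) (hρ0 : 0 < ρ)
    (hρ1 : ρ < 1) {c : N} {k : ℤ} (hc : ‖algebraMap N Ω c‖ < ρ ^ k) :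
    ‖algebraMap N Ω c‖ ≤ ρ ^ (k + 1) := by
  by_cases h : c = 0
  · rw [h, map_zero, norm_zero]
    positivity
  obtain ⟨l, hl⟩ := hN c h
  rw [hl] at hc ⊢
  have := (zpow_lt_zpow_iff_right_of_lt_one₀ hρ0 hρ1).1 hc
  exact zpow_le_zpow_right_of_le_one₀ hρ0 hρ1.le (by omega)

theorem HasNormValues.norm_le_of_zpow_lt (hN : HasNormValues N (Ω := Ω) ρ) (hρ0 : 0 < ρ)
    (hρ1 : ρ < 1) {c : N} {k : ℤ} (hc : ‖algebraMap N Ω c‖ < ρ ^ (k - 1)) :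
    ‖algebraMap N Ω c‖ ≤ ρ ^ k := by
  have := hN.norm_le_of_lt_zpow hρ0 hρ1 hc
  rwa [sub_add_cancel] at this

theorem norm_mul_pow_eq_zpow {k : ℤ} (ht : ‖t‖ ^ m = ρ) {c : Ω} (hc : ‖c‖ = ρ ^ k) (i : ℕ) (h0 : 0 < ‖t‖) :
    ‖c * t ^ i‖ = ‖t‖ ^ (m * k + i) := by
  rw [norm_mul, hc, ← ht, norm_pow, zpow_add₀ h0.ne', zpow_mul, zpow_natCast, zpow_natCast]

theorem norm_pos_of_pow_norm_eq (hρ0 : 0 < ρ) (hm : m ≠ 0) (ht : ‖t‖ ^ m = ρ) : 0 < ‖t‖ := by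
  refine (norm_nonneg t).lt_of_ne' fun h => ?_
  rw [h, zero_pow hm] at ht
  exact hρ0.ne ht

theorem norm_lt_one_of_pow_norm_eq (hρ1 : ρ < 1) (ht : ‖t‖ ^ m = ρ) : ‖t‖ < 1 := by
  by_contra! h
  have := one_le_pow₀ (n := m) h
  rw [ht] at this
  exact absurd hρ1 (not_lt.2 this)

variable [IsUltrametricDist Ω]

/-- A nonzero term has norm |t|^(mk+i), whose exponent is i modulo m. The nonzero terms thus have
pairwise different norms, and the ultrametric inequality is an equality. -/
theorem exists_norm_sum_mul_pow_eq (hN : HasNormValues N (Ω := Ω) ρ) (hρ0 : 0 < ρ) (hρ1 : ρ < 1)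
    (ht : ‖t‖ ^ m = ρ) {c : Fin m → N} (hc : c ≠ 0) :
    ∃ i, c i ≠ 0 ∧
      ‖∑ i, algebraMap N Ω (c i) * t ^ (i : ℕ)‖ = ‖algebraMap N Ω (c i) * t ^ (i : ℕ)‖ ∧
      ∀ j, ‖algebraMap N Ω (c j) * t ^ (j : ℕ)‖ ≤
        ‖∑ i, algebraMap N Ω (c i) * t ^ (i : ℕ)‖ := by
  classical
  obtain ⟨i₀, hi₀⟩ := Function.ne_iff.1 hc
  have hm : m ≠ 0 := by rintro rfl; exact i₀.elim0
  have h0 := norm_pos_of_pow_norm_eq hρ0 hm ht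
  have h1 := norm_lt_one_of_pow_norm_eq hρ1 ht
  set s := Finset.univ.filter fun i => c i ≠ 0 with hs
  have hne : s.Nonempty := ⟨i₀, by simpa [hs] using hi₀⟩
  have hsum : ∑ i, algebraMap N Ω (c i) * t ^ (i : ℕ) =
      ∑ i ∈ s, algebraMap N Ω (c i) * t ^ (i : ℕ) := by
    refine (Finset.sum_subset (Finset.subset_univ s) fun i _ hi => ?_).symm
    have : c i = 0 := by simpa [hs] using hi
    rw [this, map_zero, zero_mul]
  have hpair : Set.Pairwise (s : Set (Fin m)) (fun i j =>
      ‖algebraMap N Ω (c i) * t ^ (i : ℕ)‖ ≠ ‖algebraMap N Ω (c j) * t ^ (j : ℕ)‖) := by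
    intro i hi j hj hij h
    obtain ⟨k, hk⟩ := hN (c i) (by simpa [hs] using hi)
    obtain ⟨l, hl⟩ := hN (c j) (by simpa [hs] using hj)
    rw [norm_mul_pow_eq_zpow ht hk _ h0, norm_mul_pow_eq_zpow ht hl _ h0,
      zpow_right_inj₀ h0 h1.ne] at h
    have h2 := congrArg (· % (m : ℤ)) h
    simp only [Int.mul_add_emod_self_left] at h2
    rw [Int.emod_eq_of_lt (by positivity) (by exact_mod_cast i.2),
      Int.emod_eq_of_lt (by positivity) (by exact_mod_cast j.2)] at h2
    exact hij (Fin.ext (by exact_mod_cast h2))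
  have hsup := IsUltrametricDist.norm_sum_eq_sup'_of_pairwise_ne hne hpair
  rw [hsum, hsup]
  obtain ⟨i, hi, hi'⟩ := s.exists_mem_eq_sup' hne fun i => ‖algebraMap N Ω (c i) * t ^ (i : ℕ)‖
  refine ⟨i, by simpa [hs] using hi, hi', fun j => ?_⟩
  by_cases hj : c j = 0
  · rw [hj, map_zero, zero_mul, norm_zero, hi']
    positivity
  · exact Finset.le_sup' (fun i => ‖algebraMap N Ω (c i) * t ^ (i : ℕ)‖) (by simpa [hs] using hj)

theorem norm_mul_pow_le_norm_sum (hN : HasNormValues N (Ω := Ω) ρ) (hρ0 : 0 < ρ) (hρ1 : ρ < 1)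
    (ht : ‖t‖ ^ m = ρ) (c : Fin m → N) (j : Fin m) :
    ‖algebraMap N Ω (c j) * t ^ (j : ℕ)‖ ≤ ‖∑ i, algebraMap N Ω (c i) * t ^ (i : ℕ)‖ := by
  by_cases hc : c = 0
  · simp [hc]
  obtain ⟨-, -, -, h⟩ := exists_norm_sum_mul_pow_eq hN hρ0 hρ1 ht hc
  exact h j

theorem linearIndependent_pow_of_norm (hN : HasNormValues N (Ω := Ω) ρ) (hρ0 : 0 < ρ) (hρ1 : ρ < 1)
    (ht : ‖t‖ ^ m = ρ) : LinearIndependent N fun i : Fin m => t ^ (i : ℕ) := by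
  rw [Fintype.linearIndependent_iff]
  intro c hc i
  by_contra hi
  have hm : m ≠ 0 := by rintro rfl; exact i.elim0
  have h := norm_mul_pow_le_norm_sum hN hρ0 hρ1 ht c i
  simp only [← Algebra.smul_def, hc, norm_zero] at h
  have h1 := norm_le_zero_iff.1 h
  rw [Algebra.smul_def, mul_eq_zero, map_eq_zero] at h1
  have := norm_pos_iff.1 (norm_pos_of_pow_norm_eq hρ0 hm ht)
  exact h1.elim hi (pow_ne_zero _ this)

variable {N' : Type*} [Field N'] [Algebra N N'] [Algebra N' Ω] [IsScalarTower N N' Ω]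

theorem linearIndependent_pow_of_norm' (hN : HasNormValues N (Ω := Ω) ρ) (hρ0 : 0 < ρ)
    (hρ1 : ρ < 1) {t : N'} (ht : ‖algebraMap N' Ω t‖ ^ m = ρ) :
    LinearIndependent N fun i : Fin m => t ^ (i : ℕ) := by
  refine LinearIndependent.of_comp (IsScalarTower.toAlgHom N N' Ω).toLinearMap ?_
  convert linearIndependent_pow_of_norm hN hρ0 hρ1 ht with i
  simp

theorem le_finrank_of_norm [FiniteDimensional N N'] (hN : HasNormValues N (Ω := Ω) ρ) (hρ0 : 0 < ρ)
    (hρ1 : ρ < 1) {t : N'} (ht : ‖algebraMap N' Ω t‖ ^ m = ρ) : m ≤ Module.finrank N N' := by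
  simpa using (linearIndependent_pow_of_norm' hN hρ0 hρ1 ht).fintype_card_le_finrank

theorem exists_eq_sum_mul_pow_of_finrank_eq (hN : HasNormValues N (Ω := Ω) ρ) (hρ0 : 0 < ρ)
    (hρ1 : ρ < 1) (hm : m ≠ 0) {t : N'} (ht : ‖algebraMap N' Ω t‖ ^ m = ρ)
    (hf : Module.finrank N N' = m) (z : N') :
    ∃ c : Fin m → N, z = ∑ i, algebraMap N N' (c i) * t ^ (i : ℕ) := by
  have : Nonempty (Fin m) := ⟨⟨0, Nat.pos_of_ne_zero hm⟩⟩
  have hli := linearIndependent_pow_of_norm' hN hρ0 hρ1 ht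
  have h := hli.span_eq_top_of_card_eq_finrank (by simp [hf])
  obtain ⟨c, hc⟩ := (Submodule.mem_span_range_iff_exists_fun N).1 (h ▸ Submodule.mem_top : z ∈ _)
  exact ⟨c, by simp only [← Algebra.smul_def, hc]⟩

theorem hasNormValues_of_finrank_eq (hN : HasNormValues N (Ω := Ω) ρ) (hρ0 : 0 < ρ)
    (hρ1 : ρ < 1) (hm : m ≠ 0) {t : N'} (ht : ‖algebraMap N' Ω t‖ ^ m = ρ)
    (hf : Module.finrank N N' = m) : HasNormValues N' (Ω := Ω) ‖algebraMap N' Ω t‖ := by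
  intro z hz
  obtain ⟨c, rfl⟩ := exists_eq_sum_mul_pow_of_finrank_eq hN hρ0 hρ1 hm ht hf z
  have hc : c ≠ 0 := by
    rintro rfl
    exact hz (by simp)
  obtain ⟨i, hi, h, -⟩ := exists_norm_sum_mul_pow_eq hN hρ0 hρ1 ht hc
  obtain ⟨k, hk⟩ := hN (c i) hi
  refine ⟨m * k + i, ?_⟩
  rw [← norm_mul_pow_eq_zpow ht hk i (norm_pos_of_pow_norm_eq hρ0 hm ht), ← h, map_sum]
  congr 1
  refine Finset.sum_congr rfl fun i _ => ?_
  rw [map_mul, map_pow, ← IsScalarTower.algebraMap_apply]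

end Orthogonality

/-! ### Congruences for p-th powers -/

section PrimePowers

variable {p : ℕ} [Fact p.Prime]

theorem norm_add_pow_sub_le {x y : PadicAlgCl p} (hx : ‖x‖ ≤ 1) (hy : ‖y‖ ≤ 1) :
    ‖(x + y) ^ p - x ^ p - y ^ p‖ ≤ ‖(p : PadicAlgCl p)‖ * ‖y‖ := by
  rw [add_pow_prime_eq Fact.out]
  have : ∀ s : PadicAlgCl p, x ^ p + y ^ p + p * x * y * s - x ^ p - y ^ p = p * y * (x * s) := by
    intro s; ring
  rw [this, norm_mul, norm_mul]
  refine mul_le_of_le_one_right (by positivity) ?_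
  rw [norm_mul]
  refine mul_le_one₀ hx (norm_nonneg _)
    (IsUltrametricDist.norm_sum_le_of_forall_le_of_nonneg zero_le_one fun k _ => ?_)
  rw [norm_mul, norm_mul, norm_pow, norm_pow]
  exact mul_le_one₀ (mul_le_one₀ (pow_le_one₀ (norm_nonneg _) hx) (by positivity)
    (pow_le_one₀ (norm_nonneg _) hy)) (norm_nonneg _) (PadicAlgCl.norm_natCast_le_one p _)

theorem norm_pow_sub_pow_le {x y : PadicAlgCl p} {r : ℝ} (hx : ‖x‖ ≤ 1)
    (hr : ‖y - x‖ ≤ r) (hr1 : r ≤ 1) (hp : ‖(p : PadicAlgCl p)‖ ≤ r) :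
    ‖y ^ p - x ^ p‖ ≤ r * ‖y - x‖ := by
  have h1 := norm_add_pow_sub_le hx (hr.trans hr1)
  rw [add_sub_cancel] at h1
  have h2 : y ^ p - x ^ p = (y ^ p - x ^ p - (y - x) ^ p) + (y - x) ^ p := by ring
  rw [h2]
  refine (IsUltrametricDist.norm_add_le_max _ _).trans (max_le (h1.trans (by gcongr)) ?_)
  rw [norm_pow]
  calc ‖y - x‖ ^ p ≤ ‖y - x‖ ^ 2 :=
        pow_le_pow_of_le_one (norm_nonneg _) (hr.trans hr1) (Fact.out : p.Prime).two_le
    _ ≤ _ := by rw [pow_two]; gcongr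

end PrimePowers

/-! ### The valuation ring of K: p is a uniformizer -/

section Integers

variable {p : ℕ} [Fact p.Prime]

theorem PadicAlgCl.isIntegral_iff_norm_le_one (z : PadicAlgCl p) :
    IsIntegral ℤ_[p] z ↔ ‖z‖ ≤ 1 := by
  have halg : IsIntegral ℚ_[p] z := Algebra.IsIntegral.isIntegral z
  rw [← PadicAlgCl.spectralNorm_eq, spectralNorm, spectralValue_le_one_iff (minpoly.monic halg)]
  constructor
  · intro h n
    rw [minpoly.isIntegrallyClosed_eq_field_fractions' ℚ_[p] h, Polynomial.coeff_map]
    exact PadicInt.norm_le_one _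
  · intro h
    have hl : minpoly ℚ_[p] z ∈ Polynomial.lifts (algebraMap ℤ_[p] ℚ_[p]) := by
      rw [Polynomial.lifts_iff_coeff_lifts]
      exact fun n => ⟨⟨_, h n⟩, rfl⟩
    obtain ⟨q, hq, -, hm⟩ := Polynomial.lifts_and_degree_eq_and_monic hl (minpoly.monic halg)
    refine ⟨q, hm, ?_⟩
    rw [IsScalarTower.algebraMap_eq ℤ_[p] ℚ_[p] (PadicAlgCl p), ← Polynomial.eval₂_map, hq]
    exact minpoly.aeval _ _

variable {K : Type*} [Field K] [Algebra ℚ_[p] K] [Algebra ℤ_[p] K] [IsScalarTower ℤ_[p] ℚ_[p] K]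
  [Algebra K (PadicAlgCl p)] [IsScalarTower ℚ_[p] K (PadicAlgCl p)]

theorem PadicAlgCl.isScalarTower_padicInt : IsScalarTower ℤ_[p] K (PadicAlgCl p) :=
  IsScalarTower.of_algebraMap_eq fun x => by
    rw [IsScalarTower.algebraMap_apply ℤ_[p] ℚ_[p] K, ← IsScalarTower.algebraMap_apply ℚ_[p] K,
      ← IsScalarTower.algebraMap_apply]

theorem mem_padicIntegers_iff_norm_le_one {z : K} :
    z ∈ padicIntegers p K ↔ ‖algebraMap K (PadicAlgCl p) z‖ ≤ 1 := by
  have : IsScalarTower ℤ_[p] K (PadicAlgCl p) := PadicAlgCl.isScalarTower_padicInt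
  rw [mem_integralClosure_iff, ← PadicAlgCl.isIntegral_iff_norm_le_one,
    isIntegral_algebraMap_iff (algebraMap K (PadicAlgCl p)).injective]

theorem padicInt_prime_dvd_pow_sub (c : ℤ_[p]) (d : ℕ) : (p : ℤ_[p]) ∣ c ^ p ^ d - c := by
  rw [← Ideal.mem_span_singleton, ← PadicInt.maximalIdeal_eq_span_p, ← PadicInt.ker_toZMod,
    RingHom.mem_ker, map_sub, map_pow, ZMod.pow_card_pow, sub_self]

theorem prime_mem_nonunits_padicIntegers : ((p : ℕ) : padicIntegers p K) ∈ nonunits _ := by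
  intro h
  obtain ⟨r, hr⟩ := isUnit_iff_exists_inv.1 h
  have h1 := congrArg (fun z : padicIntegers p K => ‖algebraMap K (PadicAlgCl p) z‖) hr
  have h2 := mem_padicIntegers_iff_norm_le_one.1 r.2
  have h3 := PadicAlgCl.norm_prime_lt_one p
  simp only [MulMemClass.coe_mul, SubringClass.coe_natCast, map_mul, map_natCast, norm_mul,
    OneMemClass.coe_one, map_one, norm_one] at h1
  have h4 := norm_nonneg (algebraMap K (PadicAlgCl p) r)
  have h5 := norm_nonneg (p : PadicAlgCl p)
  nlinarith

/-- Modulo p the q-th power map is additive, fixes the images of the basis elements because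
a_i^(q−1) = 1, and fixes those of the ℤ_p-coefficients by Fermat. -/
theorem prime_dvd_pow_sub_of_basis {d : ℕ} (a : Module.Basis (Fin d) ℤ_[p] (padicIntegers p K))
    (ha : ∀ i, a i ^ (p ^ d - 1) = 1) (b : padicIntegers p K) :
    (p : padicIntegers p K) ∣ b ^ p ^ d - b := by
  have : CharP (padicIntegers p K ⧸ Ideal.span {(p : padicIntegers p K)}) p :=
    CharP.quotient _ p prime_mem_nonunits_padicIntegers
  have hpd : p ^ d - 1 + 1 = p ^ d := Nat.sub_add_cancel (Nat.pow_pos (Fact.out : p.Prime).pos)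
  rw [← Ideal.mem_span_singleton, ← Ideal.Quotient.eq, map_pow]
  conv_lhs => rw [← a.sum_repr b, map_sum, sum_pow_char_pow]
  conv_rhs => rw [← a.sum_repr b, map_sum]
  refine Finset.sum_congr rfl fun i _ => ?_
  rw [← map_pow, Algebra.smul_def, mul_pow, ← hpd, pow_succ (a i), ha, one_mul, hpd,
    Ideal.Quotient.eq, ← sub_mul, ← map_pow, ← map_sub]
  refine Ideal.mul_mem_right _ _ (Ideal.mem_span_singleton.2 ?_)
  have := map_dvd (algebraMap ℤ_[p] (padicIntegers p K)) (padicInt_prime_dvd_pow_sub (a.repr b i) d)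
  rwa [map_natCast] at this

/-- In b = b^q − pr the term b^q is strictly smaller than b when 0 < |b| < 1, so |b| ≤ |pr|. -/
theorem norm_le_norm_prime_of_lt_one {d : ℕ} [NeZero d]
    (a : Module.Basis (Fin d) ℤ_[p] (padicIntegers p K))
    (ha : ∀ i, a i ^ (p ^ d - 1) = 1) {b : K} (hb : ‖algebraMap K (PadicAlgCl p) b‖ < 1) :
    ‖algebraMap K (PadicAlgCl p) b‖ ≤ ‖(p : PadicAlgCl p)‖ := by
  have hb' : b ∈ padicIntegers p K := mem_padicIntegers_iff_norm_le_one.2 hb.le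
  obtain ⟨r, hr⟩ := prime_dvd_pow_sub_of_basis a ha ⟨b, hb'⟩
  have h1 := congrArg (fun z : padicIntegers p K => algebraMap K (PadicAlgCl p) z) hr
  simp only [AddSubgroupClass.coe_sub, SubmonoidClass.coe_pow, MulMemClass.coe_mul,
    SubringClass.coe_natCast, map_mul, map_natCast, map_sub, map_pow] at h1
  have h2 := mem_padicIntegers_iff_norm_le_one.1 r.2
  by_contra! h3
  set β := algebraMap K (PadicAlgCl p) b
  have h4 : β = β ^ p ^ d - p * algebraMap K (PadicAlgCl p) r := by rw [← h1]; ring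
  have h5 : ‖β‖ ≤ max ‖β ^ p ^ d‖ ‖p * algebraMap K (PadicAlgCl p) r‖ := by
    conv_lhs => rw [h4]
    exact IsUltrametricDist.norm_sub_le_max_norm _ _
  rw [norm_pow, norm_mul, le_max_iff] at h5
  have h0 : 0 < ‖β‖ := (norm_nonneg _).trans_lt h3
  rcases h5 with h5 | h5
  · have : ‖β‖ ^ p ^ d < ‖β‖ ^ 1 := pow_lt_pow_right_of_lt_one₀ h0 hb
      (Nat.one_lt_pow (NeZero.ne d) (Fact.out : p.Prime).one_lt)
    rw [pow_one] at this
    exact absurd h5 (not_le.2 this)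
  · exact absurd (h5.trans (mul_le_of_le_one_right (norm_nonneg _) h2)) (not_le.2 h3)

theorem hasNormValues_padic {d : ℕ} [NeZero d]
    (a : Module.Basis (Fin d) ℤ_[p] (padicIntegers p K))
    (ha : ∀ i, a i ^ (p ^ d - 1) = 1) :
    HasNormValues K (Ω := PadicAlgCl p) ‖(p : PadicAlgCl p)‖ := by
  intro c hc
  have hp0 := PadicAlgCl.norm_prime_pos p
  have hp1 := PadicAlgCl.norm_prime_lt_one p
  have hc0 : 0 < ‖algebraMap K (PadicAlgCl p) c‖ := by simpa using hc
  obtain ⟨k, hk1, hk2⟩ := exists_mem_Ico_zpow hc0 (one_lt_inv_iff₀.2 ⟨hp0, hp1⟩)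
  refine ⟨-k, ?_⟩
  have hpK : algebraMap K (PadicAlgCl p) (p : K) = p := map_natCast _ _
  have hn : ‖algebraMap K (PadicAlgCl p) (c * (p : K) ^ (k + 1))‖ =
      ‖algebraMap K (PadicAlgCl p) c‖ * ‖(p : PadicAlgCl p)‖ ^ (k + 1) := by
    rw [map_mul, map_zpow₀, hpK, norm_mul, norm_zpow]
  have h1 : ‖algebraMap K (PadicAlgCl p) (c * (p : K) ^ (k + 1))‖ < 1 := by
    rw [hn]
    calc _ < (‖(p : PadicAlgCl p)‖⁻¹) ^ (k + 1) * ‖(p : PadicAlgCl p)‖ ^ (k + 1) := by gcongr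
      _ = 1 := by rw [← mul_zpow, inv_mul_cancel₀ hp0.ne', one_zpow]
  have h2 := norm_le_norm_prime_of_lt_one a ha h1
  rw [hn, zpow_add_one₀ hp0.ne', ← mul_assoc] at h2
  have h3 := le_of_mul_le_mul_right (h2.trans_eq (one_mul _).symm) hp0
  rw [inv_zpow'] at hk1
  refine le_antisymm ?_ hk1
  rw [zpow_neg, ← one_div, le_div_iff₀ (zpow_pos hp0 _)]
  exact h3

/-- A `ℤ_p`-combination of a basis with a coefficient prime to `p` has norm one. -/
theorem norm_sum_natCast_mul_eq_one {d : ℕ} [NeZero d]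
    (a : Module.Basis (Fin d) ℤ_[p] (padicIntegers p K))
    (ha : ∀ i, a i ^ (p ^ d - 1) = 1) {n : Fin d → ℕ} (hn : ∀ i, n i ≤ p - 1)
    (hn0 : ∃ i, n i ≠ 0) :
    ‖∑ i, (n i : PadicAlgCl p) * algebraMap K (PadicAlgCl p) (a i : K)‖ = 1 := by
  set b : padicIntegers p K := ∑ i, (n i : ℤ_[p]) • a i with hb
  have hbn : ∑ i, (n i : PadicAlgCl p) * algebraMap K (PadicAlgCl p) (a i : K) =
      algebraMap K (PadicAlgCl p) (b : K) := by
    rw [hb]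
    simp [Algebra.smul_def]
  rw [hbn]
  refine le_antisymm (mem_padicIntegers_iff_norm_le_one.1 b.2) ?_
  by_contra! h
  have h1 := norm_le_norm_prime_of_lt_one a ha h
  have hp0 := PadicAlgCl.norm_prime_pos p
  have hpK : algebraMap K (PadicAlgCl p) (p : K) = p := map_natCast _ _
  have hpK0 : (p : K) ≠ 0 := by
    intro h0
    rw [h0, map_zero] at hpK
    rw [← hpK, norm_zero] at hp0
    exact lt_irrefl _ hp0
  have h2 : (b : K) / p ∈ padicIntegers p K := by
    rw [mem_padicIntegers_iff_norm_le_one, map_div₀, hpK, norm_div]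
    exact div_le_one_of_le₀ h1 hp0.le
  have h3 : b = (p : ℤ_[p]) • (⟨(b : K) / p, h2⟩ : padicIntegers p K) := by
    apply Subtype.ext
    rw [Algebra.smul_def]
    simp [mul_div_cancel₀, hpK0]
  obtain ⟨i, hi⟩ := hn0
  have h4 := congrArg (fun z => a.repr z i) h3
  simp only [map_smul, Finsupp.smul_apply, smul_eq_mul] at h4
  have hrep : a.repr b i = n i := by rw [hb, a.repr_sum_self]
  rw [hrep] at h4
  have h5 : (p : ℤ_[p]) ∣ (n i : ℤ_[p]) := ⟨_, h4⟩
  have h6 := PadicInt.norm_lt_one_iff_dvd _ |>.2 h5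
  have h7 : p ∣ n i := by
    by_contra h8
    rw [PadicInt.norm_natCast_eq_one_iff.2 ((Fact.out : p.Prime).coprime_iff_not_dvd.2 h8)] at h6
    exact lt_irrefl _ h6
  have := Nat.le_of_dvd (Nat.pos_of_ne_zero hi) h7
  have := hn i
  have := (Fact.out : p.Prime).pos
  omega

end Integers

open Filter Topology IntermediateField

/-! ### The Galois action on γ and on values of the series -/

section DworkGalois

variable {p : ℕ} [Fact p.Prime] {K : Type*} [Field K] [Algebra ℚ_[p] K]
  [Algebra K (PadicAlgCl p)] [IsScalarTower ℚ_[p] K (PadicAlgCl p)]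
  {γ ζ : PadicAlgCl p}

theorem PadicAlgCl.norm_algEquiv (σ : Gal((PadicAlgCl p)/K)) (z : PadicAlgCl p) : ‖σ z‖ = ‖z‖ :=
  (spectralNorm_eq_of_equiv (σ.restrictScalars ℚ_[p]) z).symm

theorem map_coeff_dworkSeries {F F' : Type*} [Field F] [CharZero F] [Field F'] [CharZero F']
    {p : ℕ} (hp : p ≠ 0) (f : F →+* F') (c : F) (n : ℕ) :
    f (PowerSeries.coeff n (dworkSeries p c)) = PowerSeries.coeff n (dworkSeries p (f c)) := by
  have key : ∀ n, f (dworkNum p c n) = dworkNum p (f c) n := by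
    intro n
    induction n using Nat.strong_induction_on with
    | _ n ih =>
      cases n with
      | zero => rw [dworkNum_zero hp, dworkNum_zero hp, map_one]
      | succ n =>
        rw [dworkNum_succ hp, dworkNum_succ hp, ← ih n (by omega), ← ih _ (by omega)]
        simp only [map_sub, map_mul, map_natCast]
  have h := key n
  rw [dworkNum, dworkNum, map_mul, map_natCast] at h
  exact mul_left_cancel₀ (by exact_mod_cast n.factorial_ne_zero) h

theorem SeriesHasValue.map_algEquiv {c η v : PadicAlgCl p}
    (h : SeriesHasValue (dworkSeries p c) η v) (σ : Gal((PadicAlgCl p)/K)) :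
    SeriesHasValue (dworkSeries p (σ c)) (σ η) (σ v) := by
  have hcont : Continuous σ := by
    refine AddMonoidHomClass.continuous_of_bound σ 1 fun x => ?_
    rw [PadicAlgCl.norm_algEquiv, one_mul]
  refine (HasSum.map h σ hcont).congr_fun fun n => ?_
  rw [Function.comp_apply, map_mul, map_pow]
  congr 1
  exact (map_coeff_dworkSeries (Fact.out : p.Prime).ne_zero (σ : PadicAlgCl p →+* PadicAlgCl p)
    c n).symm

theorem norm_seriesHasValue_sub_one (hγ : γ ^ (p - 1) = -(p : PadicAlgCl p)) {v b : PadicAlgCl p}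
    (hb : ‖b‖ = 1) (hv : ‖v - 1 - γ * b‖ ≤ ‖γ‖ ^ 2) : ‖v - 1‖ = ‖γ‖ := by
  have h3 := norm_pos_of_pow_eq hγ
  have h4 := norm_lt_one_of_pow_eq hγ
  have h5 : ‖v - 1 - γ * b‖ < ‖γ * b‖ := by
    rw [norm_mul, hb, mul_one]
    nlinarith
  have h6 := IsUltrametricDist.norm_add_eq_max_of_norm_ne_norm h5.ne
  rw [sub_add_cancel, max_eq_right h5.le, norm_mul, hb, mul_one] at h6
  exact h6

/-- `K(ζ)` is totally ramified of degree `p - 1` over `K`, and contains `γ`. -/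
theorem mem_adjoin_and_finrank_adjoin [FiniteDimensional ℚ_[p] K]
    (hN : HasNormValues K (Ω := PadicAlgCl p) ‖(p : PadicAlgCl p)‖)
    (hγ : γ ^ (p - 1) = -(p : PadicAlgCl p)) (hζ : IsPrimitiveRoot ζ p) :
    γ ∈ K⟮ζ⟯ ∧ Module.finrank K K⟮ζ⟯ = p - 1 := by
  have hp : p.Prime := Fact.out
  have halg : Algebra.IsAlgebraic K (PadicAlgCl p) :=
    Algebra.IsAlgebraic.tower_top (K := ℚ_[p]) _
  have hfγ : FiniteDimensional K K⟮γ⟯ :=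
    adjoin.finiteDimensional (Algebra.IsIntegral.isIntegral γ)
  have hfζ : FiniteDimensional K K⟮ζ⟯ :=
    adjoin.finiteDimensional (Algebra.IsIntegral.isIntegral ζ)
  obtain ⟨v, hvm, hv⟩ := exists_seriesHasValue_mem K⟮γ⟯ (mem_adjoin_simple_self K γ)
    (one_mem _) norm_one.le (tendsto_coeff_dworkSeries hγ)
  have hvp := isPrimitiveRoot_dworkSeries_one hγ hv
  have hpos : NeZero p := ⟨hp.ne_zero⟩
  obtain ⟨i, -, hi⟩ := hvp.eq_pow_of_pow_eq_one hζ.pow_eq_one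
  obtain ⟨j, -, hj⟩ := hζ.eq_pow_of_pow_eq_one hvp.pow_eq_one
  have hle : K⟮ζ⟯ ≤ K⟮γ⟯ := by
    rw [adjoin_simple_le_iff, ← hi]
    exact pow_mem hvm i
  have hv' : v ∈ K⟮ζ⟯ := by
    rw [← hj]
    exact pow_mem (mem_adjoin_simple_self K ζ) j
  have hnorm : ‖v - 1‖ = ‖γ‖ :=
    norm_seriesHasValue_sub_one hγ norm_one (norm_seriesHasValue_sub_le hγ norm_one.le hv)
  -- Ramification bounds the degree of K(ζ) below through v − 1, and the polynomial X^(p−1) + p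
  -- bounds that of K(γ) above; the inclusion K(ζ) ⊆ K(γ) is then an equality.
  have h1 : p - 1 ≤ Module.finrank K K⟮ζ⟯ :=
    le_finrank_of_norm hN (PadicAlgCl.norm_prime_pos p) (PadicAlgCl.norm_prime_lt_one p)
      (t := (⟨v - 1, sub_mem hv' (one_mem _)⟩ : K⟮ζ⟯)) (by
        rw [← norm_pow_of_pow_eq hγ, ← hnorm]; rfl)
  have h2 : Module.finrank K K⟮γ⟯ ≤ p - 1 := by
    rw [adjoin.finrank (Algebra.IsIntegral.isIntegral γ)]
    have hp1 : p - 1 ≠ 0 := Nat.sub_ne_zero_of_lt hp.one_lt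
    have hne : (Polynomial.X ^ (p - 1) + Polynomial.C (p : K)) ≠ 0 :=
      (Polynomial.monic_X_pow_add_C _ hp1).ne_zero
    have := Polynomial.natDegree_le_of_dvd (minpoly.dvd K γ
      (p := Polynomial.X ^ (p - 1) + Polynomial.C (p : K)) (by simp [hγ])) hne
    rwa [Polynomial.natDegree_X_pow_add_C] at this
  have heq : K⟮ζ⟯ = K⟮γ⟯ := eq_of_le_of_finrank_le hle (h2.trans h1)
  refine ⟨heq ▸ mem_adjoin_simple_self K γ, le_antisymm (heq ▸ h2) h1⟩

theorem norm_mul_sub_le (hγ : γ ^ (p - 1) = -(p : PadicAlgCl p)) {v w b c : PadicAlgCl p}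
    (hb : ‖b‖ ≤ 1) (hc : ‖c‖ ≤ 1) (hv : ‖v - 1 - γ * b‖ ≤ ‖γ‖ ^ 2)
    (hw : ‖w - 1 - γ * c‖ ≤ ‖γ‖ ^ 2) : ‖v * w - 1 - γ * (b + c)‖ ≤ ‖γ‖ ^ 2 := by
  have h4 := (norm_lt_one_of_pow_eq hγ).le
  have hsq : ‖γ‖ ^ 2 ≤ 1 := pow_le_one₀ (norm_nonneg _) h4
  have e : v * w - 1 - γ * (b + c) =
      (v - 1 - γ * b) * ((w - 1 - γ * c) + (1 + γ * c)) +
        ((w - 1 - γ * c) * (1 + γ * b) + γ ^ 2 * (b * c)) := by ring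
  have h1 : ∀ b : PadicAlgCl p, ‖b‖ ≤ 1 → ‖1 + γ * b‖ ≤ 1 := fun b hb => by
    refine (IsUltrametricDist.norm_add_le_max _ _).trans (max_le norm_one.le ?_)
    rw [norm_mul]
    exact mul_le_one₀ h4 (norm_nonneg _) hb
  rw [e]
  refine (IsUltrametricDist.norm_add_le_max _ _).trans (max_le ?_
    ((IsUltrametricDist.norm_add_le_max _ _).trans (max_le ?_ ?_)))
  · rw [norm_mul]
    refine (mul_le_of_le_one_right (norm_nonneg _) ?_).trans hv
    exact (IsUltrametricDist.norm_add_le_max _ _).trans (max_le (hw.trans hsq) (h1 c hc))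
  · rw [norm_mul]
    exact (mul_le_of_le_one_right (norm_nonneg _) (h1 b hb)).trans hw
  · rw [norm_mul, norm_pow, norm_mul]
    exact mul_le_of_le_one_right (by positivity) (mul_le_one₀ hb (norm_nonneg _) hc)

theorem norm_pow_sub_le (hγ : γ ^ (p - 1) = -(p : PadicAlgCl p)) {v b : PadicAlgCl p}
    (hb : ‖b‖ ≤ 1) (hv : ‖v - 1 - γ * b‖ ≤ ‖γ‖ ^ 2) (n : ℕ) :
    ‖v ^ n - 1 - γ * (n * b)‖ ≤ ‖γ‖ ^ 2 := by
  induction n with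
  | zero => simp
  | succ n ih =>
    rw [pow_succ, Nat.cast_succ, add_mul, one_mul]
    refine norm_mul_sub_le hγ ?_ hb ih hv
    rw [norm_mul]
    exact mul_le_one₀ (PadicAlgCl.norm_natCast_le_one p n) (norm_nonneg _) hb

theorem norm_prod_sub_le (hγ : γ ^ (p - 1) = -(p : PadicAlgCl p)) {ι : Type*} (s : Finset ι)
    {v b : ι → PadicAlgCl p} (hb : ∀ i, ‖b i‖ ≤ 1)
    (hv : ∀ i, ‖v i - 1 - γ * b i‖ ≤ ‖γ‖ ^ 2) :
    ‖∏ i ∈ s, v i - 1 - γ * ∑ i ∈ s, b i‖ ≤ ‖γ‖ ^ 2 := by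
  classical
  induction s using Finset.induction_on with
  | empty => simp
  | insert i s hi ih =>
    rw [Finset.prod_insert hi, Finset.sum_insert hi]
    exact norm_mul_sub_le hγ (hb i)
      (IsUltrametricDist.norm_sum_le_of_forall_le_of_nonneg zero_le_one fun j _ => hb j) (hv i) ih

/-- With Y = y − 1, x − 1 ≡ Y^p modulo pY, and |p| = |γ|^(p−1) < |γ| because p > 2, so the error is
smaller than x − 1. -/
theorem norm_sub_one_of_pow_eq (hp2 : p ≠ 2) (hγ : γ ^ (p - 1) = -(p : PadicAlgCl p))
    {x y : PadicAlgCl p} (hx : ‖x - 1‖ = ‖γ‖) (hy : y ^ p = x) : ‖y - 1‖ ^ p = ‖γ‖ := by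
  have hp : p.Prime := Fact.out
  have h3 := norm_pos_of_pow_eq hγ
  have h4 := norm_lt_one_of_pow_eq hγ
  have hx1 : ‖x‖ ≤ 1 := by
    rw [← sub_add_cancel x 1]
    exact (IsUltrametricDist.norm_add_le_max _ _).trans (max_le (hx.le.trans h4.le) norm_one.le)
  have hy1 : ‖y‖ ≤ 1 := by
    rw [← hy, norm_pow] at hx1
    exact (pow_le_one_iff_of_nonneg (norm_nonneg _) hp.ne_zero).1 hx1
  have hY : ‖y - 1‖ ≤ 1 :=
    (IsUltrametricDist.norm_sub_le_max_norm _ _).trans (max_le hy1 norm_one.le)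
  have h := norm_add_pow_sub_le (x := (1 : PadicAlgCl p)) norm_one.le hY
  rw [add_sub_cancel, hy, one_pow] at h
  have hlt : ‖x - 1 - (y - 1) ^ p‖ < ‖x - 1‖ := by
    rw [hx]
    refine (h.trans (mul_le_of_le_one_right (norm_nonneg _) hY)).trans_lt ?_
    rw [← norm_pow_of_pow_eq hγ]
    exact pow_lt_self_of_lt_one₀ h3 h4 (by have := hp.two_le; omega)
  rw [← norm_pow, ← hx, ← norm_neg (x - 1)]
  rw [← norm_neg (x - 1)] at hlt
  have h6 := IsUltrametricDist.norm_add_eq_max_of_norm_ne_norm hlt.ne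
  rw [max_eq_right hlt.le] at h6
  rw [← h6, ← norm_neg]
  congr 1
  ring

/-- The multiplier `ω` of `γ` under an automorphism is congruent to the one of `ζ`. -/
theorem norm_div_sub_le [FiniteDimensional ℚ_[p] K] (hγ : γ ^ (p - 1) = -(p : PadicAlgCl p))
    (hζ : IsPrimitiveRoot ζ p) (σ : Gal((PadicAlgCl p)/K)) {u : ℕ} (hu : σ ζ = ζ ^ u) :
    ‖σ γ / γ - u‖ ≤ ‖γ‖ := by
  have hp : p.Prime := Fact.out
  have halg : Algebra.IsAlgebraic K (PadicAlgCl p) :=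
    Algebra.IsAlgebraic.tower_top (K := ℚ_[p]) _
  have hfγ : FiniteDimensional K K⟮γ⟯ :=
    adjoin.finiteDimensional (Algebra.IsIntegral.isIntegral γ)
  have h3 := norm_pos_of_pow_eq hγ
  obtain ⟨v, -, hv⟩ := exists_seriesHasValue_mem K⟮γ⟯ (mem_adjoin_simple_self K γ)
    (one_mem _) norm_one.le (tendsto_coeff_dworkSeries hγ)
  have hvp := isPrimitiveRoot_dworkSeries_one hγ hv
  have hpos : NeZero p := ⟨hp.ne_zero⟩
  obtain ⟨j, -, hj⟩ := hζ.eq_pow_of_pow_eq_one hvp.pow_eq_one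
  have hσv : σ v = v ^ u := by rw [← hj, map_pow, hu, ← pow_mul, ← pow_mul, mul_comm]
  have h1 := norm_seriesHasValue_sub_le hγ norm_one.le hv
  have h2 := norm_pow_sub_le hγ norm_one.le h1 u
  -- Applying σ to v ≡ 1 + γ gives v^u ≡ 1 + σγ, while raising to the power u gives v^u ≡ 1 + uγ,
  -- both modulo γ².
  rw [← PadicAlgCl.norm_algEquiv σ] at h1
  simp only [map_sub, map_one, mul_one] at h1
  rw [hσv] at h1
  have h5 : σ γ / γ - u = ((v ^ u - 1 - γ * (u * 1)) - (v ^ u - 1 - σ γ)) / γ := by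
    have : γ ≠ 0 := norm_pos_iff.1 h3
    field_simp
    ring
  rw [h5, norm_div, div_le_iff₀ h3, ← pow_two]
  exact (IsUltrametricDist.norm_sub_le_max_norm _ _).trans (max_le h2 h1)

theorem div_pow_prime_eq (hγ : γ ^ (p - 1) = -(p : PadicAlgCl p)) (σ : Gal((PadicAlgCl p)/K)) :
    (σ γ / γ) ^ p = σ γ / γ := by
  have hp : p.Prime := Fact.out
  have h : (σ γ / γ) ^ (p - 1) = 1 := by
    rw [div_pow, ← map_pow, hγ, map_neg, map_natCast, div_self]
    rw [neg_ne_zero]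
    exact norm_pos_iff.1 (PadicAlgCl.norm_prime_pos p)
  have h2 := pow_succ (σ γ / γ) (p - 1)
  rwa [Nat.sub_add_cancel hp.one_le, h, one_mul] at h2

/-- Replacing u by u^(p^k) does not change ζ^u, and each p-th power brings u closer to σγ/γ, which
is fixed by the p-th power map: the usual approximation of a Teichmüller representative. -/
theorem exists_nat_norm_div_sub_le [FiniteDimensional ℚ_[p] K]
    (hγ : γ ^ (p - 1) = -(p : PadicAlgCl p)) (hζ : IsPrimitiveRoot ζ p)
    (σ : Gal((PadicAlgCl p)/K)) :
    ∃ u : ℕ, σ ζ = ζ ^ u ∧ ‖σ γ / γ - u‖ ≤ ‖(p : PadicAlgCl p)‖ ^ 2 := by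
  have hp : p.Prime := Fact.out
  have hpos : NeZero p := ⟨hp.ne_zero⟩
  obtain ⟨u, -, hu⟩ := hζ.eq_pow_of_pow_eq_one (ξ := σ ζ) (by rw [← map_pow, hζ.pow_eq_one, map_one])
  have key : ∀ k : ℕ, ‖σ γ / γ - (u ^ p ^ k : ℕ)‖ ≤ ‖γ‖ ^ (k + 1) := by
    intro k
    induction k with
    | zero => simpa using norm_div_sub_le hγ hζ σ hu.symm
    | succ k ih =>
      have h4 := (norm_lt_one_of_pow_eq hγ).le
      have h := norm_pow_sub_pow_le (x := ((u ^ p ^ k : ℕ) : PadicAlgCl p)) (y := σ γ / γ) (r := ‖γ‖)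
        (PadicAlgCl.norm_natCast_le_one p _)
        (ih.trans (pow_le_of_le_one (norm_nonneg _) h4 (Nat.succ_ne_zero k))) h4
        (norm_prime_le_of_pow_eq hγ)
      rw [div_pow_prime_eq hγ, ← Nat.cast_pow, ← pow_mul, ← pow_succ] at h
      rw [pow_succ' _ (k + 1)]
      exact h.trans (by gcongr)
  -- The exponent 2p is generous: only |γ|^(2p+1) ≤ |γ|^(2(p−1)) = |p|² is needed.
  refine ⟨u ^ p ^ (2 * p), ?_, ?_⟩
  · rw [← hu]
    refine pow_eq_pow_of_modEq (n := p) ?_ hζ.pow_eq_one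
    rw [← ZMod.natCast_eq_natCast_iff]
    push_cast
    rw [ZMod.pow_card_pow]
  · refine (key _).trans ?_
    rw [← norm_pow_of_pow_eq hγ, ← pow_mul]
    exact pow_le_pow_of_le_one (norm_nonneg _) (norm_lt_one_of_pow_eq hγ).le (by omega)

/-- Both σγ/γ and −1 are fixed by the p-th power map (p is odd), and that map contracts their
distance by |γ| < 1; so they coincide. -/
theorem map_eq_neg_of_map_eq_inv [FiniteDimensional ℚ_[p] K] (hp2 : p ≠ 2)
    (hγ : γ ^ (p - 1) = -(p : PadicAlgCl p)) (hζ : IsPrimitiveRoot ζ p)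
    (σ : Gal((PadicAlgCl p)/K)) (hσ : σ ζ = ζ⁻¹) : σ γ = -γ := by
  have hp : p.Prime := Fact.out
  have h3 := norm_pos_of_pow_eq hγ
  have h4 := norm_lt_one_of_pow_eq hγ
  have h1 : σ ζ = ζ ^ (p - 1) := by
    rw [hσ]
    refine inv_eq_of_mul_eq_one_right ?_
    rw [← pow_succ', Nat.sub_add_cancel hp.one_le, hζ.pow_eq_one]
  have h2 := norm_div_sub_le hγ hζ σ h1
  rw [Nat.cast_sub hp.one_le, Nat.cast_one] at h2
  have h5 : ‖σ γ / γ - (-1)‖ ≤ ‖γ‖ := by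
    have : σ γ / γ - (-1) = (σ γ / γ - (p - 1)) + p := by ring
    rw [this]
    exact (IsUltrametricDist.norm_add_le_max _ _).trans (max_le h2 (norm_prime_le_of_pow_eq hγ))
  have h6 := norm_pow_sub_pow_le (x := (-1 : PadicAlgCl p)) (by simp) h5 h4.le
    (norm_prime_le_of_pow_eq hγ)
  rw [div_pow_prime_eq hγ, (hp.odd_of_ne_two hp2).neg_one_pow] at h6
  have h7 : ‖σ γ / γ - (-1)‖ = 0 := by
    by_contra h
    have := lt_of_le_of_ne (norm_nonneg _) (Ne.symm h)
    nlinarith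
  rw [norm_eq_zero, sub_eq_zero, div_eq_iff (norm_pos_iff.1 h3)] at h7
  rw [h7, neg_one_mul]

variable [FiniteDimensional ℚ_[p] K]

/-- With σγ = uγ + pc, the formal identity E_{σγ} = E_γ^u·E_c^p is evaluated at a. Accuracy |p|² in
the choice of u makes |c| ≤ |p||γ|, so E_c converges, and its value w lies in K(ζ) because c does.
-/
theorem exists_map_eq_pow_mul_pow
    (hN : HasNormValues K (Ω := PadicAlgCl p) ‖(p : PadicAlgCl p)‖) (hγ : γ ^ (p - 1) = -(p : PadicAlgCl p))
    (hζ : IsPrimitiveRoot ζ p) (σ : Gal((PadicAlgCl p)/K)) :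
    ∃ u : ℕ, σ ζ = ζ ^ u ∧ ∀ (a : K) (v : PadicAlgCl p), ‖algebraMap K (PadicAlgCl p) a‖ ≤ 1 →
      SeriesHasValue (dworkSeries p γ) (algebraMap K (PadicAlgCl p) a) v →
      ∃ w ∈ K⟮ζ⟯, σ v = v ^ u * w ^ p := by
  have hp : p.Prime := Fact.out
  have halg : Algebra.IsAlgebraic K (PadicAlgCl p) :=
    Algebra.IsAlgebraic.tower_top (K := ℚ_[p]) _
  have hfζ : FiniteDimensional K K⟮ζ⟯ :=
    adjoin.finiteDimensional (Algebra.IsIntegral.isIntegral ζ)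
  obtain ⟨u, hu, hun⟩ := exists_nat_norm_div_sub_le hγ hζ σ
  refine ⟨u, hu, fun a v ha hv => ?_⟩
  have hγm := (mem_adjoin_and_finrank_adjoin hN hγ hζ).1
  have hp0 := PadicAlgCl.norm_prime_pos p
  have hpne : (p : PadicAlgCl p) ≠ 0 := norm_pos_iff.1 hp0
  have hγne : γ ≠ 0 := norm_pos_iff.1 (norm_pos_of_pow_eq hγ)
  have hσγ : σ γ ∈ K⟮ζ⟯ := by
    have h1 : σ γ ∈ K⟮ζ⟯.map (σ : PadicAlgCl p →ₐ[K] PadicAlgCl p) := ⟨γ, hγm, rfl⟩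
    rw [adjoin_map, Set.image_singleton] at h1
    refine adjoin_simple_le_iff.2 ?_ h1
    change σ ζ ∈ _
    rw [hu]
    exact pow_mem (mem_adjoin_simple_self K ζ) u
  set c := (σ γ - u * γ) / p with hc
  have hcm : c ∈ K⟮ζ⟯ := div_mem (sub_mem hσγ (mul_mem (_root_.natCast_mem _ u) hγm)) (_root_.natCast_mem _ p)
  have hcn : ‖c‖ ≤ ‖(p : PadicAlgCl p)‖ * ‖γ‖ := by
    have : c = (σ γ / γ - u) * γ / p := by rw [hc]; field_simp
    rw [this, norm_div, norm_mul, div_le_iff₀ hp0]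
    calc _ ≤ ‖(p : PadicAlgCl p)‖ ^ 2 * ‖γ‖ := by gcongr
      _ = _ := by ring
  obtain ⟨w, hwm, hw⟩ := exists_seriesHasValue_mem K⟮ζ⟯ hcm (_root_.algebraMap_mem _ a) ha
    (tendsto_coeff_dworkSeries_small hγ hcn)
  refine ⟨w, hwm, ?_⟩
  have h1 := hv.map_algEquiv σ
  rw [AlgEquiv.commutes] at h1
  have h2 := (hv.pow u).mul (hw.pow p)
  rw [← dworkSeries_nsmul hp.ne_zero, ← dworkSeries_nsmul hp.ne_zero,
    ← dworkSeries_add hp.ne_zero] at h2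
  have h3 : u * γ + p * c = σ γ := by rw [hc, mul_div_cancel₀ _ hpne]; ring
  rw [h3] at h2
  exact h1.unique h2

/-- Here σγ = −γ, and E_{−γ}·E_γ = E_0 = 1. -/
theorem map_mul_self_eq_one_of_map_eq_inv (hp2 : p ≠ 2)
    (hγ : γ ^ (p - 1) = -(p : PadicAlgCl p)) (hζ : IsPrimitiveRoot ζ p)
    (σ : Gal((PadicAlgCl p)/K)) (hσ : σ ζ = ζ⁻¹) {a : K} {v : PadicAlgCl p}
    (hv : SeriesHasValue (dworkSeries p γ) (algebraMap K (PadicAlgCl p) a) v) :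
    σ v * v = 1 := by
  have h1 := hv.map_algEquiv σ
  rw [AlgEquiv.commutes, map_eq_neg_of_map_eq_inv hp2 hγ hζ σ hσ] at h1
  have h2 := h1.mul hv
  rw [← dworkSeries_add (Fact.out : p.Prime).ne_zero, neg_add_cancel,
    dworkSeries_zero (Fact.out : p.Prime).ne_zero] at h2
  exact h2.unique SeriesHasValue.one

end DworkGalois

/-! ### The abelian extension L = K(ζ, y) and its subfield of degree p -/

/-- `L = K(ζ, y)` is a totally ramified extension of `K`, with `y ^ p` a unit of level one in
`K(ζ)` on which the Galois group acts through the cyclotomic character, modulo `p`th powers. -/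
structure IsRamifiedKummer (p : ℕ) [Fact p.Prime] (K : Type*) {L : Type*} [Field K] [Field L]
    [Algebra K L] [Algebra K (PadicAlgCl p)] [Algebra L (PadicAlgCl p)] (ζ y : L) : Prop where
  odd : p ≠ 2
  prim : IsPrimitiveRoot ζ p
  finrank_adjoin : Module.finrank K K⟮ζ⟯ = p - 1
  adjoin_eq : adjoin K {ζ, y} = ⊤
  pow_mem : y ^ p ∈ K⟮ζ⟯
  conj : ∀ σ : Gal(L/K), ∃ u : ℕ, ∃ w ∈ K⟮ζ⟯, σ ζ = ζ ^ u ∧ σ y = y ^ u * w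
  inv : ∀ σ : Gal(L/K), σ ζ = ζ⁻¹ → σ (y ^ p) * y ^ p = 1
  values : HasNormValues K (Ω := PadicAlgCl p) ‖(p : PadicAlgCl p)‖
  norm_zeta : ‖algebraMap L (PadicAlgCl p) (ζ - 1)‖ ^ (p - 1) = ‖(p : PadicAlgCl p)‖
  norm_y : ‖algebraMap L (PadicAlgCl p) (y - 1)‖ ^ p = ‖algebraMap L (PadicAlgCl p) (ζ - 1)‖
  norm_map : ∀ (σ : Gal(L/K)) (z : L),
    ‖algebraMap L (PadicAlgCl p) (σ z)‖ = ‖algebraMap L (PadicAlgCl p) z‖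

namespace IsRamifiedKummer

variable {p : ℕ} [Fact p.Prime] {K L : Type*} [Field K] [Field L] [Algebra K L]
  [Algebra K (PadicAlgCl p)] [Algebra L (PadicAlgCl p)] {ζ y : L}

theorem norm_zeta_pos (h : IsRamifiedKummer p K ζ y) :
    0 < ‖algebraMap L (PadicAlgCl p) (ζ - 1)‖ :=
  norm_pos_of_pow_norm_eq (PadicAlgCl.norm_prime_pos p)
    (Nat.sub_ne_zero_of_lt (Fact.out : p.Prime).one_lt) h.norm_zeta

theorem norm_zeta_lt_one (h : IsRamifiedKummer p K ζ y) :
    ‖algebraMap L (PadicAlgCl p) (ζ - 1)‖ < 1 :=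
  norm_lt_one_of_pow_norm_eq (PadicAlgCl.norm_prime_lt_one p) h.norm_zeta

theorem norm_y_pos (h : IsRamifiedKummer p K ζ y) :
    0 < ‖algebraMap L (PadicAlgCl p) (y - 1)‖ :=
  norm_pos_of_pow_norm_eq h.norm_zeta_pos (Fact.out : p.Prime).ne_zero h.norm_y

theorem norm_y_lt_one (h : IsRamifiedKummer p K ζ y) :
    ‖algebraMap L (PadicAlgCl p) (y - 1)‖ < 1 :=
  norm_lt_one_of_pow_norm_eq h.norm_zeta_lt_one h.norm_y

theorem y_ne_zero (h : IsRamifiedKummer p K ζ y) : y ≠ 0 := by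
  intro h0
  have := h.norm_y_lt_one
  rw [h0, zero_sub, map_neg, norm_neg, map_one, norm_one] at this
  exact lt_irrefl _ this

theorem map_eq_self_of_mem_adjoin {S : Set L} {σ : Gal(L/K)} (hσ : ∀ x ∈ S, σ x = x) {w : L}
    (hw : w ∈ adjoin K S) : σ w = w :=
  (forall_mem_adjoin_smul_eq_self_iff K σ).2 hσ w hw

theorem eq_one (h : IsRamifiedKummer p K ζ y) {σ : Gal(L/K)} (h1 : σ ζ = ζ) (h2 : σ y = y) :
    σ = 1 := by
  refine AlgEquiv.ext fun z => map_eq_self_of_mem_adjoin (S := {ζ, y}) ?_ (h.adjoin_eq ▸ mem_top)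
  rintro x (rfl | rfl)
  exacts [h1, h2]

theorem map_eq_self_of_mem {σ : Gal(L/K)} (hσ : σ ζ = ζ) {w : L} (hw : w ∈ K⟮ζ⟯) : σ w = w :=
  map_eq_self_of_mem_adjoin (S := {ζ}) (by rintro x rfl; exact hσ) hw

/-- The automorphisms fixing `ζ` multiply `y` by roots of unity. -/
theorem exists_map_eq_pow_mul (h : IsRamifiedKummer p K ζ y) {σ : Gal(L/K)} (hσ : σ ζ = ζ) :
    ∃ k < p, σ y = ζ ^ k * y := by
  have : NeZero p := ⟨(Fact.out : p.Prime).ne_zero⟩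
  have h1 : (σ y / y) ^ p = 1 := by
    rw [div_pow, ← map_pow, map_eq_self_of_mem hσ h.pow_mem, div_self (pow_ne_zero _ h.y_ne_zero)]
  obtain ⟨k, hk, hk'⟩ := h.prim.eq_pow_of_pow_eq_one h1
  exact ⟨k, hk, by rw [hk', div_mul_cancel₀ _ h.y_ne_zero]⟩

/-- The cyclotomic character of `Gal(L/K)`. -/
noncomputable def character (h : IsRamifiedKummer p K ζ y) : Gal(L/K) →* (ZMod p)ˣ :=
  haveI : NeZero p := ⟨(Fact.out : p.Prime).ne_zero⟩
  h.prim.autToPow K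

theorem map_zeta (h : IsRamifiedKummer p K ζ y) (σ : Gal(L/K)) :
    σ ζ = ζ ^ (h.character σ : ZMod p).val := by
  have : NeZero p := ⟨(Fact.out : p.Prime).ne_zero⟩
  exact (h.prim.autToPow_spec K σ).symm

theorem character_eq_one_iff (h : IsRamifiedKummer p K ζ y) {σ : Gal(L/K)} :
    h.character σ = 1 ↔ σ ζ = ζ := by
  have : Fact (1 < p) := ⟨(Fact.out : p.Prime).one_lt⟩
  constructor
  · intro h1
    rw [h.map_zeta, h1, Units.val_one, ZMod.val_one, pow_one]
  · intro h1
    rw [h.map_zeta] at h1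
    conv_rhs at h1 => rw [← pow_one ζ]
    have h2 := h.prim.pow_inj (ZMod.val_lt _) (Fact.out : p.Prime).one_lt h1
    exact Units.ext (ZMod.val_injective p (by rw [h2, Units.val_one, ZMod.val_one]))

/-- The cyclotomic character has cyclic target, so a central kernel suffices. If g multiplies y by
ζ^k, then gσ and σg both multiply y^u w by ζ^(ku): this is where `conj`, with the same u for ζ and
y, is used. -/
theorem commute (h : IsRamifiedKummer p K ζ y) (σ τ : Gal(L/K)) : σ * τ = τ * σ := by
  refine (h.character.isMulCommutative_of_isCyclic_of_ker_le_center ?_).is_comm.comm σ τ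
  intro g hg
  have hgζ : g ζ = ζ := h.character_eq_one_iff.1 hg
  rw [Subgroup.mem_center_iff]
  intro σ
  obtain ⟨u, w, hw, hζ, hy⟩ := h.conj σ
  obtain ⟨k, -, hk⟩ := h.exists_map_eq_pow_mul hgζ
  have h1 : (σ * g) ζ = (g * σ) ζ := by
    rw [AlgEquiv.mul_apply, AlgEquiv.mul_apply, hgζ, hζ, map_pow, hgζ]
  have h2 : (σ * g) y = (g * σ) y := by
    rw [AlgEquiv.mul_apply, AlgEquiv.mul_apply, hk, hy, map_mul, map_mul, map_pow, map_pow, hk, hζ,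
      hy, map_eq_self_of_mem hgζ hw, mul_pow, ← pow_mul, ← pow_mul, mul_comm u k]
    ring
  have h3 : (g * σ)⁻¹ * (σ * g) = 1 := h.eq_one
    (by rw [AlgEquiv.mul_apply, h1, ← AlgEquiv.mul_apply, inv_mul_cancel, AlgEquiv.one_apply])
    (by rw [AlgEquiv.mul_apply, h2, ← AlgEquiv.mul_apply, inv_mul_cancel, AlgEquiv.one_apply])
  exact (inv_mul_eq_one.1 h3).symm

variable [IsScalarTower K L (PadicAlgCl p)] [FiniteDimensional K L]

theorem values_adjoin (h : IsRamifiedKummer p K ζ y) :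
    HasNormValues K⟮ζ⟯ (Ω := PadicAlgCl p) ‖algebraMap L (PadicAlgCl p) (ζ - 1)‖ :=
  hasNormValues_of_finrank_eq (t := (⟨ζ - 1, sub_mem (mem_adjoin_simple_self K ζ) (one_mem _)⟩ :
    K⟮ζ⟯)) h.values (PadicAlgCl.norm_prime_pos p) (PadicAlgCl.norm_prime_lt_one p)
    (Nat.sub_ne_zero_of_lt (Fact.out : p.Prime).one_lt) h.norm_zeta h.finrank_adjoin

theorem finrank_adjoin_top (h : IsRamifiedKummer p K ζ y) : Module.finrank K⟮ζ⟯ L = p := by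
  have hp : p.Prime := Fact.out
  refine le_antisymm ?_ (le_finrank_of_norm h.values_adjoin h.norm_zeta_pos h.norm_zeta_lt_one
    h.norm_y)
  have htop : K⟮ζ⟯⟮y⟯ = ⊤ := by
    apply restrictScalars_injective K
    rw [adjoin_adjoin_left, Set.singleton_union, h.adjoin_eq, restrictScalars_top]
  have hint : IsIntegral K⟮ζ⟯ y := Algebra.IsIntegral.isIntegral y
  rw [← finrank_top', ← htop, adjoin.finrank hint]
  have hne := (Polynomial.monic_X_pow_sub_C (⟨y ^ p, h.pow_mem⟩ : K⟮ζ⟯) hp.ne_zero).ne_zero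
  have := Polynomial.natDegree_le_of_dvd (minpoly.dvd K⟮ζ⟯ y
    (p := Polynomial.X ^ p - Polynomial.C (⟨y ^ p, h.pow_mem⟩ : K⟮ζ⟯)) (by
      simp [IntermediateField.algebraMap_apply])) hne
  rwa [Polynomial.natDegree_X_pow_sub_C] at this

theorem finrank_eq (h : IsRamifiedKummer p K ζ y) : Module.finrank K L = (p - 1) * p := by
  rw [← Module.finrank_mul_finrank K K⟮ζ⟯ L, h.finrank_adjoin, h.finrank_adjoin_top]

variable [IsGalois K L]

theorem card_gal (h : IsRamifiedKummer p K ζ y) : Nat.card Gal(L/K) = (p - 1) * p := by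
  rw [IsGalois.card_aut_eq_finrank, h.finrank_eq]

theorem card_ker (h : IsRamifiedKummer p K ζ y) : Nat.card h.character.ker = p := by
  have h1 : h.character.ker = fixingSubgroup K⟮ζ⟯ := by
    ext σ
    rw [MonoidHom.mem_ker, h.character_eq_one_iff, IntermediateField.mem_fixingSubgroup_iff]
    exact ⟨fun h1 x hx => map_eq_self_of_mem h1 hx, fun h1 => h1 ζ (mem_adjoin_simple_self K ζ)⟩
  rw [h1, IsGalois.card_fixingSubgroup_eq_finrank, h.finrank_adjoin_top]

theorem character_surjective (h : IsRamifiedKummer p K ζ y) :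
    Function.Surjective h.character := by
  have hp : p.Prime := Fact.out
  rw [← MonoidHom.range_eq_top]
  apply Subgroup.eq_top_of_card_eq
  have h1 := Subgroup.card_mul_index h.character.ker
  rw [h.card_ker, Subgroup.index_ker, h.card_gal, mul_comm] at h1
  rw [Nat.eq_of_mul_eq_mul_right hp.pos h1, Nat.card_eq_fintype_card, ZMod.card_units]

theorem exists_ne_one_map_zeta (h : IsRamifiedKummer p K ζ y) :
    ∃ g : Gal(L/K), ∃ k : ℕ, ¬ p ∣ k ∧ g ζ = ζ ∧ g y = ζ ^ k * y := by
  have hp : p.Prime := Fact.out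
  have : Nontrivial h.character.ker := by
    rw [← Finite.one_lt_card_iff_nontrivial, h.card_ker]
    exact hp.one_lt
  obtain ⟨⟨g, hg⟩, hne⟩ := exists_ne (1 : h.character.ker)
  have hgζ := h.character_eq_one_iff.1 hg
  obtain ⟨k, hk, hgy⟩ := h.exists_map_eq_pow_mul hgζ
  refine ⟨g, k, fun hd => hne (Subtype.ext (h.eq_one hgζ ?_)), hgζ, hgy⟩
  rw [hgy, (h.prim.pow_eq_one_iff_dvd k).2 hd, one_mul]

theorem isGalois_intermediateField (h : IsRamifiedKummer p K ζ y) (E : IntermediateField K L) :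
    IsGalois K E := by
  have : E.fixingSubgroup.Normal := ⟨fun n hn g => by
    rwa [h.commute g n, mul_inv_cancel_right]⟩
  rw [← IsGalois.fixedField_fixingSubgroup E]
  exact IsGalois.of_fixedField_normal_subgroup _

theorem card_fixingSubgroup_eq_iff (h : IsRamifiedKummer p K ζ y) (M : IntermediateField K L) :
    Nat.card M.fixingSubgroup = p - 1 ↔ Module.finrank K M = p := by
  have hp : p.Prime := Fact.out
  rw [IsGalois.card_fixingSubgroup_eq_finrank]
  have h1 := Module.finrank_mul_finrank K M L
  rw [h.finrank_eq] at h1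
  have hp1 := hp.one_lt
  constructor
  · intro h2
    rw [h2, mul_comm] at h1
    exact Nat.eq_of_mul_eq_mul_left (by omega) h1
  · intro h2
    rw [h2, mul_comm] at h1
    exact Nat.eq_of_mul_eq_mul_right (by omega) h1

/-- By Galois correspondence the claim concerns subgroups of order p − 1. Existence is
Schur–Zassenhaus applied to the kernel of the character, of order p; uniqueness uses commutativity.
-/
theorem existsUnique_finrank_eq (h : IsRamifiedKummer p K ζ y) :
    ∃! M : IntermediateField K L, Module.finrank K M = p := by
  have hp : p.Prime := Fact.out
  have hp1 := hp.one_lt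
  have hcop : Nat.Coprime p (p - 1) := (Nat.coprime_self_sub_right hp.one_le).2 (Nat.coprime_one_right p)
  have hidx : h.character.ker.index = p - 1 := by
    have h1 := Subgroup.card_mul_index h.character.ker
    rw [h.card_ker, h.card_gal, mul_comm] at h1
    exact Nat.eq_of_mul_eq_mul_right hp.pos h1
  obtain ⟨H, hH⟩ := Subgroup.exists_right_complement'_of_coprime (N := h.character.ker)
    (by rw [h.card_ker, hidx]; exact hcop)
  have hHc : Nat.card H = p - 1 := by
    have := hH.card_mul_card
    rw [h.card_ker, h.card_gal, mul_comm] at this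
    exact Nat.eq_of_mul_eq_mul_right hp.pos this
  refine ⟨fixedField H, ?_, fun M hM => ?_⟩
  · change Module.finrank K (fixedField H) = p
    rw [← h.card_fixingSubgroup_eq_iff, fixingSubgroup_fixedField, hHc]
  · rw [← IsGalois.fixedField_fixingSubgroup M]
    congr 1
    have hMc := (h.card_fixingSubgroup_eq_iff M).2 hM
    have hn : H.Normal := ⟨fun n hn g => by rwa [h.commute g n, mul_inv_cancel_right]⟩
    have hHi : H.index = p := by
      have := Subgroup.card_mul_index H
      rw [hHc, h.card_gal] at this
      exact Nat.eq_of_mul_eq_mul_left (by omega) this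
    refine Subgroup.eq_of_le_of_card_ge (fun σ hσ => ?_) (by rw [hHc, hMc])
    -- H is normal of index p, so σ^p lies in H; with σ^(p−1) = 1 this puts σ itself in H.
    have h1 : σ ^ (p - 1) = 1 := by
      have := pow_card_eq_one' (x := (⟨σ, hσ⟩ : M.fixingSubgroup))
      rw [hMc] at this
      exact congrArg Subtype.val this
    have h2 : σ ^ H.index ∈ H := H.pow_index_mem σ
    rwa [hHi, ← Nat.sub_add_cancel hp.one_le, pow_succ, h1, one_mul] at h2

end IsRamifiedKummer

theorem prime_ne_zero_of_algebra_padicAlgCl (p : ℕ) [Fact p.Prime] (K : Type*) [Field K]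
    [Algebra K (PadicAlgCl p)] : (p : K) ≠ 0 := by
  intro h
  have h1 := congrArg (algebraMap K (PadicAlgCl p)) h
  rw [map_natCast, map_zero] at h1
  exact norm_pos_iff.1 (PadicAlgCl.norm_prime_pos p) h1

/-! ### Traces and orthonormality of the conjugates of α -/

namespace IsRamifiedKummer

variable {p : ℕ} [Fact p.Prime] {K L : Type*} [Field K] [Field L] [Algebra K L]
  [Algebra K (PadicAlgCl p)] [Algebra L (PadicAlgCl p)] {ζ y : L}

theorem geom_sum_zeta_pow (h : IsRamifiedKummer p K ζ y) {k : ℕ} (hk : ¬ p ∣ k) :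
    ∑ i ∈ Finset.range p, ζ ^ (k * i) = 0 := by
  have hp : p.Prime := Fact.out
  simp only [pow_mul]
  exact (h.prim.pow_of_coprime k ((hp.coprime_iff_not_dvd.2 hk).symm)).geom_sum_eq_zero hp.one_lt

variable [IsScalarTower K L (PadicAlgCl p)] [FiniteDimensional K L] [IsGalois K L]

/-- The p elements ζ^(ki)·z are conjugate, so share one trace, and they sum to 0. -/
theorem trace_eq_zero (h : IsRamifiedKummer p K ζ y) {g : Gal(L/K)} (hg : g ζ = ζ) {k : ℕ}
    (hk : ¬ p ∣ k) {z : L} (hz : g z = ζ ^ k * z) : Algebra.trace K L z = 0 := by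
  have h1 : ∀ i : ℕ, Algebra.trace K L (ζ ^ (k * i) * z) = Algebra.trace K L z := by
    intro i
    induction i with
    | zero => simp
    | succ i ih =>
      have hgz : g (ζ ^ (k * i) * z) = ζ ^ (k * (i + 1)) * z := by
        rw [map_mul, map_pow, hg, hz]
        ring
      rw [← ih, ← hgz, Algebra.trace_eq_of_algEquiv g]
  have h2 : (p : K) * Algebra.trace K L z = 0 := by
    calc (p : K) * Algebra.trace K L z
        = ∑ i ∈ Finset.range p, Algebra.trace K L (ζ ^ (k * i) * z) := by simp [h1]
      _ = 0 := by
        rw [← map_sum, ← Finset.sum_mul, h.geom_sum_zeta_pow hk, zero_mul, map_zero]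
  exact (mul_eq_zero.1 h2).resolve_left (prime_ne_zero_of_algebra_padicAlgCl p K)

theorem trace_one (h : IsRamifiedKummer p K ζ y) :
    Algebra.trace K L (1 : L) = ((p : K) - 1) * p := by
  have h1 := Algebra.trace_algebraMap (S := L) (1 : K)
  rw [map_one, h.finrank_eq] at h1
  rw [h1, nsmul_eq_mul, Nat.cast_mul, Nat.cast_sub (Fact.out : p.Prime).one_le]
  simp

theorem prime_sub_one_ne_zero (p : ℕ) [Fact p.Prime] (K : Type*) [Field K]
    [Algebra K (PadicAlgCl p)] : (p : K) - 1 ≠ 0 := by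
  intro h
  have h1 := congrArg (algebraMap K (PadicAlgCl p)) h
  rw [map_sub, map_natCast, map_zero, map_one, sub_eq_zero] at h1
  have h2 := PadicAlgCl.norm_prime_lt_one p
  rw [h1, norm_one] at h2
  exact lt_irrefl _ h2

/-- The p − 1 nontrivial powers of ζ^k are conjugate and sum to −1; comparing with the trace of 1
and cancelling p − 1 gives the value. -/
theorem trace_zeta_pow (h : IsRamifiedKummer p K ζ y) {k : ℕ} (hk : ¬ p ∣ k) :
    Algebra.trace K L (ζ ^ k) = -(p : K) := by
  have hp : p.Prime := Fact.out
  have h1 : ∀ i ∈ Finset.range (p - 1), Algebra.trace K L (ζ ^ (k * (i + 1))) =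
      Algebra.trace K L (ζ ^ k) := by
    intro i hi
    have hi' : i + 1 < p := by have := Finset.mem_range.1 hi; omega
    obtain ⟨σ, hσ⟩ := h.character_surjective (ZMod.unitOfCoprime (i + 1)
      (Nat.coprime_of_lt_prime (Nat.succ_ne_zero i) hi' hp).symm)
    have hσζ : σ (ζ ^ k) = ζ ^ (k * (i + 1)) := by
      rw [map_pow, h.map_zeta, hσ, ZMod.coe_unitOfCoprime, ZMod.val_natCast, Nat.mod_eq_of_lt hi',
        ← pow_mul, mul_comm k]
    rw [← hσζ, Algebra.trace_eq_of_algEquiv σ]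
  have h2 : ∑ i ∈ Finset.range (p - 1 + 1), Algebra.trace K L (ζ ^ (k * i)) = 0 := by
    rw [Nat.sub_add_cancel hp.one_le, ← map_sum, h.geom_sum_zeta_pow hk, map_zero]
  rw [Finset.sum_range_succ', Finset.sum_congr rfl h1, mul_zero, pow_zero, h.trace_one,
    Finset.sum_const, Finset.card_range, nsmul_eq_mul, Nat.cast_sub hp.one_le, Nat.cast_one,
    ← mul_add] at h2
  exact eq_neg_of_add_eq_zero_left ((mul_eq_zero.1 h2).resolve_left (prime_sub_one_ne_zero p K))

section Subfield

variable {M : IntermediateField K L}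

theorem card_gal_subfield (h : IsRamifiedKummer p K ζ y) (hM : Module.finrank K M = p) :
    Nat.card Gal(L/M) = p - 1 := by
  rw [IsGalois.card_aut_eq_finrank, ← IsGalois.card_fixingSubgroup_eq_finrank,
    h.card_fixingSubgroup_eq_iff, hM]

/-- The order of δ divides both p − 1 (order of Δ) and p (order of the kernel of the character). -/
theorem eq_one_of_map_zeta (h : IsRamifiedKummer p K ζ y) (hM : Module.finrank K M = p)
    {δ : Gal(L/M)} (hδ : δ ζ = ζ) : δ = 1 := by
  have hp : p.Prime := Fact.out
  have h1 : δ ^ (p - 1) = 1 := by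
    rw [← h.card_gal_subfield hM]
    exact pow_card_eq_one'
  have h2 : δ ^ p = 1 := by
    apply AlgEquiv.restrictScalarsHom_injective K
    have hmem : AlgEquiv.restrictScalarsHom K δ ∈ h.character.ker :=
      h.character_eq_one_iff.2 hδ
    have := pow_card_eq_one' (x := (⟨_, hmem⟩ : h.character.ker))
    rw [h.card_ker] at this
    rw [map_pow, map_one]
    exact congrArg Subtype.val this
  rwa [← Nat.sub_add_cancel hp.one_le, pow_succ, h1, one_mul] at h2

/-- The cyclotomic character of `Gal(L/M)`. -/
noncomputable def characterOver (h : IsRamifiedKummer p K ζ y) (M : IntermediateField K L) :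
    Gal(L/M) →* (ZMod p)ˣ :=
  h.character.comp (AlgEquiv.restrictScalarsHom K)

theorem map_zeta_over (h : IsRamifiedKummer p K ζ y) (δ : Gal(L/M)) :
    δ ζ = ζ ^ (h.characterOver M δ : ZMod p).val :=
  h.map_zeta (δ.restrictScalars K)

theorem characterOver_bijective (h : IsRamifiedKummer p K ζ y) (hM : Module.finrank K M = p) :
    Function.Bijective (h.characterOver M) := by
  refine (Nat.bijective_iff_injective_and_card _).2 ⟨?_, ?_⟩
  · rw [injective_iff_map_eq_one]
    intro δ hδ
    exact h.eq_one_of_map_zeta hM (h.character_eq_one_iff.1 hδ)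
  · rw [h.card_gal_subfield hM, Nat.card_eq_fintype_card, ZMod.card_units]

theorem zeta_pow_val_neg_one (h : IsRamifiedKummer p K ζ y) :
    ζ ^ ((-1 : (ZMod p)ˣ) : ZMod p).val = ζ⁻¹ := by
  have hp : p.Prime := Fact.out
  refine (inv_eq_of_mul_eq_one_right ?_).symm
  rw [← pow_succ', h.prim.pow_eq_one_iff_dvd, ← ZMod.natCast_eq_zero_iff]
  push_cast
  rw [ZMod.natCast_val, ZMod.cast_id', id]
  simp

/-- The element of order two of `Gal(L/M)` inverts `y`. -/
theorem mul_map_eq_one (h : IsRamifiedKummer p K ζ y) (hM : Module.finrank K M = p) {δ : Gal(L/M)}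
    (hδ : h.characterOver M δ = -1) : y * δ y = 1 := by
  have hp : p.Prime := Fact.out
  have : NeZero p := ⟨hp.ne_zero⟩
  have hζ : δ ζ = ζ⁻¹ := by rw [h.map_zeta_over, hδ, h.zeta_pow_val_neg_one]
  have h1 : (y * δ y) ^ p = 1 := by
    have := h.inv (δ.restrictScalars K) hζ
    rw [mul_pow, ← map_pow, mul_comm]
    exact this
  -- So y·δy = ζ^j. It is fixed by δ, as δ² = 1, whereas δ inverts ζ; hence ζ^(2j) = 1, and p odd
  -- gives p ∣ j.
  obtain ⟨j, -, hj⟩ := h.prim.eq_pow_of_pow_eq_one h1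
  have h2 : δ * δ = 1 := h.eq_one_of_map_zeta hM (by
    rw [AlgEquiv.mul_apply, hζ, map_inv₀, hζ, inv_inv])
  have h3 : δ (y * δ y) = y * δ y := by
    rw [map_mul, ← AlgEquiv.mul_apply, h2, AlgEquiv.one_apply, mul_comm]
  rw [← hj, map_pow, hζ, inv_pow, eq_comm,
    ← mul_eq_one_iff_eq_inv₀ (pow_ne_zero j (h.prim.ne_zero hp.ne_zero)),
    ← pow_add, h.prim.pow_eq_one_iff_dvd] at h3
  have h4 : p ∣ j := by
    rw [← two_mul, hp.dvd_mul] at h3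
    exact h3.resolve_left fun h5 => h.odd ((Nat.prime_dvd_prime_iff_eq hp Nat.prime_two).1 h5)
  rw [← hj, h.prim.pow_eq_one_iff_dvd]
  exact h4

/-- Every automorphism of `M` lifts to an automorphism of `L` fixing `ζ`. -/
theorem exists_lift (h : IsRamifiedKummer p K ζ y) (hM : Module.finrank K M = p) (g : Gal(M/K)) :
    ∃ σ : Gal(L/K), (∀ m : M, σ m = (g m : L)) ∧ σ ζ = ζ := by
  have := h.isGalois_intermediateField M
  obtain ⟨τ, hτ⟩ := AlgEquiv.restrictNormalHom_surjective (F := K) (K₁ := M) L g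
  have hτ' : ∀ m : M, τ m = (g m : L) := fun m => by
    rw [← hτ]
    exact (AlgEquiv.restrictNormal_commutes τ M m).symm
  obtain ⟨δ, hδ⟩ := (h.characterOver_bijective hM).2 (h.character τ)
  -- Dividing an arbitrary lift τ by the element of Δ with the same character keeps the action on M
  -- and makes ζ fixed.
  refine ⟨τ * (AlgEquiv.restrictScalarsHom K δ)⁻¹, fun m => ?_, ?_⟩
  · rw [← map_inv, AlgEquiv.mul_apply, ← hτ']
    congr 1
    exact (δ⁻¹).commutes m
  · rw [← h.character_eq_one_iff, map_mul, map_inv, ← hδ]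
    exact mul_inv_cancel _

theorem trace_subfield (h : IsRamifiedKummer p K ζ y) (hM : Module.finrank K M = p) (z : M) :
    ((p : K) - 1) * Algebra.trace K M z = Algebra.trace K L (z : L) := by
  rw [← Algebra.trace_trace (S := M) (z : L)]
  have : Algebra.trace M L (z : L) = Module.finrank M L • z := Algebra.trace_algebraMap z
  rw [this, map_nsmul, nsmul_eq_mul, ← IsGalois.card_aut_eq_finrank, h.card_gal_subfield hM,
    Nat.cast_sub (Fact.out : p.Prime).one_le, Nat.cast_one]

theorem map_galTrace (z : L) (δ : Gal(L/M)) : δ (galTrace M z) = galTrace M z := by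
  rw [galTrace, map_sum]
  exact Fintype.sum_equiv (Equiv.mulLeft δ) _ _ fun τ => rfl

/-- If δ acts on ζ by the exponent c, a nontrivial Kummer automorphism multiplies y·δ(σy) by
ζ^(l(1+c)) with p ∤ l. Only c = −1 escapes `trace_eq_zero`, and for that δ the product is ζ^(−k),
since δ inverts y. -/
theorem trace_self_mul (h : IsRamifiedKummer p K ζ y) (hM : Module.finrank K M = p)
    {σ : Gal(L/K)} {k : ℕ} (hσ : σ ζ = ζ) (hσy : σ y = ζ ^ k * y) :
    ∑ δ : Gal(L/M), Algebra.trace K L (y * δ (σ y)) =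
      if p ∣ k then ((p : K) - 1) * p else -(p : K) := by
  have hp : p.Prime := Fact.out
  obtain ⟨ε, hε⟩ := (h.characterOver_bijective hM).2 (-1)
  rw [Finset.sum_eq_single ε]
  · have h1 : y * ε (σ y) = (ζ ^ k)⁻¹ := by
      rw [hσy, map_mul, map_pow, h.map_zeta_over, hε, h.zeta_pow_val_neg_one, inv_pow,
        mul_left_comm, h.mul_map_eq_one hM hε, mul_one]
    rw [h1]
    split_ifs with hk
    · rw [(h.prim.pow_eq_one_iff_dvd k).2 hk, inv_one, h.trace_one]
    · have h2 : (ζ ^ k)⁻¹ = ε (ζ ^ k) := by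
        rw [map_pow, h.map_zeta_over, hε, h.zeta_pow_val_neg_one, inv_pow]
      rw [h2]
      exact (Algebra.trace_eq_of_algEquiv (ε.restrictScalars K) _).trans (h.trace_zeta_pow hk)
  · intro δ _ hδ
    obtain ⟨g, l, hl, hg, hgy⟩ := h.exists_ne_one_map_zeta
    set c := (h.characterOver M δ : ZMod p).val with hc
    refine h.trace_eq_zero hg (k := l * (1 + c)) ?_ ?_
    · rw [hp.dvd_mul, not_or]
      refine ⟨hl, fun h1 => hδ ((h.characterOver_bijective hM).1 ?_)⟩
      rw [← ZMod.natCast_eq_zero_iff, hc] at h1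
      push_cast at h1
      rw [ZMod.natCast_val, ZMod.cast_id', id] at h1
      rw [hε]
      refine Units.ext ?_
      rw [Units.val_neg, Units.val_one]
      exact eq_neg_of_add_eq_zero_right h1
    · have h3 : g (δ (σ y)) = δ (σ (g y)) := by
        have h4 := h.commute g (δ.restrictScalars K * σ)
        have h5 := h.commute (δ.restrictScalars K * σ) g
        exact DFunLike.congr_fun h4 y
      rw [map_mul, h3, hgy, map_mul, map_mul, map_pow, map_pow, hσ, h.map_zeta_over, ← hc,
        ← pow_mul, mul_add, pow_add, mul_one, mul_comm c l]
      ring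
  · simp

theorem trace_y (h : IsRamifiedKummer p K ζ y) : Algebra.trace K L y = 0 := by
  obtain ⟨g, l, hl, hg, hgy⟩ := h.exists_ne_one_map_zeta
  exact h.trace_eq_zero hg hl hgy

/-- The trace form on the conjugates of `(1 + Tr_Δ(y)) / p`. -/
theorem trace_mul_map (h : IsRamifiedKummer p K ζ y) (hM : Module.finrank K M = p) {α : M}
    (hα : (α : L) = (1 + galTrace M y) / p) (g : Gal(M/K)) :
    (g = 1 → Algebra.trace K M (α * g α) = 1) ∧ (g ≠ 1 → Algebra.trace K M (α * g α) = 0) := by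
  have hp : p.Prime := Fact.out
  have hpK := prime_ne_zero_of_algebra_padicAlgCl p K
  have hpL := prime_ne_zero_of_algebra_padicAlgCl p L
  have hp1 := prime_sub_one_ne_zero p K
  obtain ⟨σ, hσM, hσ⟩ := h.exists_lift hM g
  obtain ⟨k, hkp, hσy⟩ := h.exists_map_eq_pow_mul hσ
  have hcard : Fintype.card Gal(L/M) = p - 1 := by
    rw [← Nat.card_eq_fintype_card, h.card_gal_subfield hM]
  have hTT : Algebra.trace K L (galTrace M y * σ (galTrace M y)) =
      ((p : K) - 1) * if p ∣ k then ((p : K) - 1) * p else -(p : K) := by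
    have h1 : σ (galTrace M y) = galTrace M (σ y) := by
      rw [galTrace, map_sum]
      exact Finset.sum_congr rfl fun δ _ =>
        DFunLike.congr_fun (h.commute σ (δ.restrictScalars K)) y
    have h2 : ∀ δ : Gal(L/M), Algebra.trace K L (δ y * galTrace M (σ y)) =
        if p ∣ k then ((p : K) - 1) * p else -(p : K) := by
      intro δ
      rw [← map_galTrace (M := M) (σ y) δ, ← map_mul,
        show Algebra.trace K L (δ (y * galTrace M (σ y))) = _ from
          Algebra.trace_eq_of_algEquiv (δ.restrictScalars K) _, galTrace, Finset.mul_sum, map_sum,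
        h.trace_self_mul hM hσ hσy]
    rw [h1]
    conv_lhs => rw [galTrace, Finset.sum_mul, map_sum]
    rw [Finset.sum_congr rfl fun δ _ => h2 δ, Finset.sum_const, Finset.card_univ, hcard,
      nsmul_eq_mul, Nat.cast_sub hp.one_le, Nat.cast_one]
  have hT : Algebra.trace K L (galTrace M y) = 0 := by
    rw [galTrace, map_sum]
    exact Finset.sum_eq_zero fun δ _ =>
      (Algebra.trace_eq_of_algEquiv (δ.restrictScalars K) y).trans h.trace_y
  have h3 : ((α * g α : M) : L) = algebraMap K L ((p : K) ^ 2)⁻¹ *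
      (1 + galTrace M y + σ (galTrace M y) + galTrace M y * σ (galTrace M y)) := by
    rw [MulMemClass.coe_mul, ← hσM, hα, map_div₀, map_add, map_one, map_natCast, map_inv₀, map_pow,
      map_natCast]
    field_simp
    ring
  have h4 := h.trace_subfield hM (α * g α)
  rw [h3, ← Algebra.smul_def, map_smul, map_add, map_add, map_add, hT, h.trace_one,
    Algebra.trace_eq_of_algEquiv σ, hT, hTT, smul_eq_mul] at h4
  have hk : p ∣ k ↔ g = 1 := by
    constructor
    · intro hd
      have h5 : σ = 1 := h.eq_one hσ (by rw [hσy, (h.prim.pow_eq_one_iff_dvd k).2 hd, one_mul])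
      refine AlgEquiv.ext fun m => Subtype.ext ?_
      rw [← hσM, h5]
      rfl
    -- If g = 1, then σ is the identity on M, hence belongs to Δ; as it fixes ζ it is trivial.
    · intro hg
      set δ : Gal(L/M) := AlgEquiv.ofRingEquiv (f := (σ : L ≃+* L)) (fun m => by
        have := hσM m
        rwa [hg] at this) with hδ
      have h5 : δ = 1 := h.eq_one_of_map_zeta hM hσ
      have h6 : σ y = y := DFunLike.congr_fun h5 y
      rw [← h.prim.pow_eq_one_iff_dvd]
      exact mul_right_cancel₀ h.y_ne_zero (by rw [← hσy, h6, one_mul])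
  -- In (1 + T)(1 + σT)/p², T = Tr_Δ(y), only 1 and T·σT have nonzero trace. They give (p−1)p +
  -- (p−1)²p = (p−1)p² when p ∣ k, and (p−1)p − (p−1)p = 0 otherwise.
  refine ⟨fun hg => mul_left_cancel₀ hp1 ?_, fun hg => mul_left_cancel₀ hp1 ?_⟩
  · rw [h4, if_pos (hk.2 hg)]
    field_simp
    ring
  · rw [h4, if_neg (fun hd => hg (hk.1 hd))]
    field_simp
    ring

end Subfield

end IsRamifiedKummer

/-! ### Integrality of traces and the self-dual lattice -/

namespace IsRamifiedKummer

variable {p : ℕ} [Fact p.Prime] {K L : Type*} [Field K] [Field L] [Algebra K L]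
  [Algebra K (PadicAlgCl p)] [Algebra L (PadicAlgCl p)] {ζ y : L}
  [IsScalarTower K L (PadicAlgCl p)] [FiniteDimensional K L] [IsGalois K L]

theorem norm_map_subfield (h : IsRamifiedKummer p K ζ y) {E : IntermediateField K L}
    (g : Gal(E/K)) (z : E) :
    ‖algebraMap L (PadicAlgCl p) (g z : L)‖ = ‖algebraMap L (PadicAlgCl p) (z : L)‖ := by
  have := h.isGalois_intermediateField E
  obtain ⟨τ, hτ⟩ := AlgEquiv.restrictNormalHom_surjective (F := K) (K₁ := E) L g
  have hτ' : (g z : L) = τ z := by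
    rw [← hτ]
    exact AlgEquiv.restrictNormal_commutes τ E z
  rw [hτ', h.norm_map]

theorem norm_trace_le_of_mem (h : IsRamifiedKummer p K ζ y) {d : L} (hd : d ∈ K⟮ζ⟯) :
    ‖algebraMap K (PadicAlgCl p) (Algebra.trace K L d)‖ ≤
      ‖(p : PadicAlgCl p)‖ * ‖algebraMap L (PadicAlgCl p) d‖ := by
  have := h.isGalois_intermediateField K⟮ζ⟯
  have h1 : Algebra.trace K L d = p * Algebra.trace K K⟮ζ⟯ ⟨d, hd⟩ := by
    rw [← Algebra.trace_trace (S := K⟮ζ⟯) d]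
    have : Algebra.trace K⟮ζ⟯ L d = Module.finrank K⟮ζ⟯ L • (⟨d, hd⟩ : K⟮ζ⟯) :=
      Algebra.trace_algebraMap (S := L) (⟨d, hd⟩ : K⟮ζ⟯)
    rw [this, map_nsmul, nsmul_eq_mul, h.finrank_adjoin_top]
  rw [h1, map_mul, norm_mul, map_natCast]
  refine mul_le_mul_of_nonneg_left ?_ (norm_nonneg _)
  rw [IsScalarTower.algebraMap_apply K K⟮ζ⟯ (PadicAlgCl p), trace_eq_sum_automorphisms, map_sum]
  exact IsUltrametricDist.norm_sum_le_of_forall_le_of_nonneg (norm_nonneg _) fun g _ =>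
    (h.norm_map_subfield g ⟨d, hd⟩).le

/-- In the binomial expansion every d·y^i with 0 < i < p is multiplied by a nontrivial power of ζ
under a Kummer automorphism, so only the constant term has a trace. -/
theorem trace_mul_sub_one_pow (h : IsRamifiedKummer p K ζ y) {d : L} (hd : d ∈ K⟮ζ⟯) {j : ℕ}
    (hj : j < p) : Algebra.trace K L (d * (y - 1) ^ j) = Algebra.trace K L (d * (-1) ^ j) := by
  have hp : p.Prime := Fact.out
  obtain ⟨g, l, hl, hg, hgy⟩ := h.exists_ne_one_map_zeta
  have h1 : ∀ i ∈ Finset.range j, Algebra.trace K L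
      (d * (y ^ (i + 1) * (-1) ^ (j - (i + 1)) * (j.choose (i + 1) : L))) = 0 := by
    intro i hi
    have hij := Finset.mem_range.1 hi
    refine h.trace_eq_zero hg (k := l * (i + 1)) ?_ ?_
    · rw [hp.dvd_mul, not_or]
      exact ⟨hl, fun h2 => by have := Nat.le_of_dvd (Nat.succ_pos i) h2; omega⟩
    · rw [map_mul, map_mul, map_mul, map_pow, map_pow, map_neg, map_one, map_natCast, hgy,
        map_eq_self_of_mem hg hd, mul_pow, ← pow_mul]
      ring
  rw [sub_eq_add_neg, add_pow, Finset.mul_sum, map_sum, Finset.sum_range_succ',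
    Finset.sum_eq_zero h1]
  simp

theorem norm_prime_eq_zpow (h : IsRamifiedKummer p K ζ y) : ‖(p : PadicAlgCl p)‖ =
    ‖algebraMap L (PadicAlgCl p) (ζ - 1)‖ ^ ((p : ℤ) - 1) := by
  rw [← h.norm_zeta, ← zpow_natCast, Nat.cast_sub (Fact.out : p.Prime).one_le, Nat.cast_one]

/-- The hypothesis is the bound satisfied by products of two elements of A. Expanding z in powers of
y − 1 over K(ζ) bounds the coefficients, and the discreteness of the value groups is used twice, in
K(ζ) and in K, to sharpen a strict inequality by one step. -/
theorem norm_trace_le_one (h : IsRamifiedKummer p K ζ y) {z : L}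
    (hz : ‖algebraMap L (PadicAlgCl p) z‖ ≤
      ‖algebraMap L (PadicAlgCl p) (y - 1)‖ ^ (((p : ℤ) - 1) * (2 - 2 * p))) :
    ‖algebraMap K (PadicAlgCl p) (Algebra.trace K L z)‖ ≤ 1 := by
  have hp : p.Prime := Fact.out
  have hp2 : (2 : ℤ) ≤ p := by exact_mod_cast hp.two_le
  obtain ⟨d, hd⟩ := exists_eq_sum_mul_pow_of_finrank_eq h.values_adjoin h.norm_zeta_pos
    h.norm_zeta_lt_one hp.ne_zero h.norm_y h.finrank_adjoin_top z
  set lam := ‖algebraMap L (PadicAlgCl p) (y - 1)‖ with hlam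
  set e := ‖algebraMap L (PadicAlgCl p) (ζ - 1)‖ with he
  have hl0 : 0 < lam := h.norm_y_pos
  have hl1 : lam < 1 := h.norm_y_lt_one
  have he0 : 0 < e := h.norm_zeta_pos
  have he1 : e < 1 := h.norm_zeta_lt_one
  have hel : ∀ k : ℤ, e ^ k = lam ^ (p * k) := fun k => by
    rw [zpow_mul, zpow_natCast, hlam, h.norm_y]
  have hdn : ∀ j, ‖algebraMap L (PadicAlgCl p) (d j : L)‖ ≤ e ^ (3 - 2 * (p : ℤ)) := by
    intro j
    have h1 := norm_mul_pow_le_norm_sum h.values_adjoin h.norm_zeta_pos h.norm_zeta_lt_one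
      h.norm_y d j
    have h2 : algebraMap L (PadicAlgCl p) z = ∑ i, algebraMap K⟮ζ⟯ (PadicAlgCl p) (d i) *
        algebraMap L (PadicAlgCl p) (y - 1) ^ (i : ℕ) := by
      rw [hd, map_sum]
      refine Finset.sum_congr rfl fun i _ => ?_
      rw [map_mul, map_pow]
      rfl
    rw [← h2, norm_mul, norm_pow, ← hlam] at h1
    have h3 : ‖algebraMap K⟮ζ⟯ (PadicAlgCl p) (d j)‖ ≤
        lam ^ (((p : ℤ) - 1) * (2 - 2 * p) - (j : ℕ)) := by
      rw [zpow_sub₀ hl0.ne', zpow_natCast, le_div_iff₀ (pow_pos hl0 _)]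
      exact h1.trans hz
    refine h.values_adjoin.norm_le_of_zpow_lt he0 he1 (h3.trans_lt ?_)
    -- The comparison amounts to j < 2(p − 1), true as j ≤ p − 1; strictness then improves e^(2−2p)
    -- to e^(3−2p).
    have hj : ((j : ℕ) : ℤ) < p := by exact_mod_cast j.2
    rw [hel]
    refine zpow_lt_zpow_right_of_lt_one₀ hl0 hl1 ?_
    nlinarith
  have hlt : ‖algebraMap K (PadicAlgCl p) (Algebra.trace K L z)‖ ≤ e ^ (2 - (p : ℤ)) := by
    rw [hd, map_sum, map_sum]
    refine IsUltrametricDist.norm_sum_le_of_forall_le_of_nonneg (zpow_nonneg he0.le _) fun j _ => ?_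
    rw [show Algebra.trace K L (algebraMap K⟮ζ⟯ L (d j) * (y - 1) ^ (j : ℕ)) = _ from
      h.trace_mul_sub_one_pow (d j).2 j.2]
    refine (h.norm_trace_le_of_mem
      (mul_mem (d j).2 (_root_.pow_mem (neg_mem (one_mem _)) _))).trans ?_
    rw [map_mul, map_pow, map_neg, map_one, norm_mul, norm_pow, norm_neg, norm_one, one_pow,
      mul_one, h.norm_prime_eq_zpow]
    calc _ ≤ e ^ ((p : ℤ) - 1) * e ^ (3 - 2 * (p : ℤ)) :=
          mul_le_mul_of_nonneg_left (hdn j) (zpow_nonneg he0.le _)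
      _ = _ := by rw [← zpow_add₀ he0.ne']; congr 1; ring
  -- The trace has norm at most e^(2−p) < e^(1−p) = |p|⁻¹, and norms on K are powers of |p|.
  have h4 := h.values.norm_le_of_zpow_lt (c := Algebra.trace K L z) (k := 0)
    (PadicAlgCl.norm_prime_pos p) (PadicAlgCl.norm_prime_lt_one p) (hlt.trans_lt ?_)
  · rwa [zpow_zero] at h4
  · rw [h.norm_prime_eq_zpow, ← zpow_mul]
    refine zpow_lt_zpow_right_of_lt_one₀ he0 he1 ?_
    linarith

section Subfield

variable {M : IntermediateField K L}

theorem exists_eq_of_forall_map_eq {z : L} (hz : ∀ δ : Gal(L/M), δ z = z) :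
    ∃ m : M, (m : L) = z :=
  (IsGalois.mem_range_algebraMap_iff_fixed z).2 hz

/-- The relative norm of y − 1 from L to M, a product of p − 1 factors of equal norm. -/
theorem exists_norm_eq (h : IsRamifiedKummer p K ζ y) (hM : Module.finrank K M = p) :
    ∃ ϖ : M, ‖algebraMap M (PadicAlgCl p) ϖ‖ =
      ‖algebraMap L (PadicAlgCl p) (y - 1)‖ ^ (p - 1) := by
  obtain ⟨ϖ, hϖ⟩ := exists_eq_of_forall_map_eq (M := M) (z := ∏ δ : Gal(L/M), δ (y - 1))
    fun δ => by
      rw [map_prod]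
      exact Fintype.prod_equiv (Equiv.mulLeft δ) _ _ fun τ => rfl
  refine ⟨ϖ, ?_⟩
  have h1 : algebraMap M (PadicAlgCl p) ϖ = algebraMap L (PadicAlgCl p) ϖ := rfl
  rw [h1, hϖ, map_prod, norm_prod, Finset.prod_congr rfl fun δ _ =>
    h.norm_map (δ.restrictScalars K) (y - 1), Finset.prod_const, Finset.card_univ,
    ← Nat.card_eq_fintype_card, h.card_gal_subfield hM]

theorem norm_y_pow_pow (h : IsRamifiedKummer p K ζ y) :
    (‖algebraMap L (PadicAlgCl p) (y - 1)‖ ^ (p - 1)) ^ p = ‖(p : PadicAlgCl p)‖ := by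
  rw [← pow_mul, mul_comm, pow_mul, h.norm_y, h.norm_zeta]

theorem values_subfield (h : IsRamifiedKummer p K ζ y) (hM : Module.finrank K M = p) :
    HasNormValues M (Ω := PadicAlgCl p) (‖algebraMap L (PadicAlgCl p) (y - 1)‖ ^ (p - 1)) := by
  obtain ⟨ϖ, hϖ⟩ := h.exists_norm_eq hM
  rw [← hϖ]
  refine hasNormValues_of_finrank_eq h.values (PadicAlgCl.norm_prime_pos p)
    (PadicAlgCl.norm_prime_lt_one p) (Fact.out : p.Prime).ne_zero ?_ hM
  rw [hϖ, h.norm_y_pow_pow]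

/-- The element `(1 + Tr_Δ(y)) / p` of `M`, and the bound on its norm. -/
theorem exists_generator (h : IsRamifiedKummer p K ζ y) (hM : Module.finrank K M = p) :
    ∃ α : M, (α : L) = (1 + galTrace M y) / p ∧ ‖algebraMap M (PadicAlgCl p) α‖ ≤
      (‖algebraMap L (PadicAlgCl p) (y - 1)‖ ^ (p - 1)) ^ (1 - (p : ℤ)) := by
  have hp : p.Prime := Fact.out
  obtain ⟨τ, hτ⟩ := exists_eq_of_forall_map_eq (M := M) (map_galTrace (M := M) y)
  have hp0 := PadicAlgCl.norm_prime_pos p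
  have hl0 : 0 < ‖algebraMap L (PadicAlgCl p) (y - 1)‖ ^ (p - 1) := pow_pos h.norm_y_pos _
  have hl1 : ‖algebraMap L (PadicAlgCl p) (y - 1)‖ ^ (p - 1) < 1 :=
    pow_lt_one₀ h.norm_y_pos.le h.norm_y_lt_one (Nat.sub_ne_zero_of_lt hp.one_lt)
  refine ⟨(1 + τ) / p, by rw [← hτ]; rfl, ?_⟩
  have hcard : Fintype.card Gal(L/M) = p - 1 := by
    rw [← Nat.card_eq_fintype_card, h.card_gal_subfield hM]
  -- Since Δ has p − 1 elements, the 1 in the definition of α makes up the constant p, so the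
  -- numerator has norm below 1. Lying in M, it is at most π in norm, and division by |p| = π^p
  -- yields the exponent 1 − p.
  have h1 : 1 + galTrace M y = p + ∑ δ : Gal(L/M), δ (y - 1) := by
    simp only [galTrace, map_sub, map_one, Finset.sum_sub_distrib, Finset.sum_const,
      Finset.card_univ, hcard, nsmul_eq_mul, mul_one, Nat.cast_sub hp.one_le, Nat.cast_one]
    ring
  have h2 : ‖algebraMap M (PadicAlgCl p) (1 + τ)‖ < 1 := by
    have : algebraMap M (PadicAlgCl p) (1 + τ) =
        algebraMap L (PadicAlgCl p) (p + ∑ δ : Gal(L/M), δ (y - 1)) := by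
      rw [← h1, ← hτ]
      rfl
    rw [this, map_add, map_natCast, map_sum]
    refine (IsUltrametricDist.norm_add_le_max _ _).trans_lt
      (max_lt (PadicAlgCl.norm_prime_lt_one p) (lt_of_le_of_lt ?_ h.norm_y_lt_one))
    exact IsUltrametricDist.norm_sum_le_of_forall_le_of_nonneg (norm_nonneg _) fun δ _ =>
      (h.norm_map (δ.restrictScalars K) (y - 1)).le
  have h3 := (h.values_subfield hM).norm_le_of_lt_zpow (k := 0) hl0 hl1 (by rwa [zpow_zero])
  rw [map_div₀, map_natCast, norm_div, div_le_iff₀ hp0, ← h.norm_y_pow_pow, ← zpow_natCast _ p,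
    ← zpow_add₀ hl0.ne']
  refine h3.trans_eq ?_
  congr 1
  ring

theorem norm_trace_mul_le_one (h : IsRamifiedKummer p K ζ y) (hM : Module.finrank K M = p)
    {z w : M} (hz : ‖algebraMap M (PadicAlgCl p) z‖ ≤
      (‖algebraMap L (PadicAlgCl p) (y - 1)‖ ^ (p - 1)) ^ (1 - (p : ℤ)))
    (hw : ‖algebraMap M (PadicAlgCl p) w‖ ≤
      (‖algebraMap L (PadicAlgCl p) (y - 1)‖ ^ (p - 1)) ^ (1 - (p : ℤ))) :
    ‖algebraMap K (PadicAlgCl p) (Algebra.trace K M (z * w))‖ ≤ 1 := by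
  have hp : p.Prime := Fact.out
  have hl0 := h.norm_y_pos
  have h1 : ‖algebraMap L (PadicAlgCl p) ((z * w : M) : L)‖ ≤
      ‖algebraMap L (PadicAlgCl p) (y - 1)‖ ^ (((p : ℤ) - 1) * (2 - 2 * p)) := by
    rw [MulMemClass.coe_mul, map_mul, norm_mul]
    refine (mul_le_mul hz hw (norm_nonneg _) (by positivity)).trans_eq ?_
    rw [← zpow_natCast, Nat.cast_sub hp.one_le, ← zpow_mul, ← zpow_add₀ hl0.ne']
    congr 1
    push_cast
    ring
  have h2 := h.norm_trace_le_one h1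
  rw [← h.trace_subfield hM, map_mul, norm_mul, map_sub, map_natCast, map_one] at h2
  have h3 : ‖(p : PadicAlgCl p) - 1‖ = 1 := by
    rw [← Nat.cast_one (R := PadicAlgCl p), ← Nat.cast_sub hp.one_le]
    refine PadicAlgCl.norm_natCast_eq_one fun h4 => ?_
    have := hp.one_lt
    have := Nat.le_of_dvd (by omega) h4
    omega
  rwa [h3, one_mul] at h2

theorem trace_map_mul_map (h : IsRamifiedKummer p K ζ y) (hM : Module.finrank K M = p) {α : M}
    (hα : (α : L) = (1 + galTrace M y) / p) (g g' : Gal(M/K)) :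
    (g = g' → Algebra.trace K M (g α * g' α) = 1) ∧
      (g ≠ g' → Algebra.trace K M (g α * g' α) = 0) := by
  have h1 : Algebra.trace K M (g α * g' α) = Algebra.trace K M (α * (g⁻¹ * g') α) := by
    have h0 : g (α * (g⁻¹ * g') α) = g α * g' α := by
      rw [map_mul, AlgEquiv.mul_apply]
      congr 1
      exact AlgEquiv.apply_symm_apply g _
    rw [← h0, Algebra.trace_eq_of_algEquiv]
  rw [h1]
  obtain ⟨h2, h3⟩ := h.trace_mul_map hM hα (g⁻¹ * g')
  exact ⟨fun hg => h2 (inv_mul_eq_one.2 hg), fun hg => h3 fun h4 => hg (inv_mul_eq_one.1 h4)⟩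

theorem trace_sum_mul (h : IsRamifiedKummer p K ζ y) (hM : Module.finrank K M = p) {α : M}
    (hα : (α : L) = (1 + galTrace M y) / p) (s : Gal(M/K) → K) (g : Gal(M/K)) :
    Algebra.trace K M ((∑ g', s g' • g' α) * g α) = s g := by
  rw [Finset.sum_mul, map_sum, Finset.sum_eq_single g]
  · rw [smul_mul_assoc, map_smul, (h.trace_map_mul_map hM hα g g).1 rfl, smul_eq_mul, mul_one]
  · intro g' _ hg'
    rw [smul_mul_assoc, map_smul, (h.trace_map_mul_map hM hα g' g).2 hg', smul_zero]
  · simp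

theorem eq_sum_trace_smul (h : IsRamifiedKummer p K ζ y) (hM : Module.finrank K M = p) {α : M}
    (hα : (α : L) = (1 + galTrace M y) / p) (z : M) :
    z = ∑ g : Gal(M/K), Algebra.trace K M (z * g α) • g α := by
  have := h.isGalois_intermediateField M
  have hli : LinearIndependent K fun g : Gal(M/K) => g α := by
    rw [Fintype.linearIndependent_iff]
    intro s hs g
    rw [← h.trace_sum_mul hM hα s g, hs, zero_mul, map_zero]
  have hspan := hli.span_eq_top_of_card_eq_finrank (by
    rw [← Nat.card_eq_fintype_card, IsGalois.card_aut_eq_finrank])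
  obtain ⟨s, hs⟩ := (Submodule.mem_span_range_iff_exists_fun K).1
    (hspan ▸ Submodule.mem_top : z ∈ _)
  have h1 : ∀ g, Algebra.trace K M (z * g α) = s g := fun g => by
    rw [← hs, h.trace_sum_mul hM hα]
  simp only [h1, hs]

/-- The coordinates of z in the orthonormal basis g(α) are its traces against that basis. On the
lattice they are integral because the form is; conversely integral coordinates stay in the lattice
because every g(α) lies in it. -/
theorem norm_le_iff_forall_norm_trace (h : IsRamifiedKummer p K ζ y)
    (hM : Module.finrank K M = p) {α : M} (hα : (α : L) = (1 + galTrace M y) / p)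
    (hαn : ‖algebraMap M (PadicAlgCl p) α‖ ≤
      (‖algebraMap L (PadicAlgCl p) (y - 1)‖ ^ (p - 1)) ^ (1 - (p : ℤ))) (z : M) :
    ‖algebraMap M (PadicAlgCl p) z‖ ≤
      (‖algebraMap L (PadicAlgCl p) (y - 1)‖ ^ (p - 1)) ^ (1 - (p : ℤ)) ↔
    ∀ g : Gal(M/K), ‖algebraMap K (PadicAlgCl p) (Algebra.trace K M (z * g α))‖ ≤ 1 := by
  have hg : ∀ g : Gal(M/K), ‖algebraMap M (PadicAlgCl p) (g α)‖ ≤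
      (‖algebraMap L (PadicAlgCl p) (y - 1)‖ ^ (p - 1)) ^ (1 - (p : ℤ)) :=
    fun g => (h.norm_map_subfield g α).trans_le hαn
  refine ⟨fun hz g => h.norm_trace_mul_le_one hM hz (hg g), fun hz => ?_⟩
  have hl0 := h.norm_y_pos
  rw [h.eq_sum_trace_smul hM hα z, map_sum]
  refine IsUltrametricDist.norm_sum_le_of_forall_le_of_nonneg (by positivity) fun g _ => ?_
  rw [Algebra.smul_def, map_mul, norm_mul, ← IsScalarTower.algebraMap_apply]
  exact (mul_le_of_le_one_left (norm_nonneg _) (hz g)).trans (hg g)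

end Subfield

end IsRamifiedKummer

/-! ### The inverse different and its square root -/

/-- Elements of J have square in S, so are integral and J ≤ 1; then 1 = J·J ≤ J. -/
theorem FractionalIdeal.eq_one_of_sq_eq_one {S F : Type*} [CommRing S] [Field F]
    [Algebra S F] [IsFractionRing S F] [IsDomain S] [IsIntegrallyClosed S] {J : FractionalIdeal S⁰ F}
    (hJ : J ^ 2 = 1) : J = 1 := by
  have h1 : J ≤ 1 := by
    intro z hz
    have h2 : z ^ 2 ∈ (1 : FractionalIdeal S⁰ F) := by
      rw [← hJ, sq, sq]
      exact FractionalIdeal.mul_mem_mul hz hz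
    obtain ⟨s, hs⟩ := (FractionalIdeal.mem_one_iff _).1 h2
    have h3 : IsIntegral S z := .of_pow two_pos (hs ▸ isIntegral_algebraMap)
    obtain ⟨t, ht⟩ := IsIntegrallyClosed.isIntegral_iff.1 h3
    exact (FractionalIdeal.mem_one_iff _).2 ⟨t, ht⟩
  refine le_antisymm h1 ?_
  calc (1 : FractionalIdeal S⁰ F) = J * J := by rw [← hJ, sq]
    _ ≤ J * 1 := mul_le_mul_right h1 J
    _ = J := mul_one J

theorem FractionalIdeal.eq_spanSingleton_of_sq_eq {S F : Type*} [CommRing S] [Field F]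
    [Algebra S F] [IsFractionRing S F] [IsDomain S] [IsIntegrallyClosed S] {A : FractionalIdeal S⁰ F} {b : F}
    (hb : b ≠ 0) (hA : A ^ 2 = FractionalIdeal.spanSingleton S⁰ (b ^ 2)) :
    A = FractionalIdeal.spanSingleton S⁰ b := by
  have h1 : A * FractionalIdeal.spanSingleton S⁰ b⁻¹ = 1 := by
    refine FractionalIdeal.eq_one_of_sq_eq_one ?_
    rw [mul_pow, hA, FractionalIdeal.spanSingleton_pow,
      FractionalIdeal.spanSingleton_mul_spanSingleton, ← mul_pow, mul_inv_cancel₀ hb, one_pow,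
      FractionalIdeal.spanSingleton_one]
  calc A = A * (FractionalIdeal.spanSingleton S⁰ b⁻¹ * FractionalIdeal.spanSingleton S⁰ b) := by
        rw [FractionalIdeal.spanSingleton_mul_spanSingleton, inv_mul_cancel₀ hb,
          FractionalIdeal.spanSingleton_one, mul_one]
    _ = _ := by rw [← mul_assoc, h1, one_mul]

section Integers

variable {p : ℕ} [Fact p.Prime] {K : Type*} [Field K] [Algebra ℚ_[p] K]
  [Algebra ℤ_[p] K] [IsScalarTower ℤ_[p] ℚ_[p] K] [Algebra K (PadicAlgCl p)]
  [IsScalarTower ℚ_[p] K (PadicAlgCl p)] {L : Type*} [Field L] [Algebra K L]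
  [Algebra L (PadicAlgCl p)] [IsScalarTower K L (PadicAlgCl p)]

theorem isIntegral_padicIntegers_iff_norm_le_one (M : IntermediateField K L) (z : M) :
    z ∈ integralClosure (padicIntegers p K) M ↔ ‖algebraMap M (PadicAlgCl p) z‖ ≤ 1 := by
  have : IsScalarTower ℤ_[p] K (PadicAlgCl p) := PadicAlgCl.isScalarTower_padicInt
  have : IsScalarTower ℤ_[p] (padicIntegers p K) (PadicAlgCl p) :=
    IsScalarTower.of_algebraMap_eq fun x => by
      rw [IsScalarTower.algebraMap_apply ℤ_[p] K (PadicAlgCl p)]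
      rfl
  have : IsScalarTower (padicIntegers p K) M (PadicAlgCl p) :=
    IsScalarTower.of_algebraMap_eq fun x =>
      IsScalarTower.algebraMap_apply K M (PadicAlgCl p) (x : K)
  rw [mem_integralClosure_iff, ← PadicAlgCl.isIntegral_iff_norm_le_one,
    ← isIntegral_algebraMap_iff (B := PadicAlgCl p) (algebraMap M (PadicAlgCl p)).injective]
  exact ⟨fun h => isIntegral_trans _ h, fun h => h.tower_top⟩

theorem mem_spanSingleton_iff_norm_le [FiniteDimensional K L] (M : IntermediateField K L) [IsFractionRing (integralClosure (padicIntegers p K) M) M] {b : M}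
    (hb : b ≠ 0) (z : M) :
    z ∈ FractionalIdeal.spanSingleton (integralClosure (padicIntegers p K) M)⁰ b ↔
      ‖algebraMap M (PadicAlgCl p) z‖ ≤ ‖algebraMap M (PadicAlgCl p) b‖ := by
  have hb' : 0 < ‖algebraMap M (PadicAlgCl p) b‖ := norm_pos_iff.2 (by simpa using hb)
  rw [FractionalIdeal.mem_spanSingleton]
  constructor
  · rintro ⟨s, rfl⟩
    rw [Algebra.smul_def, map_mul, norm_mul]
    exact mul_le_of_le_one_left hb'.le ((isIntegral_padicIntegers_iff_norm_le_one M s.1).1 s.2)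
  · intro hz
    refine ⟨⟨z / b, (isIntegral_padicIntegers_iff_norm_le_one M _).2 ?_⟩, ?_⟩
    · rw [map_div₀, norm_div]
      exact div_le_one_of_le₀ hz hb'.le
    · rw [Algebra.smul_def]
      exact div_mul_cancel₀ z hb

end Integers

namespace IsRamifiedKummer

variable {p : ℕ} [Fact p.Prime] {K : Type*} [Field K] [Algebra ℚ_[p] K]
  [Algebra ℤ_[p] K] [IsScalarTower ℤ_[p] ℚ_[p] K] [Algebra K (PadicAlgCl p)]
  [IsScalarTower ℚ_[p] K (PadicAlgCl p)] {L : Type*} [Field L] [Algebra K L]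
  [Algebra L (PadicAlgCl p)] [IsScalarTower K L (PadicAlgCl p)] [FiniteDimensional K L]
  [IsGalois K L] {ζ y : L} {M : IntermediateField K L}

theorem isFractionRing_padicIntegers [FiniteDimensional ℚ_[p] K] :
    IsFractionRing (padicIntegers p K) K :=
  integralClosure.isFractionRing_of_finite_extension ℚ_[p] K

theorem isFractionRing_integralClosure [FiniteDimensional ℚ_[p] K] (M : IntermediateField K L) :
    IsFractionRing (integralClosure (padicIntegers p K) M) M :=
  have : IsFractionRing (padicIntegers p K) K := isFractionRing_padicIntegers
  integralClosure.isFractionRing_of_finite_extension K M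

theorem exists_norm_eq_zpow (h : IsRamifiedKummer p K ζ y) (hM : Module.finrank K M = p) :
    ∃ b : M, b ≠ 0 ∧ ‖algebraMap M (PadicAlgCl p) b‖ =
      (‖algebraMap L (PadicAlgCl p) (y - 1)‖ ^ (p - 1)) ^ (1 - (p : ℤ)) := by
  obtain ⟨ϖ, hϖ⟩ := h.exists_norm_eq hM
  have h0 : ϖ ≠ 0 := by
    rintro rfl
    rw [map_zero, norm_zero] at hϖ
    exact (pow_pos h.norm_y_pos _).ne hϖ
  exact ⟨ϖ ^ (1 - (p : ℤ)), zpow_ne_zero _ h0, by rw [map_zpow₀, norm_zpow, hϖ]⟩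

/-- Here b generates the self-dual lattice A. Pairing z with 𝔒_M is pairing z/b with b𝔒_M = A, so z
lies in the dual of 𝔒_M exactly when z/b lies in A, that is z in b²𝔒_M. -/
theorem mem_traceDual_one_iff (h : IsRamifiedKummer p K ζ y) (hM : Module.finrank K M = p)
    {b : M} (hb : b ≠ 0) (hbn : ‖algebraMap M (PadicAlgCl p) b‖ =
      (‖algebraMap L (PadicAlgCl p) (y - 1)‖ ^ (p - 1)) ^ (1 - (p : ℤ))) (z : M) :
    z ∈ Submodule.traceDual (padicIntegers p K) K
        (1 : Submodule (integralClosure (padicIntegers p K) M) M) ↔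
      ‖algebraMap M (PadicAlgCl p) z‖ ≤ ‖algebraMap M (PadicAlgCl p) (b ^ 2)‖ := by
  have hb' : 0 < ‖algebraMap M (PadicAlgCl p) b‖ := norm_pos_iff.2 (by simpa using hb)
  have hz : ‖algebraMap M (PadicAlgCl p) z‖ ≤ ‖algebraMap M (PadicAlgCl p) (b ^ 2)‖ ↔
      ‖algebraMap M (PadicAlgCl p) (z / b)‖ ≤ ‖algebraMap M (PadicAlgCl p) b‖ := by
    rw [map_div₀, norm_div, div_le_iff₀ hb', map_pow, norm_pow, sq]
  obtain ⟨α, hα, hαn⟩ := h.exists_generator hM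
  have hrange : ∀ c : K, c ∈ (algebraMap (padicIntegers p K) K).range ↔
      ‖algebraMap K (PadicAlgCl p) c‖ ≤ 1 := fun c => by
    rw [← mem_padicIntegers_iff_norm_le_one]
    exact ⟨fun ⟨s, hs⟩ => hs ▸ s.2, fun hc => ⟨⟨c, hc⟩, rfl⟩⟩
  have hdual : z ∈ Submodule.traceDual (padicIntegers p K) K
        (1 : Submodule (integralClosure (padicIntegers p K) M) M) ↔
      ∀ w ∈ (1 : Submodule (integralClosure (padicIntegers p K) M) M),
        Algebra.traceForm K M z w ∈ (algebraMap (padicIntegers p K) K).range :=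
    forall₂_congr fun _ _ => Submodule.mem_one
  rw [hz, hdual]
  constructor
  · intro h1
    rw [hbn, h.norm_le_iff_forall_norm_trace hM hα hαn]
    intro g
    have hint : b⁻¹ * g α ∈ integralClosure (padicIntegers p K) M := by
      rw [isIntegral_padicIntegers_iff_norm_le_one, map_mul, map_inv₀, norm_mul, norm_inv,
        inv_mul_le_iff₀ hb', mul_one, hbn]
      exact (h.norm_map_subfield g α).trans_le hαn
    have h2 := (hrange _).1 (h1 (b⁻¹ * g α) (Submodule.mem_one.2 ⟨⟨_, hint⟩, rfl⟩))
    rwa [Algebra.traceForm_apply, ← mul_assoc, ← div_eq_mul_inv] at h2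
  · intro h1 w hw
    obtain ⟨s, rfl⟩ := Submodule.mem_one.1 hw
    have h2 := (isIntegral_padicIntegers_iff_norm_le_one M s.1).1 s.2
    rw [hrange, Algebra.traceForm_apply]
    have h3 : z * algebraMap _ M s = z / b * (b * (s : M)) := by
      rw [← mul_assoc, div_mul_cancel₀ z hb]
      rfl
    rw [h3]
    refine h.norm_trace_mul_le_one hM (h1.trans_eq hbn) ?_
    rw [map_mul, norm_mul, ← hbn]
    exact mul_le_of_le_one_right hb'.le h2

theorem isSqrtInverseDifferent_iff [FiniteDimensional ℚ_[p] K] (h : IsRamifiedKummer p K ζ y)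
    (hM : Module.finrank K M = p)
    {b : M} (hb : b ≠ 0) (hbn : ‖algebraMap M (PadicAlgCl p) b‖ =
      (‖algebraMap L (PadicAlgCl p) (y - 1)‖ ^ (p - 1)) ^ (1 - (p : ℤ)))
    (A : FractionalIdeal (integralClosure (padicIntegers p K) M)⁰ M) :
    IsSqrtInverseDifferent (padicIntegers p K) K A ↔
      (A : Set M) = {z : M | ‖algebraMap M (PadicAlgCl p) z‖ ≤
        (‖algebraMap L (PadicAlgCl p) (y - 1)‖ ^ (p - 1)) ^ (1 - (p : ℤ))} := by
  have : IsFractionRing (padicIntegers p K) K := isFractionRing_padicIntegers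
  have : IsFractionRing (integralClosure (padicIntegers p K) M) M :=
    isFractionRing_integralClosure M
  have : IsIntegrallyClosed (integralClosure (padicIntegers p K) M) :=
    integralClosure.isIntegrallyClosedOfFiniteExtension K
  have hsq : IsSqrtInverseDifferent (padicIntegers p K) K A ↔
      A ^ 2 = FractionalIdeal.spanSingleton _ (b ^ 2) := by
    rw [IsSqrtInverseDifferent, SetLike.ext_iff, SetLike.ext_iff]
    refine forall_congr' fun z => ?_
    rw [h.mem_traceDual_one_iff hM hb hbn, mem_spanSingleton_iff_norm_le M (pow_ne_zero 2 hb)]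
    rfl
  have hA : A = FractionalIdeal.spanSingleton _ b ↔ (A : Set M) =
      {z : M | ‖algebraMap M (PadicAlgCl p) z‖ ≤
        (‖algebraMap L (PadicAlgCl p) (y - 1)‖ ^ (p - 1)) ^ (1 - (p : ℤ))} := by
    rw [SetLike.ext_iff, Set.ext_iff]
    refine forall_congr' fun z => ?_
    rw [mem_spanSingleton_iff_norm_le M hb, hbn]
    rfl
  rw [hsq, ← hA]
  refine ⟨FractionalIdeal.eq_spanSingleton_of_sq_eq hb, fun h1 => ?_⟩
  rw [h1, FractionalIdeal.spanSingleton_pow]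

theorem existsUnique_isSqrtInverseDifferent [FiniteDimensional ℚ_[p] K]
    (h : IsRamifiedKummer p K ζ y) (hM : Module.finrank K M = p) :
    ∃! A : FractionalIdeal (integralClosure (padicIntegers p K) M)⁰ M,
      IsSqrtInverseDifferent (padicIntegers p K) K A := by
  obtain ⟨b, hb, hbn⟩ := h.exists_norm_eq_zpow hM
  have : IsFractionRing (integralClosure (padicIntegers p K) M) M :=
    isFractionRing_integralClosure M
  refine ⟨FractionalIdeal.spanSingleton _ b, ?_, fun A hA => ?_⟩
  · refine (h.isSqrtInverseDifferent_iff hM hb hbn _).2 ?_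
    ext z
    rw [SetLike.mem_coe, mem_spanSingleton_iff_norm_le M hb, hbn]
    rfl
  · replace hA := (h.isSqrtInverseDifferent_iff hM hb hbn A).1 hA
    refine SetLike.ext fun z => ?_
    rw [mem_spanSingleton_iff_norm_le M hb, hbn, ← SetLike.mem_coe, hA]
    rfl

theorem groupRingAct_eq (a : MonoidAlgebra (padicIntegers p K) Gal(M/K)) (z : M) :
    groupRingAct a z = ∑ g : Gal(M/K), (a.coeff g : K) • g z := by
  rw [groupRingAct, Finsupp.sum_fintype]
  · rfl
  · exact fun g => zero_smul _ _

theorem isSelfDualIntegralNormalBasisGenerator (h : IsRamifiedKummer p K ζ y)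
    (hM : Module.finrank K M = p) {α : M} (hα : (α : L) = (1 + galTrace M y) / p)
    (hαn : ‖algebraMap M (PadicAlgCl p) α‖ ≤
      (‖algebraMap L (PadicAlgCl p) (y - 1)‖ ^ (p - 1)) ^ (1 - (p : ℤ))) :
    IsSelfDualIntegralNormalBasisGenerator (padicIntegers p K) K
      {z : M | ‖algebraMap M (PadicAlgCl p) z‖ ≤
        (‖algebraMap L (PadicAlgCl p) (y - 1)‖ ^ (p - 1)) ^ (1 - (p : ℤ))} α where
  generates := by
    ext z
    rw [Set.mem_ofPred_eq, h.norm_le_iff_forall_norm_trace hM hα hαn]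
    constructor
    · rintro ⟨a, rfl⟩ g
      beta_reduce
      rw [groupRingAct_eq, h.trace_sum_mul hM hα, ← mem_padicIntegers_iff_norm_le_one]
      exact (a.coeff g).2
    · intro hz
      refine ⟨.ofCoeff (Finsupp.equivFunOnFinite.symm fun g =>
        ⟨_, mem_padicIntegers_iff_norm_le_one.2 (hz g)⟩), ?_⟩
      exact (groupRingAct_eq _ _).trans (h.eq_sum_trace_smul hM hα z).symm
  free := by
    intro a a' haa
    refine MonoidAlgebra.coeff_injective (Finsupp.ext fun g => Subtype.ext ?_)
    rw [← h.trace_sum_mul hM hα (fun g => (a.coeff g : K)) g,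
      ← h.trace_sum_mul hM hα (fun g => (a'.coeff g : K)) g, ← groupRingAct_eq, ← groupRingAct_eq]
    exact congrArg (fun z => Algebra.trace K M (z * g α)) haa
  trace_self g := (h.trace_map_mul_map hM hα g g).1 rfl
  trace_ne g g' := (h.trace_map_mul_map hM hα g g').2

end IsRamifiedKummer

/-! ### The element x as a product of Dwork values -/

section DworkProduct

variable {p : ℕ} [Fact p.Prime] {K : Type*} [Field K] [Algebra ℚ_[p] K]
  [Algebra K (PadicAlgCl p)] [IsScalarTower ℚ_[p] K (PadicAlgCl p)] [FiniteDimensional ℚ_[p] K]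
  {γ ζ : PadicAlgCl p}

/-- Any primitive root is E_γ(1)^j with p ∤ j, hence ≡ 1 + jγ mod γ² with j a unit. -/
theorem norm_isPrimitiveRoot_sub_one
    (hN : HasNormValues K (Ω := PadicAlgCl p) ‖(p : PadicAlgCl p)‖)
    (hγ : γ ^ (p - 1) = -(p : PadicAlgCl p)) (hζ : IsPrimitiveRoot ζ p) : ‖ζ - 1‖ = ‖γ‖ := by
  have hp : p.Prime := Fact.out
  have hpos : NeZero p := ⟨hp.ne_zero⟩
  have halg : Algebra.IsAlgebraic K (PadicAlgCl p) :=
    Algebra.IsAlgebraic.tower_top (K := ℚ_[p]) _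
  have hfζ : FiniteDimensional K K⟮ζ⟯ :=
    adjoin.finiteDimensional (Algebra.IsIntegral.isIntegral ζ)
  obtain ⟨v, -, hv⟩ := exists_seriesHasValue_mem K⟮ζ⟯
    (mem_adjoin_and_finrank_adjoin hN hγ hζ).1 (one_mem _) norm_one.le
    (tendsto_coeff_dworkSeries hγ)
  obtain ⟨j, -, hj, rfl⟩ := (isPrimitiveRoot_dworkSeries_one hγ hv).isPrimitiveRoot_iff.1 hζ
  refine norm_seriesHasValue_sub_one hγ ?_
    (norm_pow_sub_le hγ norm_one.le (norm_seriesHasValue_sub_le hγ norm_one.le hv) j)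
  rw [mul_one]
  exact PadicAlgCl.norm_natCast_eq_one ((hp.coprime_iff_not_dvd).1 hj.symm)

variable {ι : Type*} [Fintype ι] {a : ι → K} {e : ι → PadicAlgCl p} {n : ι → ℕ}

theorem norm_prod_pow_sub_one (hγ : γ ^ (p - 1) = -(p : PadicAlgCl p))
    (ha : ∀ i, ‖algebraMap K (PadicAlgCl p) (a i)‖ ≤ 1)
    (he : ∀ i, SeriesHasValue (dworkSeries p γ) (algebraMap K (PadicAlgCl p) (a i)) (e i))
    (hn : ‖∑ i, (n i : PadicAlgCl p) * algebraMap K (PadicAlgCl p) (a i)‖ = 1) :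
    ‖∏ i, e i ^ n i - 1‖ = ‖γ‖ := by
  refine norm_seriesHasValue_sub_one hγ hn (norm_prod_sub_le hγ _ (fun i => ?_) fun i =>
    norm_pow_sub_le hγ (ha i) (norm_seriesHasValue_sub_le hγ (ha i) (he i)) (n i))
  rw [norm_mul]
  exact mul_le_one₀ (PadicAlgCl.norm_natCast_le_one p _) (norm_nonneg _) (ha i)

theorem exists_map_prod_eq (hN : HasNormValues K (Ω := PadicAlgCl p) ‖(p : PadicAlgCl p)‖)
    (hγ : γ ^ (p - 1) = -(p : PadicAlgCl p)) (hζ : IsPrimitiveRoot ζ p)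
    (ha : ∀ i, ‖algebraMap K (PadicAlgCl p) (a i)‖ ≤ 1)
    (he : ∀ i, SeriesHasValue (dworkSeries p γ) (algebraMap K (PadicAlgCl p) (a i)) (e i))
    (σ : Gal((PadicAlgCl p)/K)) :
    ∃ u : ℕ, ∃ w ∈ K⟮ζ⟯, σ ζ = ζ ^ u ∧
      σ (∏ i, e i ^ n i) = (∏ i, e i ^ n i) ^ u * w ^ p := by
  obtain ⟨u, hu, hw⟩ := exists_map_eq_pow_mul_pow hN hγ hζ σ
  choose w hwm hw using fun i => hw (a i) (e i) (ha i) (he i)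
  refine ⟨u, ∏ i, w i ^ n i, prod_mem fun i _ => pow_mem (hwm i) _, hu, ?_⟩
  rw [map_prod, ← Finset.prod_pow, ← Finset.prod_pow, ← Finset.prod_mul_distrib]
  refine Finset.prod_congr rfl fun i _ => ?_
  rw [map_pow, hw]
  ring

theorem map_prod_mul_self_eq_one (hp2 : p ≠ 2) (hγ : γ ^ (p - 1) = -(p : PadicAlgCl p))
    (hζ : IsPrimitiveRoot ζ p)
    (he : ∀ i, SeriesHasValue (dworkSeries p γ) (algebraMap K (PadicAlgCl p) (a i)) (e i))
    (σ : Gal((PadicAlgCl p)/K)) (hσ : σ ζ = ζ⁻¹) :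
    σ (∏ i, e i ^ n i) * ∏ i, e i ^ n i = 1 := by
  rw [map_prod, ← Finset.prod_mul_distrib]
  refine Finset.prod_eq_one fun i _ => ?_
  rw [map_pow, ← mul_pow, map_mul_self_eq_one_of_map_eq_inv hp2 hγ hζ σ hσ (he i), one_pow]

end DworkProduct

/-! ### The concrete field K'(y) satisfies the abstract hypotheses -/

section KummerExt

theorem kummerExt_eq_adjoin (K : Type*) {Ω : Type*} [Field K] [Field Ω] [Algebra K Ω] (ζ y : Ω) :
    kummerExt K ζ y = adjoin K {ζ, y} := by
  rw [kummerExt, adjoin_adjoin_left, Set.singleton_union]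

theorem mem_kummerExt (K : Type*) {Ω : Type*} [Field K] [Field Ω] [Algebra K Ω] (ζ y : Ω) :
    ζ ∈ kummerExt K ζ y := by
  rw [kummerExt_eq_adjoin]
  exact subset_adjoin K _ (Set.mem_insert _ _)

theorem mem_adjoin_iff_coe_mem {K Ω : Type*} [Field K] [Field Ω] [Algebra K Ω]
    (L : IntermediateField K Ω) (z w : L) : w ∈ K⟮z⟯ ↔ (w : Ω) ∈ K⟮(z : Ω)⟯ := by
  rw [← lift_adjoin_simple, IntermediateField.mem_lift]

variable {p : ℕ} [Fact p.Prime] {K : Type*} [Field K] [Algebra ℚ_[p] K]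
  [Algebra K (PadicAlgCl p)] [IsScalarTower ℚ_[p] K (PadicAlgCl p)] {ζ x y : PadicAlgCl p}

/-- Extracting p-th roots leaves an ambiguity by a power of ζ, which is absorbed into w. -/
theorem exists_map_eq_pow_mul_of_pow (hζ : IsPrimitiveRoot ζ p) (hy : y ^ p = x) (hx : x ≠ 0)
    {σ : Gal((PadicAlgCl p)/K)}
    (hσ : ∃ u : ℕ, ∃ w ∈ K⟮ζ⟯, σ ζ = ζ ^ u ∧ σ x = x ^ u * w ^ p) :
    ∃ u : ℕ, ∃ w ∈ K⟮ζ⟯, σ ζ = ζ ^ u ∧ σ y = y ^ u * w := by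
  have hp : p.Prime := Fact.out
  have hpos : NeZero p := ⟨hp.ne_zero⟩
  obtain ⟨u, w, hw, hu, hσx⟩ := hσ
  have h1 : (σ y) ^ p = (y ^ u * w) ^ p := by
    rw [← map_pow, hy, hσx, ← hy]
    ring
  have h0 : y ^ u * w ≠ 0 := by
    intro h
    rw [h, zero_pow hp.ne_zero, ← map_pow, hy] at h1
    exact hx (by simpa using h1)
  obtain ⟨j, -, hj⟩ := hζ.eq_pow_of_pow_eq_one (ξ := σ y / (y ^ u * w))
    (by rw [div_pow, h1, div_self (pow_ne_zero _ h0)])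
  refine ⟨u, ζ ^ j * w, mul_mem (pow_mem (mem_adjoin_simple_self K ζ) _) hw, hu, ?_⟩
  rw [(eq_div_iff h0).1 hj |>.symm]
  ring

theorem isGalois_kummerExt
    (h : ∀ σ : Gal((PadicAlgCl p)/K), ∃ u : ℕ, ∃ w ∈ K⟮ζ⟯, σ ζ = ζ ^ u ∧ σ y = y ^ u * w) :
    IsGalois K (kummerExt K ζ y) := by
  have halg : Algebra.IsAlgebraic K (PadicAlgCl p) :=
    Algebra.IsAlgebraic.tower_top (K := ℚ_[p]) _
  have hchar : CharZero K := charZero_of_injective_algebraMap (algebraMap ℚ_[p] K).injective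
  have hac : IsAlgClosure K (PadicAlgCl p) := ⟨inferInstance, halg⟩
  have hnorm : Normal K (PadicAlgCl p) := IsAlgClosure.normal K _
  have : Normal K (kummerExt K ζ y) := by
    rw [normal_iff_forall_map_le']
    intro σ
    rw [kummerExt_eq_adjoin, adjoin_map, adjoin_le_iff, Set.image_pair, Set.pair_subset_iff]
    obtain ⟨u, w, hw, hu, hσy⟩ := h σ
    have h1 : ζ ∈ adjoin K {ζ, y} := subset_adjoin K _ (Set.mem_insert _ _)
    have h2 : y ∈ adjoin K {ζ, y} :=
      subset_adjoin K _ (Set.mem_insert_of_mem _ (Set.mem_singleton y))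
    have h3 : w ∈ adjoin K {ζ, y} :=
      adjoin.mono K _ _ (Set.singleton_subset_iff.2 (Set.mem_insert _ _)) hw
    refine ⟨?_, ?_⟩
    · exact hu ▸ pow_mem h1 u
    · exact hσy ▸ mul_mem (pow_mem h2 u) h3
  exact ⟨⟩

theorem isRamifiedKummer_kummerExt [FiniteDimensional ℚ_[p] K] {γ : PadicAlgCl p} (hp2 : p ≠ 2)
    (hN : HasNormValues K (Ω := PadicAlgCl p) ‖(p : PadicAlgCl p)‖)
    (hγ : γ ^ (p - 1) = -(p : PadicAlgCl p)) (hζ : IsPrimitiveRoot ζ p)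
    (hx : x ∈ K⟮ζ⟯) (hx1 : ‖x - 1‖ = ‖γ‖) (hy : y ^ p = x)
    (hσ : ∀ σ : Gal((PadicAlgCl p)/K), ∃ u : ℕ, ∃ w ∈ K⟮ζ⟯, σ ζ = ζ ^ u ∧ σ y = y ^ u * w)
    (hinv : ∀ σ : Gal((PadicAlgCl p)/K), σ ζ = ζ⁻¹ → σ x * x = 1) :
    IsRamifiedKummer p K (⟨ζ, mem_kummerExt K ζ y⟩ : kummerExt K ζ y) (kummerGen K ζ y) := by
  have halg : Algebra.IsAlgebraic K (PadicAlgCl p) :=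
    Algebra.IsAlgebraic.tower_top (K := ℚ_[p]) _
  have hac : IsAlgClosure K (PadicAlgCl p) := ⟨inferInstance, halg⟩
  have hnorm : Normal K (PadicAlgCl p) := IsAlgClosure.normal K _
  have hgal := isGalois_kummerExt hσ
  have hlift : ∀ τ : Gal((kummerExt K ζ y)/K), ∃ σ : Gal((PadicAlgCl p)/K),
      ∀ z : kummerExt K ζ y, (τ z : PadicAlgCl p) = σ z := fun τ => by
    obtain ⟨σ, rfl⟩ :=
      AlgEquiv.restrictNormalHom_surjective (F := K) (K₁ := kummerExt K ζ y) (PadicAlgCl p) τ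
    exact ⟨σ, fun z => AlgEquiv.restrictNormal_commutes σ (kummerExt K ζ y) z⟩
  have hζγ := norm_isPrimitiveRoot_sub_one hN hγ hζ
  refine
    { odd := hp2
      prim := hζ.of_map_of_injective (f := algebraMap (kummerExt K ζ y) (PadicAlgCl p))
        (algebraMap (kummerExt K ζ y) (PadicAlgCl p)).injective
      finrank_adjoin := ?_
      adjoin_eq := ?_
      pow_mem := ?_
      conj := ?_
      inv := ?_
      values := hN
      norm_zeta := ?_
      norm_y := ?_
      norm_map := ?_ }
  · rw [← (mem_adjoin_and_finrank_adjoin hN hγ hζ).2, (liftAlgEquiv _).toLinearEquiv.finrank_eq,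
      lift_adjoin_simple]
  · apply lift_injective
    rw [lift_adjoin, IntermediateField.lift_top, Set.image_pair]
    exact (kummerExt_eq_adjoin K ζ y).symm
  · rw [mem_adjoin_iff_coe_mem]
    change y ^ p ∈ K⟮ζ⟯
    rwa [hy]
  · intro τ
    obtain ⟨σ, hτ⟩ := hlift τ
    obtain ⟨u, w, hw, hu, hσy⟩ := hσ σ
    have hwL : w ∈ kummerExt K ζ y :=
      adjoin_le_iff.2 (Set.singleton_subset_iff.2 (mem_kummerExt K ζ y)) hw
    exact ⟨u, ⟨w, hwL⟩, (mem_adjoin_iff_coe_mem _ _ _).2 hw, Subtype.ext ((hτ _).trans hu),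
      Subtype.ext ((hτ _).trans hσy)⟩
  · intro τ hτζ
    obtain ⟨σ, hτ⟩ := hlift τ
    refine Subtype.ext ?_
    have h1 := hinv σ ((hτ ⟨ζ, mem_kummerExt K ζ y⟩).symm.trans (congrArg Subtype.val hτζ))
    rw [← hy] at h1
    rw [MulMemClass.coe_mul, hτ]
    exact h1
  · exact (congrArg (· ^ (p - 1)) hζγ).trans (norm_pow_of_pow_eq hγ)
  · exact (norm_sub_one_of_pow_eq hp2 hγ hx1 hy).trans hζγ.symm
  · intro τ z
    obtain ⟨σ, hτ⟩ := hlift τ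
    exact (congrArg norm (hτ z)).trans (PadicAlgCl.norm_algEquiv σ z)

end KummerExt

/-! ### The theorem -/

theorem mainTheorem2
    (p : ℕ) [Fact p.Prime] (hp : p ≠ 2)
    -- `K` is an unramified extension of `ℚ_p` of degree `d`, embedded in an algebraic closure of `ℚ_p`
    (K : Type*) [Field K] [Algebra ℚ_[p] K] [FiniteDimensional ℚ_[p] K]
    [Algebra ℤ_[p] K] [IsScalarTower ℤ_[p] ℚ_[p] K]
    [Algebra K (PadicAlgCl p)] [IsScalarTower ℚ_[p] K (PadicAlgCl p)]
    (hK : Algebra.FormallyUnramified ℤ_[p] (padicIntegers p K))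
    (d : ℕ) [NeZero d] (hd : Module.finrank ℚ_[p] K = d)
    -- a `ℤ_p`-basis of `𝔒_K` consisting of `(q - 1)`th roots of unity, with `q = p ^ d`
    (a : Module.Basis (Fin d) ℤ_[p] (padicIntegers p K))
    (ha0 : a 0 = 1) (ha : ∀ i, a i ^ (p ^ d - 1) = 1)
    (γ : PadicAlgCl p) (hγ : γ ^ (p - 1) = -(p : PadicAlgCl p))
    (ζ : PadicAlgCl p) (hζ : IsPrimitiveRoot ζ p)
    (e : Fin d → PadicAlgCl p)
    (he : ∀ i, e i = dworkValue p γ (algebraMap K (PadicAlgCl p) (a i : K)))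
    (n : Fin d → ℕ) (hn : ∀ i, n i ≤ p - 1) (hn0 : ∃ i, n i ≠ 0)
    -- `y = x ^ (1 / p)` with `x = ∏ e_i ^ n_i`
    (y : PadicAlgCl p) (hy : y ^ p = ∏ i, e i ^ n i) :
    -- the series defining the `e_i` converge
    (∀ i, Summable (dworkTerm p γ (algebraMap K (PadicAlgCl p) (a i : K)))) ∧
    -- `M` exists and is unique
    (∃! M : IntermediateField K (kummerExt K ζ y), Module.finrank K M = p) ∧
    ∀ M : IntermediateField K (kummerExt K ζ y), Module.finrank K M = p →
      IsGalois K M ∧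
      -- `A_{M/K}` exists and is unique
      (∃! A : FractionalIdeal (integralClosure (padicIntegers p K) M)⁰ M,
        IsSqrtInverseDifferent (padicIntegers p K) K A) ∧
      ∀ A : FractionalIdeal (integralClosure (padicIntegers p K) M)⁰ M,
        IsSqrtInverseDifferent (padicIntegers p K) K A →
        ∃ α : M,
          (α : kummerExt K ζ y) =
            (1 + galTrace M (kummerGen K ζ y)) / (p : kummerExt K ζ y) ∧
          IsSelfDualIntegralNormalBasisGenerator (padicIntegers p K) K {z : M | z ∈ A} α := by
  have hp' : p.Prime := Fact.out
  have ha1 : ∀ i, ‖algebraMap K (PadicAlgCl p) (a i : K)‖ ≤ 1 := fun i =>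
    mem_padicIntegers_iff_norm_le_one.1 (a i).2
  have hN : HasNormValues K (Ω := PadicAlgCl p) ‖(p : PadicAlgCl p)‖ := hasNormValues_padic a ha
  have halg : Algebra.IsAlgebraic K (PadicAlgCl p) :=
    Algebra.IsAlgebraic.tower_top (K := ℚ_[p]) _
  have hfζ : FiniteDimensional K K⟮ζ⟯ :=
    adjoin.finiteDimensional (Algebra.IsIntegral.isIntegral ζ)
  have hval : ∀ i, e i ∈ K⟮ζ⟯ ∧
      SeriesHasValue (dworkSeries p γ) (algebraMap K (PadicAlgCl p) (a i : K)) (e i) := fun i => by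
    obtain ⟨v, hvm, hv⟩ := exists_seriesHasValue_mem K⟮ζ⟯
      (mem_adjoin_and_finrank_adjoin hN hγ hζ).1 (K⟮ζ⟯.algebraMap_mem (a i : K)) (ha1 i)
      (tendsto_coeff_dworkSeries hγ)
    -- `dworkValue` is a `tsum`; convergence, already known, identifies it with the true limit
    -- rather than the default value 0.
    have hev : e i = v := (he i).trans (HasSum.tsum_eq hv)
    exact hev ▸ ⟨hvm, hv⟩
  have hx1 := norm_prod_pow_sub_one hγ ha1 (fun i => (hval i).2)
    (norm_sum_natCast_mul_eq_one a ha hn hn0)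
  have hx0 : ∏ i, e i ^ n i ≠ 0 := by
    intro h
    rw [h, zero_sub, norm_neg, norm_one] at hx1
    exact (norm_lt_one_of_pow_eq hγ).ne' hx1
  have hσ := fun σ => exists_map_eq_pow_mul_of_pow hζ hy hx0
    (exists_map_prod_eq (n := n) hN hγ hζ ha1 (fun i => (hval i).2) σ)
  have hgal := isGalois_kummerExt hσ
  have hmain := isRamifiedKummer_kummerExt hp hN hγ hζ
    (prod_mem fun i _ => pow_mem (hval i).1 _) hx1 hy hσ
    fun σ => map_prod_mul_self_eq_one hp hγ hζ (fun i => (hval i).2) σ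
  refine ⟨fun i => HasSum.summable (hval i).2, hmain.existsUnique_finrank_eq, fun M hM =>
    ⟨hmain.isGalois_intermediateField M, hmain.existsUnique_isSqrtInverseDifferent hM,
      fun A hA => ?_⟩⟩
  obtain ⟨b, hb, hbn⟩ := hmain.exists_norm_eq_zpow hM
  obtain ⟨α, hα, hαn⟩ := hmain.exists_generator hM
  refine ⟨α, hα, ?_⟩
  have hset := (hmain.isSqrtInverseDifferent_iff hM hb hbn A).1 hA
  have hgen := hmain.isSelfDualIntegralNormalBasisGenerator hM hα hαn
  rw [← hset] at hgen
  exact hgen
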